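/- Let $Q$ be a finite separated quiver without multiple arrows: its vertex set is a disjoint union $Q_v=\overset{\circ}{Q}\sqcup\overset{\bullet}{Q}$ of even and odd vertices, every arrow goes from an even to an odd vertex, and two different arrows do not have both the same start and the same end. Assume that the graph $G$ of $Q$ is an extended Dynkin graph (a cycle, $\widetilde D_n$ with $n\ge 4$, $\widetilde E_6$, $\widetilde E_7$ or $\widetilde E_8$), and let $\delta_G$ be its minimal positive imaginary root, i.e. the least nonzero vector $x\in\mathbb Z_{\ge 0}^{Q_v}$ with $\sum_{i}x_i^2-\sum_{\alpha: j\to i}x_jx_i=0$. A representation $T$ of $Q$ of dimension $\delta_G$ assigns to each vertex $i$ the unitary space $\mathbb C^{\delta_i}$ and to each arrow $j\to i$ a linear map $T_{ij}:\mathbb C^{\delta_j}\to\mathbb C^{\delta_i}$. It is orthoscalar if there are numbers $\chi_i\ge 0$ $(i\in Q_v)$ with $\sum_{j\to i}T_{ij}T_{ij}^*=\chi_iI$ for every odd $i$ and $\sum_{j\to i}T_{ij}^*T_{ij}=\chi_jI$ for every even $j$ (the last sum over the arrows that start in $j$). It is indecomposable if it is not an orthogonal direct sum of two nonzero representations. Representations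 $T,\widetilde T$ are unitarily equivalent if there are unitary $U_i$ with $U_iT_{ij}=\widetilde T_{ij}U_j$ for all arrows $j\to i$. Then the indecomposable orthoscalar representations of $Q$ of dimension $\delta_G$ depend, up to unitary equivalence, on exactly $m=|Q_v|+1$ positive parameters. That is, they exist, and each such representation $T$ has an open neighbourhood $O$ in the space of all representations of dimension $\delta_G$, with smooth functions $P:O\to\mathbb R^m$ and $F:W\to O$, where $W\subseteq(0,\infty)^m$ is open, such that, $X$ being the set of all indecomposable orthoscalar representations of dimension $\delta_G$: (i) if $R\in O\cap X$ and $R'\in X$ is unitarily equivalent to $R$, then $R'\in O$ and $P(R')=P(R)$; (ii) $F(w)\in X$ and $P(F(w))=w$ for all $w\in W$; (iii) if $R\in O\cap X$, then $P(R)\in W$ and $R$ is unitarily equivalent to its normal form $F(P(R))$. -/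

import Mathlib

open scoped ContDiff

universe u v

/-! ### Separated quivers without multiple arrows, and their graphs -/

section Quivers

variable (V : Type u) [Quiver.{v} V]

/-- `V = even ⊔ evenᶜ`, and every arrow starts in `even` and ends in its complement
(the set of odd vertices). -/
def IsSeparatedBy (even : Set V) : Prop :=
  ∀ i j : V, (i ⟶ j) → i ∈ even ∧ j ∉ even

/-- Two arrows with the same start and the same end are equal. -/
def HasNoMultipleArrows : Prop :=
  ∀ (i j : V) (a b : i ⟶ j), a = b

/-- The graph of a quiver (for a separated quiver without multiple arrows no edge is lost). -/
def quiverGraph : SimpleGraph V where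
  Adj i j := i ≠ j ∧ (Nonempty (i ⟶ j) ∨ Nonempty (j ⟶ i))
  symm := ⟨fun _ _ h => ⟨h.1.symm, h.2.symm⟩⟩
  loopless := ⟨fun _ h => h.1 rfl⟩

variable {V}

/-- The Tits form `∑ xᵢ² - ∑ₐ x_{t(a)} x_{h(a)}`. -/
def titsForm [Fintype V] [∀ i j : V, Fintype (i ⟶ j)] (x : V → ℤ) : ℤ :=
  ∑ i, x i ^ 2 - ∑ i, ∑ j, ∑ _a : (i ⟶ j), x i * x j

/-- `δ` is the minimal positive imaginary root of an extended Dynkin quiver: the least nonzero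
vector with non-negative integer coordinates at which the Tits form vanishes. -/
def IsMinimalImaginaryRoot [Fintype V] [∀ i j : V, Fintype (i ⟶ j)] (δ : V → ℕ) : Prop :=
  IsLeast {x : V → ℕ | x ≠ 0 ∧ titsForm (fun i => (x i : ℤ)) = 0} δ

end Quivers

/-! ### Extended Dynkin graphs -/

/-- The graph `D̃ₙ` with `n = m + 4`, on `n + 1` vertices: the path `1 - 2 - ⋯ - (n - 1)`, with
the vertex `0` attached to `2` and the vertex `n` attached to `n - 2`. -/
def graphDTilde (m : ℕ) : SimpleGraph (Fin (m + 5)) :=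
  SimpleGraph.fromRel fun i j =>
    (i.val = 0 ∧ j.val = 2) ∨
    (1 ≤ i.val ∧ j.val = i.val + 1 ∧ j.val ≤ m + 3) ∨
    (i.val = m + 2 ∧ j.val = m + 4)

/-- The graph `Ẽ₆`: the path `0 - 1 - 2 - 3 - 4`, and a further arm `2 - 5 - 6`. -/
def graphE6Tilde : SimpleGraph (Fin 7) :=
  SimpleGraph.fromRel fun i j =>
    (j.val = i.val + 1 ∧ j.val ≤ 4) ∨ (i.val = 2 ∧ j.val = 5) ∨ (i.val = 5 ∧ j.val = 6)

/-- The graph `Ẽ₇`: the path `0 - 1 - ⋯ - 6`, and the vertex `7` attached to `3`. -/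
def graphE7Tilde : SimpleGraph (Fin 8) :=
  SimpleGraph.fromRel fun i j =>
    (j.val = i.val + 1 ∧ j.val ≤ 6) ∨ (i.val = 3 ∧ j.val = 7)

/-- The graph `Ẽ₈`: the path `0 - 1 - ⋯ - 7`, and the vertex `8` attached to `5`. -/
def graphE8Tilde : SimpleGraph (Fin 9) :=
  SimpleGraph.fromRel fun i j =>
    (j.val = i.val + 1 ∧ j.val ≤ 7) ∨ (i.val = 5 ∧ j.val = 8)

/-- The simple extended Dynkin graphs: cycles, `D̃ₙ` with `n ≥ 4`, `Ẽ₆`, `Ẽ₇`, `Ẽ₈`. -/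
def IsExtendedDynkin {V : Type u} (G : SimpleGraph V) : Prop :=
  (∃ n, 3 ≤ n ∧ Nonempty (G ≃g SimpleGraph.cycleGraph n)) ∨
  (∃ m, Nonempty (G ≃g graphDTilde m)) ∨
  Nonempty (G ≃g graphE6Tilde) ∨
  Nonempty (G ≃g graphE7Tilde) ∨
  Nonempty (G ≃g graphE8Tilde)

/-! ### Representations in finite-dimensional Hilbert spaces -/

/-- The representations of a quiver of dimension `d`, on the standard unitary spaces `ℂ^(d i)`,
as a finite-dimensional normed space. -/
abbrev HilbertRep (V : Type u) [Quiver.{v} V] (d : V → ℕ) : Type (max u v) :=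
  ∀ i j : V, (i ⟶ j) → (EuclideanSpace ℂ (Fin (d i)) →L[ℂ] EuclideanSpace ℂ (Fin (d j)))

namespace HilbertRep

variable {V : Type u} [Quiver.{v} V] {d : V → ℕ}

/-- Orthoscalar representations of a separated quiver: with `χᵢ ≥ 0`,
`∑ T_{ij} T_{ij}* = χᵢ I` at odd `i` (sum over the arrows that end in `i`) and
`∑ T_{ij}* T_{ij} = χⱼ I` at even `j` (sum over the arrows that start in `j`). -/
def IsOrthoscalar [Fintype V] [∀ i j : V, Fintype (i ⟶ j)] (even : Set V)
    (T : HilbertRep V d) : Prop :=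
  ∃ χ : V → ℝ, (∀ i, 0 ≤ χ i) ∧
    (∀ i, i ∉ even → ∑ j, ∑ a : (j ⟶ i), (T j i a) ∘L ContinuousLinearMap.adjoint (T j i a) =
      (χ i : ℂ) • ContinuousLinearMap.id ℂ (EuclideanSpace ℂ (Fin (d i)))) ∧
    (∀ j, j ∈ even → ∑ i, ∑ a : (j ⟶ i), ContinuousLinearMap.adjoint (T j i a) ∘L (T j i a) =
      (χ j : ℂ) • ContinuousLinearMap.id ℂ (EuclideanSpace ℂ (Fin (d j))))

/-- Indecomposability in the category of (orthoscalar) Hilbert space representations: `T` is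
nonzero and is not the orthogonal direct sum of two nonzero representations, the summands being
given by subspaces `M i` and their orthogonal complements. (Summands of an orthoscalar
representation are orthoscalar.) -/
def IsIndecomposable (T : HilbertRep V d) : Prop :=
  d ≠ 0 ∧
  ∀ M : ∀ i : V, Submodule ℂ (EuclideanSpace ℂ (Fin (d i))),
    (∀ (i j : V) (a : i ⟶ j), ∀ x ∈ M i, T i j a x ∈ M j) →
    (∀ (i j : V) (a : i ⟶ j), ∀ x ∈ (M i)ᗮ, T i j a x ∈ (M j)ᗮ) →
    (∀ i, M i = ⊥) ∨ (∀ i, M i = ⊤)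

/-- Unitary equivalence: `Uⱼ T_a = T'_a Uᵢ` for every arrow `a : i ⟶ j`, with all `Uᵢ` unitary. -/
def UnitarilyEquivalent (T T' : HilbertRep V d) : Prop :=
  ∃ U : ∀ i : V, EuclideanSpace ℂ (Fin (d i)) ≃ₗᵢ[ℂ] EuclideanSpace ℂ (Fin (d i)),
    ∀ (i j : V) (a : i ⟶ j) (x : EuclideanSpace ℂ (Fin (d i))),
      U j (T i j a x) = T' i j a (U i x)

/-- The nonempty family `X` of representations of dimension `d` depends, up to unitary
equivalence, on exactly `m` positive parameters. Around every `T ∈ X` there are a smooth normal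
form `F`, defined on an open set `W` of parameter values in the open positive orthant of `ℝ^m`,
and smooth functions `P = (P₁, …, Pₘ)` on a neighbourhood `O` of `T`, such that
* on `X` both `O` and `P` are invariant under unitary equivalence,
* all parameter values are admissible and independent: `F w ∈ O ∩ X` and `P (F w) = w` on `W`,
* the parameters are a complete system: a member `R` of `X` in `O` has parameters `P R ∈ W`, and
  it is unitarily equivalent to its normal form `F (P R)`. -/
def DependsOnPositiveParameters [Fintype V] [∀ i j : V, Fintype (i ⟶ j)]
    (X : Set (HilbertRep V d)) (m : ℕ) : Prop :=
  X.Nonempty ∧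
  ∀ T ∈ X, ∃ (O : Set (HilbertRep V d)) (W : Set (Fin m → ℝ))
    (P : HilbertRep V d → (Fin m → ℝ)) (F : (Fin m → ℝ) → HilbertRep V d),
    IsOpen O ∧ T ∈ O ∧ IsOpen W ∧ (∀ w ∈ W, ∀ k, 0 < w k) ∧
    ContDiffOn ℝ ∞ P O ∧ ContDiffOn ℝ ∞ F W ∧
    (∀ R ∈ O ∩ X, ∀ R' ∈ X, UnitarilyEquivalent R R' → R' ∈ O ∧ P R' = P R) ∧
    (∀ w ∈ W, F w ∈ O ∩ X ∧ P (F w) = w) ∧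
    (∀ R ∈ O ∩ X, P R ∈ W ∧ UnitarilyEquivalent R (F (P R)))

end HilbertRep

/-! A representation becomes one matrix `M`, indexed by the basis vectors of all the spaces and
supported on the arrow blocks. Unitary equivalence is conjugation by block diagonal unitaries,
indecomposability says that only scalars among the block diagonal matrices commute with `M` and
`Mᴴ`, and orthoscalarity says that the block diagonal part of `M * Mᴴ - Mᴴ * M`, a moment map, is a
real scalar on each block. The signs cause no trouble because every vertex is only a source or only
a target.

The count is infinitesimal. For balanced `T`, a block diagonal `g` commuting with `T` has an adjoint
commuting with `T` (`conjTranspose_commute`). So at an irreducible balanced `T` the infinitesimal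
stabilizer is the scalars, and the linearized moment map is onto the block diagonal matrices of
trace zero (`exists_momentLin_eq`). The vanishing Tits form says that the arrow matrices and the
block diagonal matrices have equal dimension, so the kernel has complex dimension 1. The block
scalars may vary subject to one trace relation. Modulo the unitary orbit this gives `2 + (|V| - 1) =
|V| + 1` real directions.

A slice makes this local. Balanced matrices whose linearized moment at `T` is Hermitian form the
zero set of `sliceMap`, a manifold of that dimension near `T`. The gauge condition is the critical
equation of the distance to `T` on a unitary orbit, so compactness puts a point of each nearby orbit
on the slice (`exists_closest`). Coordinates are real traces of smooth equivariant matrix functions.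
A direction killed by all their differentials defines a derivation of the full matrix algebra (by
Burnside's theorem); derivations are inner, so the direction is tangent to the orbit, and within the
slice it is zero. Thus invariants are coordinates on the slice, and the inverse chart is the normal
form (`exists_local_parameters`).

For existence, a sum of squares identifies the minimal root with an explicit labelling, and each
extended Dynkin graph gets an explicit irreducible real model. For the graphs of type E, two arms at
the branch vertex add up to a Jacobi matrix `J`; since `J` has simple spectrum, `c - J` with `c` its
top eigenvalue has corank one and can be carried down the remaining arm. -/

/-! ### Block matrices -/

namespace BlockMatrix

open Matrix Module
open scoped ComplexOrder

set_option linter.unusedSectionVars false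

section Basic

variable {I : Type*} [Fintype I] [DecidableEq I] {V : Type*} [DecidableEq V]

/-- The matrices whose entries vanish outside the positions in `p`. -/
def supportedOn (p : I → I → Prop) : Submodule ℂ (Matrix I I ℂ) where
  carrier := {M | ∀ x y, ¬ p x y → M x y = 0}
  add_mem' := fun ha hb x y h => by simp [ha x y h, hb x y h]
  zero_mem' := fun _ _ _ => rfl
  smul_mem' := fun c M hM x y h => by simp [hM x y h]

theorem finrank_supportedOn (p : I → I → Prop) :
    finrank ℂ (supportedOn p) = Nat.card {xy : I × I // p xy.1 xy.2} := by
  classical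
  let e : supportedOn p ≃ₗ[ℂ] ({xy : I × I // p xy.1 xy.2} → ℂ) :=
    { toFun := fun M xy => M.1 xy.1.1 xy.1.2
      map_add' := fun _ _ => rfl
      map_smul' := fun _ _ => rfl
      invFun := fun f => ⟨Matrix.of fun x y => if h : p x y then f ⟨(x, y), h⟩ else 0,
        fun x y h => by simp [h]⟩
      left_inv := fun M => by
        ext x y
        by_cases h : p x y
        · simp [h]
        · simp [h, M.2 x y h]
      right_inv := fun f => by
        ext ⟨⟨x, y⟩, h⟩
        simp only at h
        simp [h] }
  rw [e.finrank_eq, finrank_fintype_fun_eq_card, Nat.card_eq_fintype_card]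

variable (κ : I → V)

/-- The algebra of block diagonal matrices, the blocks being the fibres of `κ`. -/
def blockDiag : Subalgebra ℂ (Matrix I I ℂ) where
  carrier := {M | ∀ x y, κ x ≠ κ y → M x y = 0}
  add_mem' := fun ha hb x y h => by simp [ha x y h, hb x y h]
  mul_mem' := fun {a b} ha hb x y h => by
    rw [Matrix.mul_apply]
    refine Finset.sum_eq_zero fun z _ => ?_
    by_cases hz : κ x = κ z
    · rw [hb z y (hz ▸ h), mul_zero]
    · rw [ha x z hz, zero_mul]
  algebraMap_mem' := fun r x y h => by
    rw [Matrix.algebraMap_matrix_apply, if_neg (fun e => h (congrArg κ e))]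

variable {κ}

theorem conjTranspose_mem_blockDiag {M : Matrix I I ℂ} (h : M ∈ blockDiag κ) :
    Mᴴ ∈ blockDiag κ := fun x y hxy => by
  rw [conjTranspose_apply, h y x (Ne.symm hxy), star_zero]

theorem diagonal_mem_blockDiag (d : I → ℂ) : diagonal d ∈ blockDiag κ := fun _ _ h =>
  diagonal_apply_ne _ (fun e => h (e ▸ rfl))

theorem mul_diagonal_comm {M : Matrix I I ℂ} (h : M ∈ blockDiag κ) (c : V → ℂ) :
    M * diagonal (fun x => c (κ x)) = diagonal (fun x => c (κ x)) * M := by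
  ext x y
  rw [mul_diagonal, diagonal_mul]
  by_cases hxy : κ x = κ y
  · rw [hxy, mul_comm]
  · rw [h x y hxy]; simp

/-- A matrix commuting with the projections onto the blocks is block diagonal. -/
theorem mem_blockDiag_of_commute {M : Matrix I I ℂ}
    (h : ∀ v, M * diagonal (fun x => if κ x = v then 1 else 0) =
      diagonal (fun x => if κ x = v then 1 else 0) * M) : M ∈ blockDiag κ := fun x y hxy => by
  have := congrFun (congrFun (h (κ y)) x) y
  rw [mul_diagonal, diagonal_mul] at this
  simpa [hxy] using this

variable (κ) in
/-- The block diagonal part of a matrix. -/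
def diagPart : Matrix I I ℂ →ₗ[ℂ] Matrix I I ℂ where
  toFun M := Matrix.of fun x y => if κ x = κ y then M x y else 0
  map_add' a b := by ext x y; by_cases h : κ x = κ y <;> simp [h]
  map_smul' c a := by ext x y; by_cases h : κ x = κ y <;> simp [h]

theorem diagPart_apply (M : Matrix I I ℂ) (x y : I) :
    diagPart κ M x y = if κ x = κ y then M x y else 0 := rfl

theorem diagPart_mem (M : Matrix I I ℂ) : diagPart κ M ∈ blockDiag κ := fun x y h => by
  rw [diagPart_apply, if_neg h]

theorem diagPart_conjTranspose (M : Matrix I I ℂ) : diagPart κ Mᴴ = (diagPart κ M)ᴴ := by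
  ext x y
  simp only [diagPart_apply, conjTranspose_apply]
  by_cases h : κ x = κ y
  · simp [h]
  · simp [h, Ne.symm h]

/-- In the trace pairing the off-block entries of `M` only meet vanishing entries of `g`. Moment
maps tested against block diagonal matrices can therefore drop the projection. -/
theorem trace_mul_diagPart {g : Matrix I I ℂ} (hg : g ∈ blockDiag κ) (M : Matrix I I ℂ) :
    trace (g * diagPart κ M) = trace (g * M) := by
  simp only [trace, diag_apply, mul_apply, diagPart_apply]
  refine Finset.sum_congr rfl fun x _ => Finset.sum_congr rfl fun y _ => ?_
  by_cases h : κ y = κ x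
  · simp [h]
  · simp [h, hg x y (Ne.symm h)]

theorem trace_diagPart (M : Matrix I I ℂ) : trace (diagPart κ M) = trace M := by
  simpa using trace_mul_diagPart (κ := κ) (one_mem _) M

/-- The matrices supported in the blocks `(v, w)` with `A w v`, an "arrow" from `w` to `v`. -/
def arrowMatrices (κ : I → V) (A : V → V → Prop) : Submodule ℂ (Matrix I I ℂ) :=
  supportedOn fun x y => A (κ y) (κ x)

variable {A : V → V → Prop}

theorem mul_mem_arrowMatrices {g M : Matrix I I ℂ} (hg : g ∈ blockDiag κ)
    (hM : M ∈ arrowMatrices κ A) : g * M ∈ arrowMatrices κ A := fun x y h => by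
  rw [mul_apply]
  refine Finset.sum_eq_zero fun z _ => ?_
  by_cases hz : κ x = κ z
  · rw [hM z y (by simpa only [hz] using h), mul_zero]
  · rw [hg x z hz, zero_mul]

theorem mem_arrowMatrices_mul {g M : Matrix I I ℂ} (hg : g ∈ blockDiag κ)
    (hM : M ∈ arrowMatrices κ A) : M * g ∈ arrowMatrices κ A := fun x y h => by
  rw [mul_apply]
  refine Finset.sum_eq_zero fun z _ => ?_
  by_cases hz : κ z = κ y
  · rw [hM x z (by simpa only [hz] using h), zero_mul]
  · rw [hg z y hz, mul_zero]

/-- `M` and its adjoint commute only with the scalars among the block diagonal matrices. -/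
def IsIrreducible (κ : I → V) (M : Matrix I I ℂ) : Prop :=
  ∀ g ∈ blockDiag κ, g * M = M * g → g * Mᴴ = Mᴴ * g → ∃ z : ℂ, g = z • (1 : Matrix I I ℂ)

/-- The (signed) moment map is scalar on each block. -/
def IsBalanced (κ : I → V) (M : Matrix I I ℂ) : Prop :=
  ∃ c : V → ℝ, diagPart κ (M * Mᴴ - Mᴴ * M) = diagonal fun x => (c (κ x) : ℂ)

theorem re_trace_mul_conjTranspose (M : Matrix I I ℂ) :
    (trace (M * Mᴴ)).re = ∑ x, ∑ y, ‖M x y‖ ^ 2 := by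
  simp only [trace, diag_apply, mul_apply, conjTranspose_apply, Complex.re_sum]
  refine Finset.sum_congr rfl fun x _ => Finset.sum_congr rfl fun y _ => ?_
  rw [Complex.star_def, Complex.mul_conj, Complex.ofReal_re, Complex.normSq_eq_norm_sq]

theorem eq_zero_of_re_trace {M : Matrix I I ℂ} (h : (trace (M * Mᴴ)).re = 0) : M = 0 := by
  have h2 : trace (M * Mᴴ) = 0 := by
    apply Complex.ext h
    have h3 : star (trace (M * Mᴴ)) = trace (M * Mᴴ) := by
      rw [← trace_conjTranspose]; simp
    exact Complex.conj_eq_iff_im.mp h3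
  rwa [trace_mul_conjTranspose_self_eq_zero_iff] at h2

theorem trace_rotate_left (a b c d : Matrix I I ℂ) :
    trace (a * b * (c * d)) = trace (b * c * (d * a)) := by
  rw [mul_assoc, trace_mul_comm]
  simp only [mul_assoc]

theorem trace_rotate_right (a b c d : Matrix I I ℂ) :
    trace (a * b * (c * d)) = trace (d * a * (b * c)) :=
  (trace_rotate_left d a b c).symm

/-- For a balanced `T`, the block diagonal matrices commuting with `T` form a self-adjoint set. -/
theorem conjTranspose_commute {T g : Matrix I I ℂ} (hT : IsBalanced κ T) (hg : g ∈ blockDiag κ)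
    (h : g * T = T * g) : gᴴ * T = T * gᴴ := by
  obtain ⟨c, hc⟩ := hT
  have hg' := conjTranspose_mem_blockDiag hg
  -- In the Frobenius norm: `‖[gᴴ, T]‖² - ‖[g, T]‖² = tr ([g, gᴴ] [T, Tᴴ])`.
  have key : trace ((gᴴ * T - T * gᴴ) * (gᴴ * T - T * gᴴ)ᴴ) -
      trace ((g * T - T * g) * (g * T - T * g)ᴴ) =
      trace ((g * gᴴ - gᴴ * g) * (T * Tᴴ - Tᴴ * T)) := by
    simp only [conjTranspose_sub, conjTranspose_mul, conjTranspose_conjTranspose, sub_mul, mul_sub,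
      trace_sub]
    rw [trace_rotate_right gᴴ T Tᴴ g, trace_rotate_left T gᴴ g Tᴴ, trace_rotate_right g T Tᴴ gᴴ,
      trace_rotate_left T g gᴴ Tᴴ, trace_rotate_left gᴴ T g Tᴴ, trace_rotate_right T gᴴ Tᴴ g]
    ring
  -- The block diagonal part of `[T, Tᴴ]` is scalar on blocks, hence commutes with `g` and `gᴴ`, and
  -- a commutator of these pairs with it to zero.
  have hz : trace ((g * gᴴ - gᴴ * g) * (T * Tᴴ - Tᴴ * T)) = 0 := by
    rw [← trace_mul_diagPart (sub_mem (mul_mem hg hg') (mul_mem hg' hg)), hc, sub_mul, trace_sub,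
      mul_assoc, mul_diagonal_comm hg' (fun v => (c v : ℂ)), ← mul_assoc, trace_mul_comm,
      ← mul_assoc, sub_self]
  have h0 : g * T - T * g = 0 := sub_eq_zero.mpr h
  rw [hz, h0, zero_mul, trace_zero, sub_zero, trace_mul_conjTranspose_self_eq_zero_iff] at key
  exact sub_eq_zero.mp key

/-- Balancedness supplies the other half of the irreducibility hypothesis: commuting with `T` alone
already forces commuting with `Tᴴ`. -/
theorem exists_smul_one_of_commute {T g : Matrix I I ℂ} (hT : IsBalanced κ T)
    (hirr : IsIrreducible κ T) (hg : g ∈ blockDiag κ) (h : g * T = T * g) :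
    ∃ z : ℂ, g = z • (1 : Matrix I I ℂ) := by
  refine hirr g hg h ?_
  have := congrArg conjTranspose (conjTranspose_commute hT hg h)
  simpa [conjTranspose_mul] using this.symm

end Basic

end BlockMatrix

/-! ### Linearized moment map, dimension count, Burnside's theorem and derivations -/

namespace BlockMatrix

open Matrix Module
open scoped ComplexOrder

set_option linter.unusedSectionVars false

section Linear

variable {I : Type*} [Fintype I] [DecidableEq I] {V : Type*} [DecidableEq V] {κ : I → V}
  {A : V → V → Prop}

variable (κ) in
/-- The block diagonal matrices of trace zero. -/
def traceZero : Submodule ℂ (Matrix I I ℂ) :=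
  Subalgebra.toSubmodule (blockDiag κ) ⊓ LinearMap.ker (traceLinearMap I ℂ ℂ)

theorem mem_traceZero {M : Matrix I I ℂ} :
    M ∈ traceZero κ ↔ M ∈ blockDiag κ ∧ trace M = 0 := by
  simp [traceZero]

/-- The linearization of the moment map: the block diagonal part of `[X, Tᴴ]`. -/
def momentLin (κ : I → V) (T : Matrix I I ℂ) : Matrix I I ℂ →ₗ[ℂ] Matrix I I ℂ :=
  diagPart κ ∘ₗ (LinearMap.mulRight ℂ Tᴴ - LinearMap.mulLeft ℂ Tᴴ)

theorem momentLin_apply (T X : Matrix I I ℂ) :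
    momentLin κ T X = diagPart κ (X * Tᴴ - Tᴴ * X) := rfl

theorem momentLin_mem (T X : Matrix I I ℂ) : momentLin κ T X ∈ traceZero κ := by
  rw [mem_traceZero, momentLin_apply, trace_diagPart, trace_sub, trace_mul_comm, sub_self]
  exact ⟨diagPart_mem _, rfl⟩

theorem finrank_traceZero_add_one [Nonempty I] :
    finrank ℂ (traceZero κ) + 1 = finrank ℂ (blockDiag κ) := by
  let t : blockDiag κ →ₗ[ℂ] ℂ := traceLinearMap I ℂ ℂ ∘ₗ (blockDiag κ).val.toLinearMap
  have ht : LinearMap.range t = ⊤ := by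
    rw [LinearMap.range_eq_top]
    refine LinearMap.surjective_of_ne_zero fun h => ?_
    have := congrArg (fun f => f 1) h
    simp [t] at this
  have h1 := t.finrank_range_add_finrank_ker
  rw [ht, finrank_top, finrank_self] at h1
  have e : traceZero κ = (LinearMap.ker t).map (blockDiag κ).val.toLinearMap := by
    ext M
    simp only [mem_traceZero, Submodule.mem_map, LinearMap.mem_ker]
    constructor
    · rintro ⟨h, h'⟩
      exact ⟨⟨M, h⟩, h', rfl⟩
    · rintro ⟨y, hy, rfl⟩
      exact ⟨y.2, hy⟩
  rw [e, ← (Submodule.equivMapOfInjective (blockDiag κ).val.toLinearMap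
    (fun _ _ h => Subtype.ext h) (LinearMap.ker t)).finrank_eq, add_comm, h1]

/-- The linearized moment map of an irreducible balanced `T` maps onto the trace zero matrices. -/
theorem exists_momentLin_eq [Nonempty I] {T : Matrix I I ℂ} (hTA : T ∈ arrowMatrices κ A)
    (hT : IsBalanced κ T) (hirr : IsIrreducible κ T) {η : Matrix I I ℂ}
    (hη : η ∈ traceZero κ) : ∃ X ∈ arrowMatrices κ A, momentLin κ T X = η := by
  let a : blockDiag κ →ₗ[ℂ] Matrix I I ℂ := momentLin κ T ∘ₗ
    (LinearMap.mulRight ℂ T - LinearMap.mulLeft ℂ T) ∘ₗ (blockDiag κ).val.toLinearMap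
  have ha : ∀ g, a g = momentLin κ T (g.1 * T - T * g.1) := fun _ => rfl
  -- Pairing `a g` with `gᴴ` gives `‖[g, T]‖²`, so the kernel consists of the `g` commuting with
  -- `T`, which are scalars.
  have hker : LinearMap.ker a = Submodule.span ℂ {(1 : blockDiag κ)} := by
    ext g
    rw [LinearMap.mem_ker, Submodule.mem_span_singleton]
    constructor
    · intro hg
      have h1 : trace (g.1ᴴ * a g) = 0 := by rw [hg, mul_zero, trace_zero]
      rw [ha, momentLin_apply, trace_mul_diagPart (conjTranspose_mem_blockDiag g.2)] at h1
      have h2 : trace ((g.1 * T - T * g.1) * (g.1 * T - T * g.1)ᴴ) = 0 := by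
        rw [← h1]
        rw [conjTranspose_sub, conjTranspose_mul, conjTranspose_mul, mul_sub, mul_sub, trace_sub,
          trace_sub]
        congr 1
        · rw [trace_mul_comm g.1ᴴ, mul_assoc]
        · rw [trace_mul_comm, mul_assoc]
      rw [trace_mul_conjTranspose_self_eq_zero_iff] at h2
      obtain ⟨z, hz⟩ := exists_smul_one_of_commute hT hirr g.2 (sub_eq_zero.mp h2)
      exact ⟨z, Subtype.ext hz.symm⟩
    · rintro ⟨z, rfl⟩
      simp [ha]
  have h1 := a.finrank_range_add_finrank_ker
  rw [hker, finrank_span_singleton (one_ne_zero), ← finrank_traceZero_add_one] at h1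
  have hle : LinearMap.range a ≤ traceZero κ := by
    rintro _ ⟨g, rfl⟩
    exact momentLin_mem _ _
  -- Rank-nullity leaves exactly one dimension less than the block diagonal matrices, which is the
  -- dimension of the trace zero part.
  have heq := Submodule.eq_of_le_of_finrank_eq hle (by omega)
  rw [← heq] at hη
  obtain ⟨g, rfl⟩ := hη
  exact ⟨_, sub_mem (mul_mem_arrowMatrices g.2 hTA) (mem_arrowMatrices_mul g.2 hTA), rfl⟩

theorem finrank_comap {K E F : Type*} [Field K] [AddCommGroup E] [Module K E]
    [AddCommGroup F] [Module K F] [FiniteDimensional K E] (f : E →ₗ[K] F) (S : Submodule K F) :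
    finrank K (S.comap f) = finrank K ↥(S ⊓ LinearMap.range f) + finrank K (LinearMap.ker f) := by
  have h := (f.domRestrict (S.comap f)).finrank_range_add_finrank_ker
  have h1 : LinearMap.range (f.domRestrict (S.comap f)) = S ⊓ LinearMap.range f := by
    rw [LinearMap.range_domRestrict, Submodule.map_comap_eq, inf_comm]
  have h2 : LinearMap.ker (f.domRestrict (S.comap f)) =
      (LinearMap.ker f).comap (S.comap f).subtype := by
    rw [LinearMap.ker_domRestrict]
  rw [← h, h1, h2, LinearEquiv.finrank_eq (Submodule.comapSubtypeEquivOfLe _)]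
  intro x hx
  simp [LinearMap.mem_ker.mp hx]

/-- The real diagonal matrices which are scalar on each block. -/
def realBlockScalar (κ : I → V) : Submodule ℝ (Matrix I I ℂ) where
  carrier := {M | ∃ c : V → ℝ, M = diagonal fun x => (c (κ x) : ℂ)}
  add_mem' := by
    rintro _ _ ⟨c, rfl⟩ ⟨d, rfl⟩
    exact ⟨c + d, by ext x y; by_cases h : x = y <;> simp [h]⟩
  zero_mem' := ⟨0, by ext x y; by_cases h : x = y <;> simp [h]⟩
  smul_mem' := by
    rintro r _ ⟨c, rfl⟩
    exact ⟨r • c, by ext x y; by_cases h : x = y <;> simp [h]⟩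

/-- One real scalar per vertex is free, and the trace imposes a single nontrivial relation;
surjectivity of `κ` keeps the scalars distinguishable. -/
theorem finrank_realBlockScalar_inf [Nonempty I] [Fintype V] (hκ : Function.Surjective κ) :
    finrank ℝ ↥(realBlockScalar κ ⊓ (traceZero κ).restrictScalars ℝ) + 1 = Fintype.card V := by
  let t : (V → ℝ) →ₗ[ℝ] ℝ :=
    { toFun := fun c => ∑ x, c (κ x)
      map_add' := fun _ _ => Finset.sum_add_distrib
      map_smul' := fun r c => by simp [Finset.mul_sum] }
  let D : (V → ℝ) →ₗ[ℝ] Matrix I I ℂ :=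
    { toFun := fun c => diagonal fun x => (c (κ x) : ℂ)
      map_add' := fun c d => by ext x y; by_cases h : x = y <;> simp [h]
      map_smul' := fun r c => by ext x y; by_cases h : x = y <;> simp [h] }
  have hD : Function.Injective D := fun c d h => by
    ext v
    obtain ⟨x, rfl⟩ := hκ v
    have := congrFun (congrFun h x) x
    simpa [D] using this
  have htr : ∀ c, trace (D c) = ((t c : ℝ) : ℂ) := fun c => by simp [D, t, trace]
  have ht : LinearMap.range t = ⊤ := by
    rw [LinearMap.range_eq_top]
    refine LinearMap.surjective_of_ne_zero fun h => ?_
    have := congrArg (fun f => f (fun _ => 1)) h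
    simp [t] at this
  have h1 := t.finrank_range_add_finrank_ker
  rw [ht, finrank_top, finrank_self, finrank_fintype_fun_eq_card] at h1
  have e : realBlockScalar κ ⊓ (traceZero κ).restrictScalars ℝ = (LinearMap.ker t).map D := by
    ext M
    simp only [Submodule.mem_inf, Submodule.restrictScalars_mem, mem_traceZero, Submodule.mem_map,
      LinearMap.mem_ker]
    constructor
    · rintro ⟨⟨c, rfl⟩, -, h⟩
      exact ⟨c, by exact_mod_cast (htr c).symm.trans h, rfl⟩
    · rintro ⟨c, hc, rfl⟩
      exact ⟨⟨c, rfl⟩, diagonal_mem_blockDiag _, by rw [htr, hc]; rfl⟩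
  rw [e, ← (Submodule.equivMapOfInjective D hD (LinearMap.ker t)).finrank_eq, add_comm, h1]

theorem finrank_restrictScalars (S : Submodule ℂ (Matrix I I ℂ)) :
    finrank ℝ (S.restrictScalars ℝ) = 2 * finrank ℂ S :=
  finrank_real_of_complex S

/-- This is the source of `|V| + 1`. With `D` the complex dimension of the block diagonal matrices,
the domain has real dimension `2D` and the image `2(D - 1)`, so the kernel has real dimension 2; the
admissible values contribute `|V| - 1` more. -/
theorem finrank_comap_realBlockScalar [Nonempty I] [Fintype V] (hκ : Function.Surjective κ)
    (hdim : finrank ℂ (arrowMatrices κ A) = finrank ℂ (blockDiag κ))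
    {E : Type*} [AddCommGroup E] [Module ℝ E] [FiniteDimensional ℝ E]
    (ι : E →ₗ[ℝ] Matrix I I ℂ) (hι : Function.Injective ι)
    (hr : LinearMap.range ι = (arrowMatrices κ A).restrictScalars ℝ)
    {T : Matrix I I ℂ} (hTA : T ∈ arrowMatrices κ A)
    (hT : IsBalanced κ T) (hirr : IsIrreducible κ T) :
    finrank ℝ ((realBlockScalar κ).comap ((momentLin κ T).restrictScalars ℝ ∘ₗ ι)) =
      Fintype.card V + 1 := by
  set f := (momentLin κ T).restrictScalars ℝ ∘ₗ ι
  have hrf : LinearMap.range f = (traceZero κ).restrictScalars ℝ := by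
    apply le_antisymm
    · rintro _ ⟨X, rfl⟩
      exact momentLin_mem T (ι X)
    · intro η hη
      obtain ⟨X, hX, rfl⟩ := exists_momentLin_eq hTA hT hirr hη
      have : X ∈ LinearMap.range ι := hr ▸ hX
      obtain ⟨Y, rfl⟩ := this
      exact ⟨Y, rfl⟩
  have h1 := f.finrank_range_add_finrank_ker
  rw [hrf, finrank_restrictScalars, ← LinearMap.finrank_range_of_inj hι, hr,
    finrank_restrictScalars, hdim, ← finrank_traceZero_add_one] at h1
  rw [finrank_comap, hrf]
  have h2 := finrank_realBlockScalar_inf hκ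
  omega

/-- **Burnside's theorem** for self-adjoint matrix algebras. -/
theorem eq_top_of_commutant (S : Subalgebra ℂ (Matrix I I ℂ)) (hstar : ∀ M ∈ S, Mᴴ ∈ S)
    (hirr : ∀ g : Matrix I I ℂ, (∀ M ∈ S, g * M = M * g) → ∃ z : ℂ, g = z • 1) : S = ⊤ := by
  cases isEmpty_or_nonempty I
  · exact Subsingleton.elim _ _
  let φ := toEuclideanCLM (n := I) (𝕜 := ℂ)
  let H := EuclideanSpace ℂ I
  let _ : Module S H :=
    { smul := fun s x => φ s.1 x
      one_smul := fun x => by change φ 1 x = x; rw [map_one]; rfl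
      mul_smul := fun s t x => by change φ (s.1 * t.1) x = φ s.1 (φ t.1 x); rw [map_mul]; rfl
      smul_zero := fun s => map_zero (φ s.1)
      smul_add := fun s => map_add (φ s.1)
      add_smul := fun s t x => by
        change φ (s.1 + t.1) x = φ s.1 x + φ t.1 x; rw [map_add]; rfl
      zero_smul := fun x => by change φ 0 x = 0; rw [map_zero]; rfl }
  have hsmul : ∀ (s : S) (x : H), s • x = φ s.1 x := fun _ _ => rfl
  have hscal : ∀ (z : ℂ) (x : H), algebraMap ℂ S z • x = z • x := fun z x => by
    rw [hsmul, Subalgebra.coe_algebraMap, AlgHomClass.commutes]; rfl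
  have hsimple : IsSimpleModule S H := by
    rw [isSimpleModule_iff]
    refine { exists_pair_ne := ⟨⊥, ⊤, bot_ne_top⟩, eq_bot_or_eq_top := fun N => ?_ }
    let W : Submodule ℂ H :=
      { carrier := N, add_mem' := N.add_mem, zero_mem' := N.zero_mem
        smul_mem' := fun z x hx => hscal z x ▸ N.smul_mem _ hx }
    have hW : ∀ M ∈ S, ∀ x ∈ W, φ M x ∈ W := fun M hM x hx => N.smul_mem (⟨M, hM⟩ : S) hx
    have hW' : ∀ M ∈ S, ∀ x ∈ Wᗮ, φ M x ∈ Wᗮ := fun M hM x hx => by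
      rw [Submodule.mem_orthogonal] at hx ⊢
      intro u hu
      have := hx _ (hW _ (hstar M hM) u hu)
      rwa [← star_eq_conjTranspose, map_star, ContinuousLinearMap.star_eq_adjoint,
        ContinuousLinearMap.adjoint_inner_left] at this
    -- As `S` is closed under adjoints, the complement of an invariant subspace is invariant, so the
    -- orthogonal projection lies in the commutant and is scalar.
    obtain ⟨z, hz⟩ := hirr (φ.symm W.starProjection) fun M hM => by
      apply EquivLike.injective φ
      rw [map_mul, map_mul, StarAlgEquiv.apply_symm_apply]
      ext1 x
      obtain ⟨y, hy, w, hw, rfl⟩ := W.exists_add_mem_mem_orthogonal x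
      simp only [mul_apply_eq_comp, map_add]
      rw [Submodule.starProjection_eq_self_iff.mpr (hW M hM y hy),
        (Submodule.starProjection_apply_eq_zero_iff _).mpr (hW' M hM w hw),
        Submodule.starProjection_eq_self_iff.mpr hy,
        (Submodule.starProjection_apply_eq_zero_iff _).mpr hw, map_zero]
    have hp : ∀ x, W.starProjection x = z • x := fun x => by
      rw [← φ.apply_symm_apply W.starProjection, hz, map_smul, map_one]; rfl
    by_cases hN : N = ⊥
    · exact Or.inl hN
    · right
      obtain ⟨x, hx, hx0⟩ := N.exists_mem_ne_zero_of_ne_bot hN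
      have h1 := hp x
      rw [Submodule.starProjection_eq_self_iff.mpr (show x ∈ W from hx)] at h1
      have hz1 : z = 1 := by
        have h2 : (z - 1) • x = 0 := by rw [sub_smul, ← h1, one_smul, sub_self]
        exact sub_eq_zero.mp ((smul_eq_zero.mp h2).resolve_right hx0)
      rw [eq_top_iff]
      intro y _
      have := Submodule.starProjection_eq_self_iff.mp ((hp y).trans (by rw [hz1, one_smul]))
      exact this
  -- Schur: `S` contains the scalars, so its module endomorphisms are complex linear and lie in the
  -- commutant.
  have hend : ∀ f : Module.End S H, ∃ z : ℂ, ∀ x, f x = z • x := fun f => by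
    let f' : H →ₗ[ℂ] H :=
      { toFun := f, map_add' := map_add f
        map_smul' := fun z x => by rw [← hscal, map_smul, hscal]; rfl }
    obtain ⟨z, hz⟩ := hirr (φ.symm (LinearMap.toContinuousLinearMap f')) fun M hM => by
      apply EquivLike.injective φ
      rw [map_mul, map_mul, StarAlgEquiv.apply_symm_apply]
      ext1 x
      exact map_smul f (⟨M, hM⟩ : S) x
    refine ⟨z, fun x => ?_⟩
    have : φ (φ.symm (LinearMap.toContinuousLinearMap f')) x = z • x := by
      rw [hz, map_smul, map_one]; rfl
    rwa [StarAlgEquiv.apply_symm_apply] at this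
  rw [eq_top_iff]
  intro N _
  -- Every matrix is linear over the endomorphism ring, which acts by scalars. Density then provides
  -- an element of `S` with the same values on the standard basis.
  let F : Module.End (Module.End S H) H :=
    { toFun := φ N, map_add' := map_add _
      map_smul' := fun f x => by
        obtain ⟨z, hz⟩ := hend f
        simp only [RingHom.id_apply, Module.End.smul_def, hz, map_smul] }
  obtain ⟨r, hr⟩ := jacobson_density F
    (Finset.univ.image fun i : I => EuclideanSpace.single i (1 : ℂ))
  have : N = r.1 := by
    apply EquivLike.injective φ
    refine ContinuousLinearMap.coe_injective ((EuclideanSpace.basisFun I ℂ).toBasis.ext fun i => ?_)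
    rw [OrthonormalBasis.coe_toBasis, EuclideanSpace.basisFun_apply]
    exact hr (EuclideanSpace.single i 1) (Finset.mem_image_of_mem _ (Finset.mem_univ i))
  rw [this]
  exact r.2

/-- Derivations of a matrix algebra are inner. -/
theorem exists_commutator_of_derivation (D : Matrix I I ℂ →ₗ[ℂ] Matrix I I ℂ)
    (hD : ∀ M N, D (M * N) = D M * N + M * D N) : ∃ ξ, ∀ M, D M = ξ * M - M * ξ := by
  cases isEmpty_or_nonempty I
  · exact ⟨0, fun M => Subsingleton.elim _ _⟩
  obtain ⟨o⟩ := ‹Nonempty I›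
  -- Averaging over matrix units: by the Leibniz rule, `M * ξ + D M` is the sum of `D (M * single i
  -- o 1) * single o i 1`. Expanding `M * single i o 1` in matrix units turns that sum into `ξ * M`.
  let ξ : Matrix I I ℂ := ∑ i, D (single i o 1) * single o i 1
  have h1 : (∑ i : I, single i o (1 : ℂ) * single o i 1) = 1 := by
    simp only [single_mul_single_same, mul_one]
    exact sum_single_one
  refine ⟨ξ, fun M => ?_⟩
  have e : M * ξ + D M = ∑ i, D (M * single i o 1) * single o i 1 := by
    simp only [hD, add_mul, Finset.sum_add_distrib, mul_assoc]
    rw [← Finset.mul_sum, ← Finset.mul_sum, h1, mul_one, add_comm]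
  have e2 : ξ * M = ∑ i, D (M * single i o 1) * single o i 1 := by
    have h2 : ∀ i, single o i (1 : ℂ) * M = ∑ j, M i j • single o j 1 := fun i => by
      ext x y
      simp [Matrix.sum_apply, mul_apply, single_apply, ite_and]
    have h3 : ∀ i, M * single i o (1 : ℂ) = ∑ k, M k i • single k o 1 := fun i => by
      ext x y
      simp [Matrix.sum_apply, mul_apply, single_apply, ite_and]
    simp only [ξ, Finset.sum_mul, mul_assoc, h2, h3, map_sum, map_smul, Finset.mul_sum,
      Matrix.mul_smul, Matrix.smul_mul]
    rw [Finset.sum_comm]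
  rw [e2, ← e]; simp

end Linear

end BlockMatrix

/-! ### Charts of level sets, and closest points of unitary orbits -/

namespace BlockMatrix

open Matrix Module
open scoped ComplexOrder Topology Matrix.Norms.Frobenius

set_option linter.unusedSectionVars false

section Chart

/-- A level set whose points all lie in the range of the derivative is, near a point, smoothly
parametrized by any smooth functions which restrict to coordinates on the kernel. -/
theorem exists_chart_of_level_set {E F : Type*} [NormedAddCommGroup E] [NormedSpace ℝ E]
    [FiniteDimensional ℝ E] [NormedAddCommGroup F] [NormedSpace ℝ F] [FiniteDimensional ℝ F]
    {m : ℕ} {f : E → F} {P : E → Fin m → ℝ} {T : E} (hf : ContDiff ℝ ∞ f) (hP : ContDiff ℝ ∞ P)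
    (hrange : ∀ R, f R ∈ LinearMap.range (fderiv ℝ f T : E →ₗ[ℝ] F))
    (hinj : ∀ X, fderiv ℝ f T X = 0 → fderiv ℝ P T X = 0 → X = 0)
    (hdim : finrank ℝ (LinearMap.ker (fderiv ℝ f T : E →ₗ[ℝ] F)) = m)
    {N : Set E} (hN : N ∈ 𝓝 T) :
    ∃ (S : Set E) (W : Set (Fin m → ℝ)) (Φ : (Fin m → ℝ) → E), IsOpen S ∧ T ∈ S ∧ S ⊆ N ∧
      IsOpen W ∧ ContDiffOn ℝ ∞ Φ W ∧ (∀ w ∈ W, Φ w ∈ S ∧ f (Φ w) = 0 ∧ P (Φ w) = w) ∧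
      ∀ R ∈ S, f R = 0 → P R ∈ W ∧ Φ (P R) = R := by
  set f' : E →ₗ[ℝ] F := (fderiv ℝ f T : E →ₗ[ℝ] F) with hf'
  set G := LinearMap.range f' with hG
  obtain ⟨q, hq⟩ := G.exists_isCompl
  let pr : F →L[ℝ] G := LinearMap.toContinuousLinearMap (G.projectionOnto q hq)
  have hpr : ∀ x (h : x ∈ G), pr x = ⟨x, h⟩ := fun x h =>
    Submodule.projectionOnto_apply_left hq ⟨x, h⟩
  -- The derivative of `f` need not be onto `F`, so `f` is first projected to the range of that
  -- derivative; with `P` adjoined the inverse function theorem applies.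
  let Θ : E → G × (Fin m → ℝ) := fun R => (pr (f R), P R)
  have hΘ : ContDiff ℝ ∞ Θ := (pr.contDiff.comp hf).prodMk hP
  have hfd : Differentiable ℝ f := hf.differentiable (by simp)
  have hPd : Differentiable ℝ P := hP.differentiable (by simp)
  have hΘd : HasFDerivAt Θ ((pr ∘L fderiv ℝ f T).prod (fderiv ℝ P T)) T :=
    (pr.hasFDerivAt.comp T (hfd T).hasFDerivAt).prodMk (hPd T).hasFDerivAt
  set Θ' := (pr ∘L fderiv ℝ f T).prod (fderiv ℝ P T) with hΘ'
  have hinjΘ : Function.Injective Θ' := by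
    rw [injective_iff_map_eq_zero]
    intro X hX
    have h1 : pr (fderiv ℝ f T X) = 0 := congrArg Prod.fst hX
    rw [hpr (fderiv ℝ f T X) ⟨X, rfl⟩] at h1
    exact hinj X (congrArg Subtype.val h1) (congrArg Prod.snd hX)
  have hfr : finrank ℝ E = finrank ℝ (G × (Fin m → ℝ)) := by
    rw [finrank_prod, finrank_fin_fun, ← hdim, f'.finrank_range_add_finrank_ker]
  let e : E ≃L[ℝ] G × (Fin m → ℝ) :=
    (LinearMap.linearEquivOfInjective (Θ' : E →ₗ[ℝ] G × (Fin m → ℝ)) hinjΘ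
      hfr).toContinuousLinearEquiv
  have he : (e : E →L[ℝ] G × (Fin m → ℝ)) = Θ' := by ext X <;> rfl
  rw [← he] at hΘd
  let H := hΘ.contDiffAt.toOpenPartialHomeomorph Θ hΘd (by simp)
  have hHc : ∀ R, H R = Θ R := fun R => rfl
  -- Smoothness of the local inverse at a point needs an invertible derivative of `Θ` there, so the
  -- domain is shrunk to the open set where this holds.
  let U : Set E := {R | fderiv ℝ Θ R ∈
    Set.range ((↑) : (E ≃L[ℝ] G × (Fin m → ℝ)) → (E →L[ℝ] G × (Fin m → ℝ)))}
  have hU : IsOpen U := ContinuousLinearEquiv.isOpen.preimage (hΘ.continuous_fderiv (by simp))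
  let S := H.source ∩ (interior N ∩ U)
  have hSo : IsOpen S := H.open_source.inter (isOpen_interior.inter hU)
  have hTS : T ∈ S := ⟨hΘ.contDiffAt.mem_toOpenPartialHomeomorph_source hΘd (by simp),
    mem_interior_iff_mem_nhds.mpr hN, ⟨e, hΘd.fderiv.symm⟩⟩
  let j : (Fin m → ℝ) → G × (Fin m → ℝ) := fun w => (0, w)
  have hj : ContDiff ℝ ∞ j := contDiff_const.prodMk contDiff_id
  refine ⟨S, j ⁻¹' (H.target ∩ H.symm ⁻¹' S), fun w => H.symm (j w), hSo, hTS,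
    fun R hR => interior_subset hR.2.1,
    (H.isOpen_inter_preimage_symm hSo).preimage hj.continuous, ?_, ?_, ?_⟩
  · intro w hw
    obtain ⟨e', he'⟩ := hw.2.2.2
    have h1 : ContDiffAt ℝ ∞ H.symm (j w) := H.contDiffAt_symm (f₀' := e') hw.1
      (by rw [he']; exact (hΘ.differentiable (by simp) _).hasFDerivAt) hΘ.contDiffAt
    exact (h1.comp w hj.contDiffAt).contDiffWithinAt
  · intro w hw
    have h1 : Θ (H.symm (j w)) = j w := H.right_inv hw.1
    refine ⟨hw.2, ?_, congrArg Prod.snd h1⟩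
    have h2 : pr (f (H.symm (j w))) = 0 := congrArg Prod.fst h1
    -- All values of `f` lie in the range `G`, so nothing is lost by the projection and its
    -- vanishing gives `f = 0`.
    rw [hpr _ (hrange _)] at h2
    exact congrArg Subtype.val h2
  · intro R hR h0
    have h1 : j (P R) = H R := by simp [hHc, Θ, j, h0]
    have h2 : H.symm (j (P R)) = R := by rw [h1]; exact H.left_inv hR.1
    refine ⟨⟨?_, ?_⟩, h2⟩
    · rw [h1]; exact H.map_source hR.1
    · change H.symm (j (P R)) ∈ S
      rwa [h2]

end Chart

section Gauge

variable {I : Type*} [Fintype I] [DecidableEq I] {V : Type*} [DecidableEq V] {κ : I → V}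

variable (κ) in
/-- The block diagonal unitary matrices. -/
def unitaryBlocks : Set (Matrix I I ℂ) := {k | k ∈ unitaryGroup I ℂ ∧ k ∈ blockDiag κ}

theorem one_mem_unitaryBlocks : (1 : Matrix I I ℂ) ∈ unitaryBlocks κ := ⟨one_mem _, one_mem _⟩

theorem mul_mem_unitaryBlocks {k l : Matrix I I ℂ} (hk : k ∈ unitaryBlocks κ)
    (hl : l ∈ unitaryBlocks κ) : k * l ∈ unitaryBlocks κ :=
  ⟨mul_mem hk.1 hl.1, mul_mem hk.2 hl.2⟩

theorem conjTranspose_mem_unitaryBlocks {k : Matrix I I ℂ} (hk : k ∈ unitaryBlocks κ) :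
    kᴴ ∈ unitaryBlocks κ :=
  ⟨Unitary.star_mem hk.1, conjTranspose_mem_blockDiag hk.2⟩

theorem conjTranspose_mul_self {k : Matrix I I ℂ} (hk : k ∈ unitaryBlocks κ) : kᴴ * k = 1 :=
  Unitary.star_mul_self_of_mem hk.1

theorem mul_conjTranspose_self' {k : Matrix I I ℂ} (hk : k ∈ unitaryBlocks κ) : k * kᴴ = 1 :=
  Unitary.mul_star_self_of_mem hk.1

theorem norm_sq_eq (M : Matrix I I ℂ) : ‖M‖ ^ 2 = (trace (M * Mᴴ)).re := by
  rw [re_trace_mul_conjTranspose, frobenius_norm_def, ← Real.sqrt_eq_rpow, Real.sq_sqrt]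
  · simp
  · positivity

theorem isCompact_unitaryBlocks : IsCompact (unitaryBlocks κ) := by
  refine Metric.isCompact_of_isClosed_isBounded ?_ ?_
  · refine IsClosed.inter ?_ ?_
    · exact isClosed_unitary
    · exact Submodule.closed_of_finiteDimensional
        ((Subalgebra.toSubmodule (blockDiag κ)).restrictScalars ℝ)
  · rw [isBounded_iff_forall_norm_le]
    refine ⟨Real.sqrt (Fintype.card I), fun k hk => ?_⟩
    apply Real.le_sqrt_of_sq_le
    rw [norm_sq_eq, mul_conjTranspose_self' hk]
    simp

theorem exp_mem_unitaryBlocks {ξ : Matrix I I ℂ} (hξ : ξ ∈ blockDiag κ) (hs : ξᴴ = -ξ) (t : ℝ) :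
    NormedSpace.exp (t • ξ) ∈ unitaryBlocks κ := by
  refine ⟨NormedSpace.exp_mem_unitary_of_mem_skewAdjoint ?_, mem_blockDiag_of_commute fun v => ?_⟩
  · rw [skewAdjoint.mem_iff, star_smul, star_eq_conjTranspose, hs, star_trivial, smul_neg]
  · have h1 : Commute (t • ξ) (diagonal fun x => if κ x = v then (1 : ℂ) else 0) :=
      Commute.smul_left (mul_diagonal_comm hξ fun w => if w = v then (1 : ℂ) else 0) t
    exact h1.exp_left

theorem norm_sq_sub (M N : Matrix I I ℂ) :
    ‖M - N‖ ^ 2 = ‖M‖ ^ 2 + ‖N‖ ^ 2 - 2 * (trace (M * Nᴴ)).re := by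
  have h : (trace (N * Mᴴ)).re = (trace (M * Nᴴ)).re := by
    have : trace (N * Mᴴ) = star (trace (M * Nᴴ)) := by
      rw [← trace_conjTranspose, conjTranspose_mul, conjTranspose_conjTranspose]
    rw [this]; simp
  simp only [norm_sq_eq, conjTranspose_sub, mul_sub, sub_mul, trace_sub, Complex.sub_re]
  rw [h]; ring

theorem norm_conj_unitary {k : Matrix I I ℂ} (hk : k ∈ unitaryBlocks κ) (M : Matrix I I ℂ) :
    ‖k * M * kᴴ‖ = ‖M‖ := by
  rw [← sq_eq_sq₀ (norm_nonneg _) (norm_nonneg _), norm_sq_eq, norm_sq_eq]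
  simp only [conjTranspose_mul, conjTranspose_conjTranspose]
  have : k * M * kᴴ * (k * (Mᴴ * kᴴ)) = k * (M * Mᴴ) * kᴴ := by
    rw [mul_assoc (k * M), ← mul_assoc kᴴ, conjTranspose_mul_self hk, one_mul]
    simp only [mul_assoc]
  rw [mul_assoc k M, ← mul_assoc k M, this, trace_mul_comm, ← mul_assoc, conjTranspose_mul_self hk, one_mul]

/-- The skew-Hermitian part vanishes if it is orthogonal to the skew-Hermitian block diagonal
matrices. -/
theorem isHermitian_of_re_trace {η : Matrix I I ℂ} (hη : η ∈ blockDiag κ)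
    (h : ∀ ξ ∈ blockDiag κ, ξᴴ = -ξ → (trace (ξ * η)).re = 0) : ηᴴ = η := by
  set s := η - ηᴴ with hs
  have hsk : sᴴ = -s := by simp [hs]
  have h1 := h s (sub_mem hη (conjTranspose_mem_blockDiag hη)) hsk
  have h2 : (trace (s * ηᴴ)).re = 0 := by
    have : trace (s * ηᴴ) = - star (trace (s * η)) := by
      rw [← trace_conjTranspose, conjTranspose_mul, hsk, mul_neg, trace_neg, neg_neg,
        trace_mul_comm]
    rw [this]; simp [h1]
  have h3 : (trace (s * sᴴ)).re = 0 := by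
    rw [hsk, mul_neg, hs, mul_sub, trace_neg, trace_sub, ← hs]
    simp [h1, h2]
  exact (sub_eq_zero.mp (eq_zero_of_re_trace h3)).symm

/-- Each orbit of the block unitary group contains a point closest to `T`, and there the
linearized moment map is Hermitian. -/
theorem exists_closest (T M : Matrix I I ℂ) : ∃ k ∈ unitaryBlocks κ,
    (∀ l ∈ unitaryBlocks κ, ‖k * M * kᴴ - T‖ ≤ ‖l * M * lᴴ - T‖) ∧
    (momentLin κ T (k * M * kᴴ))ᴴ = momentLin κ T (k * M * kᴴ) := by
  have hcont : Continuous fun k : Matrix I I ℂ => ‖k * M * kᴴ - T‖ := by fun_prop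
  obtain ⟨k, hk, hmin⟩ := isCompact_unitaryBlocks.exists_isMinOn ⟨1, one_mem_unitaryBlocks (κ := κ)⟩
    hcont.continuousOn
  refine ⟨k, hk, fun l hl => hmin hl, isHermitian_of_re_trace
    (mem_traceZero.mp (momentLin_mem _ _)).1 fun ξ hξ hs => ?_⟩
  set N := k * M * kᴴ with hN
  -- Conjugation by unitaries preserves the Frobenius norm, so minimizing the distance to `T`
  -- amounts to maximizing the real part of `trace (N * Tᴴ)` along the orbit.
  have hmax : ∀ t : ℝ, (trace (NormedSpace.exp (t • ξ) * N * NormedSpace.exp (t • (-ξ)) * Tᴴ)).re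
      ≤ (trace (N * Tᴴ)).re := fun t => by
    have hu := exp_mem_unitaryBlocks hξ hs t
    have e1 : NormedSpace.exp (t • (-ξ)) = (NormedSpace.exp (t • ξ))ᴴ := by
      rw [← hs, ← exp_conjTranspose]; simp
    have h1 : ‖N - T‖ ≤ ‖(NormedSpace.exp (t • ξ) * k) * M * (NormedSpace.exp (t • ξ) * k)ᴴ - T‖ :=
      hmin (mul_mem_unitaryBlocks hu hk)
    have e2 : (NormedSpace.exp (t • ξ) * k) * M * (NormedSpace.exp (t • ξ) * k)ᴴ =
        NormedSpace.exp (t • ξ) * N * (NormedSpace.exp (t • ξ))ᴴ := by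
      rw [conjTranspose_mul, hN]; simp only [mul_assoc]
    rw [e2] at h1
    have h2 := pow_le_pow_left₀ (norm_nonneg _) h1 2
    rw [norm_sq_sub, norm_sq_sub, norm_conj_unitary hu] at h2
    rw [e1]
    linarith
  have hd : HasDerivAt (fun t : ℝ => NormedSpace.exp (t • ξ) * N * NormedSpace.exp (t • (-ξ)) * Tᴴ)
      ((ξ * N + N * (-ξ)) * Tᴴ) 0 := by
    have h1 := hasDerivAt_exp_smul_const (𝕂 := ℝ) ξ (0 : ℝ)
    have h2 := hasDerivAt_exp_smul_const (𝕂 := ℝ) (-ξ) (0 : ℝ)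
    simp only [zero_smul, NormedSpace.exp_zero, one_mul] at h1 h2
    have h3 := ((h1.mul_const N).mul h2).mul_const Tᴴ
    simpa using! h3
  let τ : Matrix I I ℂ →L[ℝ] ℝ := LinearMap.toContinuousLinearMap
    (Complex.reLm ∘ₗ (traceLinearMap I ℂ ℂ).restrictScalars ℝ)
  have hd2 := τ.hasFDerivAt.comp_hasDerivAt 0 hd
  -- The first-order condition at `t = 0`; it says that `ξ` is orthogonal to the linearized moment
  -- of `N`.
  have h0 : τ ((ξ * N + N * (-ξ)) * Tᴴ) = 0 := by
    refine IsLocalMax.hasDerivAt_eq_zero (Filter.Eventually.of_forall fun t => ?_) hd2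
    simpa [τ] using hmax t
  have h4 : (trace ((ξ * N + N * (-ξ)) * Tᴴ)).re = 0 := h0
  rw [momentLin_apply, trace_mul_diagPart hξ, ← h4, mul_sub, add_mul, trace_sub, trace_add,
    mul_neg, neg_mul, trace_neg, mul_assoc ξ N, ← sub_eq_add_neg]
  congr 2
  rw [← mul_assoc, trace_mul_comm, mul_assoc N, trace_mul_comm N, mul_assoc, trace_mul_comm]

end Gauge

end BlockMatrix

/-! ### The slice through a balanced matrix -/

namespace BlockMatrix

open Matrix Module
open scoped ComplexOrder Topology Matrix.Norms.Frobenius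

set_option linter.unusedSectionVars false

section Slice

variable {I : Type*} [Fintype I] [DecidableEq I] {V : Type*} [DecidableEq V] {κ : I → V}

theorem diagPart_mul_left {g : Matrix I I ℂ} (hg : g ∈ blockDiag κ) (M : Matrix I I ℂ) :
    diagPart κ (g * M) = g * diagPart κ M := by
  ext x y
  simp only [diagPart_apply, mul_apply]
  split_ifs with h
  · refine Finset.sum_congr rfl fun z _ => ?_
    by_cases hz : κ x = κ z
    · rw [if_pos (hz.symm.trans h)]
    · rw [hg x z hz, zero_mul, zero_mul]
  · refine (Finset.sum_eq_zero fun z _ => ?_).symm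
    by_cases hz : κ x = κ z
    · rw [if_neg (fun e => h (hz.trans e)), mul_zero]
    · rw [hg x z hz, zero_mul]

theorem diagPart_mul_right {g : Matrix I I ℂ} (hg : g ∈ blockDiag κ) (M : Matrix I I ℂ) :
    diagPart κ (M * g) = diagPart κ M * g := by
  have h := diagPart_mul_left (conjTranspose_mem_blockDiag hg) Mᴴ
  have h2 := congrArg conjTranspose h
  rw [← diagPart_conjTranspose, conjTranspose_mul, conjTranspose_mul, ← diagPart_conjTranspose] at h2
  simpa using h2

theorem IsBalanced.conj {M k : Matrix I I ℂ} (hM : IsBalanced κ M) (hk : k ∈ unitaryBlocks κ) :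
    IsBalanced κ (k * M * kᴴ) := by
  obtain ⟨c, hc⟩ := hM
  refine ⟨c, ?_⟩
  have hk' := conjTranspose_mem_unitaryBlocks hk
  have e : ∀ N L : Matrix I I ℂ, k * N * kᴴ * (k * L * kᴴ) = k * (N * L) * kᴴ := fun N L => by
    rw [mul_assoc (k * N), mul_assoc k L, ← mul_assoc kᴴ, conjTranspose_mul_self hk, one_mul]
    simp only [mul_assoc]
  have e1 : (k * M * kᴴ)ᴴ = k * Mᴴ * kᴴ := by
    simp only [conjTranspose_mul, conjTranspose_conjTranspose, mul_assoc]
  rw [e1, e, e, ← sub_mul, ← mul_sub, diagPart_mul_right hk'.2, diagPart_mul_left hk.2, hc,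
    mul_diagonal_comm hk.2 fun v => (c v : ℂ), mul_assoc, mul_conjTranspose_self' hk, mul_one]

theorem re_trace_skew_mul {ξ η : Matrix I I ℂ} (hξ : ξᴴ = -ξ) (hη : ηᴴ = η) :
    (trace (ξ * η)).re = 0 := by
  have h : trace (ξ * η) = - star (trace (ξ * η)) := by
    rw [← trace_conjTranspose, conjTranspose_mul, hξ, hη, mul_neg, trace_neg, neg_neg,
      trace_mul_comm]
  have := congrArg Complex.re h
  simp at this
  linarith

variable (κ) in
/-- The blockwise means of the real parts of the diagonal entries. -/
noncomputable def blockMean (M : Matrix I I ℂ) (v : V) : ℝ :=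
  (∑ y, if κ y = v then (M y y).re else 0) / ∑ y, if κ y = v then (1 : ℝ) else 0

variable (κ) in
/-- The projection onto the real diagonal matrices which are scalar on each block. -/
noncomputable def scalarPart : Matrix I I ℂ →ₗ[ℝ] Matrix I I ℂ where
  toFun M := diagonal fun x => (blockMean κ M (κ x) : ℂ)
  map_add' M N := by
    rw [diagonal_add]
    congr 1
    ext x
    rw [← Complex.ofReal_add]
    congr 1
    simp only [blockMean, ← add_div, ← Finset.sum_add_distrib]
    congr 2
    ext y
    split_ifs <;> simp
  map_smul' r M := by
    rw [RingHom.id_apply, ← diagonal_smul]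
    congr 1
    ext x
    simp only [blockMean, Pi.smul_apply, Complex.real_smul, ← Complex.ofReal_mul, ← mul_div_assoc,
      Finset.mul_sum]
    congr 3
    ext y
    split_ifs <;> simp

theorem scalarPart_apply (M : Matrix I I ℂ) :
    scalarPart κ M = diagonal fun x => (blockMean κ M (κ x) : ℂ) := rfl

theorem card_fiber_pos (x : I) : 0 < ∑ y, if κ y = κ x then (1 : ℝ) else 0 :=
  Finset.sum_pos' (fun _ _ => by split_ifs <;> simp) ⟨x, Finset.mem_univ x, by simp⟩

theorem scalarPart_mem (M : Matrix I I ℂ) : scalarPart κ M ∈ realBlockScalar κ :=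
  ⟨blockMean κ M, rfl⟩

theorem scalarPart_of_mem {M : Matrix I I ℂ} (h : M ∈ realBlockScalar κ) : scalarPart κ M = M := by
  obtain ⟨c, rfl⟩ := h
  rw [scalarPart_apply]
  congr 1
  ext x
  congr 1
  rw [blockMean, div_eq_iff (card_fiber_pos x).ne', Finset.mul_sum]
  refine Finset.sum_congr rfl fun y _ => ?_
  split_ifs with h <;> simp [h]

theorem scalarPart_conjTranspose (M : Matrix I I ℂ) : (scalarPart κ M)ᴴ = scalarPart κ M := by
  rw [scalarPart_apply, diagonal_conjTranspose]
  congr 1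
  ext x
  simp

theorem trace_scalarPart (M : Matrix I I ℂ) : trace (scalarPart κ M) = ((trace M).re : ℂ) := by
  rw [scalarPart_apply, trace_diagonal, ← Complex.ofReal_sum]
  congr 1
  simp only [blockMean, Finset.sum_div]
  rw [Finset.sum_comm, trace, Complex.re_sum]
  refine Finset.sum_congr rfl fun y _ => ?_
  have h : ∀ x, (if κ y = κ x then (M y y).re else 0) / (∑ z, if κ z = κ x then (1 : ℝ) else 0) =
      (M y y).re * (if κ x = κ y then 1 else 0) / ∑ z, if κ z = κ y then (1 : ℝ) else 0 := by
    intro x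
    by_cases h : κ y = κ x
    · rw [if_pos h, h]; simp
    · rw [if_neg h, if_neg (Ne.symm h)]; simp
  simp only [h]
  rw [← Finset.sum_div, ← Finset.mul_sum, mul_div_assoc, div_self (card_fiber_pos y).ne', mul_one]
  rfl

variable (κ) in
/-- The complementary projection to `scalarPart`. -/
noncomputable def tracelessPart : Matrix I I ℂ →ₗ[ℝ] Matrix I I ℂ := LinearMap.id - scalarPart κ

theorem tracelessPart_apply (M : Matrix I I ℂ) : tracelessPart κ M = M - scalarPart κ M := rfl

theorem tracelessPart_eq_zero {M : Matrix I I ℂ} :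
    tracelessPart κ M = 0 ↔ M ∈ realBlockScalar κ := by
  rw [tracelessPart_apply, sub_eq_zero]
  exact ⟨fun h => h ▸ scalarPart_mem M, fun h => (scalarPart_of_mem h).symm⟩

theorem tracelessPart_tracelessPart (M : Matrix I I ℂ) :
    tracelessPart κ (tracelessPart κ M) = tracelessPart κ M := by
  conv_lhs => rw [tracelessPart_apply M, map_sub, tracelessPart_eq_zero.mpr (scalarPart_mem M),
    sub_zero]

theorem tracelessPart_conjTranspose {M : Matrix I I ℂ} (h : Mᴴ = M) :
    (tracelessPart κ M)ᴴ = tracelessPart κ M := by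
  rw [tracelessPart_apply, conjTranspose_sub, h, scalarPart_conjTranspose]

variable (κ) in
/-- The moment map, traceless on each block, together with the gauge condition at `T`. -/
noncomputable def sliceMap (T M : Matrix I I ℂ) : Matrix I I ℂ :=
  tracelessPart κ (diagPart κ (M * Mᴴ - Mᴴ * M)) +
    (2⁻¹ : ℝ) • (momentLin κ T M - (momentLin κ T M)ᴴ)

theorem diagPart_moment_conjTranspose (M : Matrix I I ℂ) :
    (diagPart κ (M * Mᴴ - Mᴴ * M))ᴴ = diagPart κ (M * Mᴴ - Mᴴ * M) := by
  rw [← diagPart_conjTranspose]; simp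

theorem eq_zero_of_hermitian_add_skew {h s : Matrix I I ℂ} (hh : hᴴ = h) (hs : sᴴ = -s)
    (h0 : h + s = 0) : h = 0 ∧ s = 0 := by
  have h1 := congrArg conjTranspose h0
  rw [conjTranspose_add, hh, hs, conjTranspose_zero, ← sub_eq_add_neg, sub_eq_zero] at h1
  rw [h1, ← two_smul ℂ, smul_eq_zero] at h0
  have := h0.resolve_left two_ne_zero
  exact ⟨h1.trans this, this⟩

theorem half_skew (η : Matrix I I ℂ) : ((2⁻¹ : ℝ) • (η - ηᴴ))ᴴ = -((2⁻¹ : ℝ) • (η - ηᴴ)) := by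
  rw [conjTranspose_smul, star_trivial, conjTranspose_sub, conjTranspose_conjTranspose, ← smul_neg,
    neg_sub]

theorem half_skew_eq_zero {η : Matrix I I ℂ} : (2⁻¹ : ℝ) • (η - ηᴴ) = 0 ↔ ηᴴ = η := by
  rw [smul_eq_zero_iff_right (by norm_num), sub_eq_zero, eq_comm]

/-- The moment term is Hermitian and the gauge term skew-Hermitian, so a single matrix equation
encodes both conditions without interference. -/
theorem sliceMap_eq_zero {T M : Matrix I I ℂ} :
    sliceMap κ T M = 0 ↔ IsBalanced κ M ∧ (momentLin κ T M)ᴴ = momentLin κ T M := by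
  constructor
  · intro h
    obtain ⟨h1, h2⟩ := eq_zero_of_hermitian_add_skew
      (tracelessPart_conjTranspose (diagPart_moment_conjTranspose M)) (half_skew _) h
    exact ⟨tracelessPart_eq_zero.mp h1, half_skew_eq_zero.mp h2⟩
  · rintro ⟨h1, h2⟩
    rw [sliceMap, tracelessPart_eq_zero.mpr h1, half_skew_eq_zero.mpr h2, add_zero]

/-- The derivative of `sliceMap` at `T`, as a function of the linearized moment map. -/
noncomputable def sliceDeriv (κ : I → V) (η : Matrix I I ℂ) : Matrix I I ℂ :=
  tracelessPart κ (η + ηᴴ) + (2⁻¹ : ℝ) • (η - ηᴴ)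

/-- The skew part forces `η` to be Hermitian, and then the first term is twice its component
complementary to the real block scalars. Hence the tangent space of the slice is the space counted
in `finrank_comap_realBlockScalar`. -/
theorem sliceDeriv_eq_zero {η : Matrix I I ℂ} :
    sliceDeriv κ η = 0 ↔ η ∈ realBlockScalar κ := by
  have hh : (η + ηᴴ)ᴴ = η + ηᴴ := by simp [add_comm]
  constructor
  · intro h
    obtain ⟨h1, h2⟩ := eq_zero_of_hermitian_add_skew (tracelessPart_conjTranspose hh)
      (half_skew η) h
    rw [half_skew_eq_zero] at h2
    rw [h2, tracelessPart_eq_zero] at h1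
    have := (realBlockScalar κ).smul_mem (2⁻¹ : ℝ) h1
    rwa [← two_smul ℝ η, smul_smul, inv_mul_cancel₀ two_ne_zero, one_smul] at this
  · intro h
    have h2 : ηᴴ = η := by rw [← scalarPart_of_mem h, scalarPart_conjTranspose]
    rw [sliceDeriv, h2, tracelessPart_eq_zero.mpr (add_mem h h), sub_self, smul_zero, add_zero]

/-- This supplies the range hypothesis of `exists_chart_of_level_set`. Since `sliceDeriv` doubles
the Hermitian part and reproduces the skew part, the preimage is half the moment term plus the gauge
term. -/
theorem exists_sliceDeriv_eq (T M : Matrix I I ℂ) :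
    ∃ η ∈ traceZero κ, sliceDeriv κ η = sliceMap κ T M := by
  set H := diagPart κ (M * Mᴴ - Mᴴ * M) with hH
  set s := (2⁻¹ : ℝ) • (momentLin κ T M - (momentLin κ T M)ᴴ) with hs
  have hHtr : trace H = 0 := by
    rw [hH, trace_diagPart, trace_sub, trace_mul_comm, sub_self]
  have hHH : Hᴴ = H := diagPart_moment_conjTranspose M
  have hsk : sᴴ = -s := half_skew _
  have hη := mem_traceZero.mp (momentLin_mem (κ := κ) T M)
  refine ⟨(2⁻¹ : ℝ) • tracelessPart κ H + s, mem_traceZero.mpr ⟨?_, ?_⟩, ?_⟩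
  · refine add_mem ?_ ?_
    · rw [tracelessPart_apply, scalarPart_apply]
      exact ((Subalgebra.toSubmodule (blockDiag κ)).restrictScalars ℝ).smul_mem _
        (sub_mem (diagPart_mem _) (diagonal_mem_blockDiag _))
    · exact ((Subalgebra.toSubmodule (blockDiag κ)).restrictScalars ℝ).smul_mem _
        (sub_mem hη.1 (conjTranspose_mem_blockDiag hη.1))
  · rw [trace_add, trace_smul, tracelessPart_apply, trace_sub, trace_scalarPart, hHtr, hs,
      trace_smul, trace_sub, trace_conjTranspose, hη.2]
    simp
  · have h1 : ((2⁻¹ : ℝ) • tracelessPart κ H)ᴴ = (2⁻¹ : ℝ) • tracelessPart κ H := by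
      rw [conjTranspose_smul, star_trivial, tracelessPart_conjTranspose hHH]
    have h2 : ∀ N : Matrix I I ℂ, (2⁻¹ : ℝ) • N + (2⁻¹ : ℝ) • N = N := fun N => by
      rw [← add_smul]; norm_num
    rw [sliceDeriv, conjTranspose_add, h1, hsk, sliceMap, ← hH, ← hs]
    congr 1
    · rw [add_add_add_comm, h2, add_neg_cancel, add_zero, tracelessPart_tracelessPart]
    · rw [add_sub_add_left_eq_sub, sub_neg_eq_add, smul_add, h2]

/-- Conjugate transposition as a continuous real linear map. -/
noncomputable def conjTransposeCLM : Matrix I I ℂ →L[ℝ] Matrix I I ℂ :=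
  LinearMap.toContinuousLinearMap
    { toFun := conjTranspose
      map_add' := conjTranspose_add
      map_smul' := fun r M => by simp [conjTranspose_smul] }

theorem conjTransposeCLM_apply (M : Matrix I I ℂ) : conjTransposeCLM M = Mᴴ := rfl

theorem sliceMap_eq (T M : Matrix I I ℂ) : sliceMap κ T M =
    LinearMap.toContinuousLinearMap (tracelessPart κ ∘ₗ (diagPart κ).restrictScalars ℝ)
      (M * conjTransposeCLM M - conjTransposeCLM M * M) +
    (2⁻¹ : ℝ) • (LinearMap.toContinuousLinearMap ((momentLin κ T).restrictScalars ℝ) M -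
      conjTransposeCLM (LinearMap.toContinuousLinearMap ((momentLin κ T).restrictScalars ℝ) M)) :=
  rfl

theorem contDiff_sliceMap (T : Matrix I I ℂ) : ContDiff ℝ ∞ (sliceMap κ T) := by
  have : sliceMap κ T = _ := funext (sliceMap_eq T)
  rw [this]
  have h1 : ContDiff ℝ ∞ fun M : Matrix I I ℂ => conjTransposeCLM M :=
    (conjTransposeCLM (I := I)).contDiff
  have h2 : ContDiff ℝ ∞ fun M : Matrix I I ℂ => M := contDiff_id
  have h3 := (LinearMap.toContinuousLinearMap ((momentLin κ T).restrictScalars ℝ)).contDiff (n := ∞)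
  exact ((ContinuousLinearMap.contDiff _).comp ((h2.mul h1).sub (h1.mul h2))).add
    ((h3.sub (conjTransposeCLM.contDiff.comp h3)).const_smul _)

/-- The quadratic moment map has derivative `η + ηᴴ` in the direction `X`, with `η` the linearized
moment of `X`; the gauge term is already linear. -/
theorem fderiv_sliceMap (T X : Matrix I I ℂ) :
    fderiv ℝ (sliceMap κ T) T X = sliceDeriv κ (momentLin κ T X) := by
  have h0 := ((contDiff_sliceMap (κ := κ) T).differentiable (by simp) T).hasFDerivAt
  have hl : HasDerivAt (fun t : ℝ => T + t • X) X 0 := by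
    have := ((hasDerivAt_id (0 : ℝ)).smul_const X).const_add T
    rw [one_smul] at this
    exact this
  have h1 : HasDerivAt (fun t : ℝ => sliceMap κ T (T + t • X)) (fderiv ℝ (sliceMap κ T) T X) 0 := by
    have h0' : HasFDerivAt (sliceMap κ T) (fderiv ℝ (sliceMap κ T) T) (T + (0 : ℝ) • X) := by
      rwa [zero_smul, add_zero]
    exact h0'.comp_hasDerivAt (0 : ℝ) hl
  have hc := conjTransposeCLM.hasFDerivAt.comp_hasDerivAt (0 : ℝ) hl
  have h2 := (((LinearMap.toContinuousLinearMap (tracelessPart κ ∘ₗ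
    (diagPart κ).restrictScalars ℝ)).hasFDerivAt.comp_hasDerivAt (0 : ℝ)
      ((hl.mul hc).sub (hc.mul hl))).add
    (((LinearMap.toContinuousLinearMap ((momentLin κ T).restrictScalars ℝ)
      ).hasFDerivAt.comp_hasDerivAt (0 : ℝ) hl).sub
      (conjTransposeCLM.hasFDerivAt.comp_hasDerivAt (0 : ℝ)
        ((LinearMap.toContinuousLinearMap ((momentLin κ T).restrictScalars ℝ)
      ).hasFDerivAt.comp_hasDerivAt (0 : ℝ) hl)) |>.const_smul (2⁻¹ : ℝ)))
  have h3 := h1.unique h2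
  rw [h3, sliceDeriv]
  simp only [Function.comp_apply, zero_smul, add_zero, conjTransposeCLM_apply]
  change tracelessPart κ (diagPart κ _) + _ = _
  congr 2
  rw [momentLin_apply, ← diagPart_conjTranspose, ← map_add]
  congr 1
  simp only [conjTranspose_sub, conjTranspose_mul, conjTranspose_conjTranspose]
  change X * Tᴴ + T * Xᴴ - (Xᴴ * T + Tᴴ * X) = _
  abel

end Slice

end BlockMatrix

/-! ### Smooth equivariant maps and the directions their traces cannot see -/

namespace BlockMatrix

open Matrix Module
open scoped ComplexOrder Topology Matrix.Norms.Frobenius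

set_option linter.unusedSectionVars false

section Equivariant

variable {I : Type*} [Fintype I] [DecidableEq I] {V : Type*} [DecidableEq V] {κ : I → V}
  {E : Type*} [NormedAddCommGroup E] [NormedSpace ℝ E] [FiniteDimensional ℝ E]

variable (κ) in
/-- The smooth matrix valued maps which are equivariant under the block unitary group. -/
def equivariantMaps (ι : E →L[ℝ] Matrix I I ℂ) : Subalgebra ℂ (E → Matrix I I ℂ) where
  carrier := {Z | ContDiff ℝ ∞ Z ∧ ∀ k ∈ unitaryBlocks κ, ∀ R R' : E, ι R' = k * ι R * kᴴ →
    Z R' = k * Z R * kᴴ}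
  add_mem' := fun {Y Z} hY hZ => ⟨hY.1.add hZ.1, fun k hk R R' h => by
    simp only [Pi.add_apply, hY.2 k hk R R' h, hZ.2 k hk R R' h, mul_add, add_mul]⟩
  mul_mem' := fun {Y Z} hY hZ => ⟨hY.1.mul hZ.1, fun k hk R R' h => by
    simp only [Pi.mul_apply, hY.2 k hk R R' h, hZ.2 k hk R R' h]
    rw [mul_assoc (k * _), mul_assoc k (Z R), ← mul_assoc kᴴ, conjTranspose_mul_self hk, one_mul]
    simp only [mul_assoc]⟩
  algebraMap_mem' := fun z => ⟨contDiff_const, fun k hk R R' _ => by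
    simp only [Pi.algebraMap_apply, Algebra.algebraMap_eq_smul_one, Matrix.mul_smul, mul_one,
      Matrix.smul_mul, mul_conjTranspose_self' hk]⟩

theorem conjTranspose_mem_equivariantMaps {ι : E →L[ℝ] Matrix I I ℂ} {Z : E → Matrix I I ℂ}
    (hZ : Z ∈ equivariantMaps κ ι) : (fun R => (Z R)ᴴ) ∈ equivariantMaps κ ι :=
  ⟨(conjTransposeCLM (I := I)).contDiff.comp hZ.1, fun k hk R R' h => by
    simp only [hZ.2 k hk R R' h, conjTranspose_mul, conjTranspose_conjTranspose, mul_assoc]⟩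

theorem inclusion_mem_equivariantMaps (ι : E →L[ℝ] Matrix I I ℂ) :
    (fun R => ι R) ∈ equivariantMaps κ ι :=
  ⟨ι.contDiff, fun _ _ _ _ h => h⟩

theorem const_mem_equivariantMaps (ι : E →L[ℝ] Matrix I I ℂ) (c : V → ℂ) :
    (fun _ => diagonal fun x => c (κ x)) ∈ equivariantMaps κ ι :=
  ⟨contDiff_const, fun k hk _ _ _ => by
    rw [mul_diagonal_comm hk.2 c, mul_assoc, mul_conjTranspose_self' hk, mul_one]⟩

/-- The values of the equivariant maps at an irreducible point fill the matrix algebra. -/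
theorem exists_equivariantMaps_eq {ι : E →L[ℝ] Matrix I I ℂ} {T : E}
    (hirr : IsIrreducible κ (ι T)) (M : Matrix I I ℂ) : ∃ Z ∈ equivariantMaps κ ι, Z T = M := by
  let S := (equivariantMaps κ ι).map (Pi.evalAlgHom ℂ (fun _ : E => Matrix I I ℂ) T)
  have hS : ∀ Z ∈ equivariantMaps κ ι, Z T ∈ S := fun Z hZ => ⟨Z, hZ, rfl⟩
  have htop : S = ⊤ := by
    -- The block projections, `ι T` and its adjoint are values of equivariant maps, so the commutant
    -- of all values is scalar by irreducibility.
    refine eq_top_of_commutant S ?_ fun g hg => ?_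
    · rintro _ ⟨Z, hZ, rfl⟩
      exact hS _ (conjTranspose_mem_equivariantMaps hZ)
    · refine hirr g (mem_blockDiag_of_commute fun v => hg _ ?_) (hg _ ?_) (hg _ ?_)
      · exact hS _ (const_mem_equivariantMaps ι fun w => if w = v then 1 else 0)
      · exact hS _ (inclusion_mem_equivariantMaps ι)
      · exact hS _ (conjTranspose_mem_equivariantMaps (inclusion_mem_equivariantMaps ι))
  have : M ∈ S := htop ▸ Algebra.mem_top
  obtain ⟨Z, hZ, rfl⟩ := this
  exact ⟨Z, hZ, rfl⟩

theorem hasDerivAt_line {Z : E → Matrix I I ℂ} (hZ : ContDiff ℝ ∞ Z) (T X : E) :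
    HasDerivAt (fun t : ℝ => Z (T + t • X)) (fderiv ℝ Z T X) 0 := by
  have hl : HasDerivAt (fun t : ℝ => T + t • X) X 0 := by
    have := ((hasDerivAt_id (0 : ℝ)).smul_const X).const_add T
    rw [one_smul] at this
    exact this
  have h0 : HasFDerivAt Z (fderiv ℝ Z T) (T + (0 : ℝ) • X) := by
    rw [zero_smul, add_zero]
    exact (hZ.differentiable (by simp) T).hasFDerivAt
  exact h0.comp_hasDerivAt (0 : ℝ) hl

theorem fderiv_mul_line {Y Z : E → Matrix I I ℂ} (hY : ContDiff ℝ ∞ Y) (hZ : ContDiff ℝ ∞ Z)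
    (T X : E) : fderiv ℝ (Y * Z) T X = fderiv ℝ Y T X * Z T + Y T * fderiv ℝ Z T X := by
  have h := (hasDerivAt_line (hY.mul hZ) T X).unique
    ((hasDerivAt_line hY T X).mul (hasDerivAt_line hZ T X))
  rw [zero_smul, add_zero] at h
  exact h

theorem fderiv_conjTranspose_line {Z : E → Matrix I I ℂ} (hZ : ContDiff ℝ ∞ Z)
    (T X : E) : fderiv ℝ (fun R => (Z R)ᴴ) T X = (fderiv ℝ Z T X)ᴴ :=
  (hasDerivAt_line ((conjTransposeCLM (I := I)).contDiff.comp hZ) T X).unique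
    (conjTransposeCLM.hasFDerivAt.comp_hasDerivAt (0 : ℝ) (hasDerivAt_line hZ T X))

theorem fderiv_smul_line {Z : E → Matrix I I ℂ} (hZ : ContDiff ℝ ∞ Z) (z : ℂ)
    (T X : E) : fderiv ℝ (z • Z) T X = z • fderiv ℝ Z T X :=
  (hasDerivAt_line (hZ.const_smul z) T X).unique ((hasDerivAt_line hZ T X).const_smul z)

theorem fderiv_add_line {Y Z : E → Matrix I I ℂ} (hY : ContDiff ℝ ∞ Y) (hZ : ContDiff ℝ ∞ Z)
    (T X : E) : fderiv ℝ (Y + Z) T X = fderiv ℝ Y T X + fderiv ℝ Z T X :=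
  (hasDerivAt_line (hY.add hZ) T X).unique ((hasDerivAt_line hY T X).add (hasDerivAt_line hZ T X))

/-- A direction which is killed by the differentials of all invariants is tangent to the orbit. -/
theorem exists_skew_of_fderiv_trace_eq_zero {ι : E →L[ℝ] Matrix I I ℂ} {T : E}
    (hirr : IsIrreducible κ (ι T)) {X : E}
    (hX : ∀ Z ∈ equivariantMaps κ ι, (trace (fderiv ℝ Z T X)).re = 0) :
    ∃ ξ ∈ blockDiag κ, ξᴴ = -ξ ∧ ι X = ξ * ι T - ι T * ξ := by
  -- Equivariant maps form a complex algebra; multiplying `Z` by `-Complex.I` turns the imaginary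
  -- part of the trace into a real part.
  have htr : ∀ Z ∈ equivariantMaps κ ι, trace (fderiv ℝ Z T X) = 0 := fun Z hZ => by
    refine Complex.ext (hX Z hZ) ?_
    have h := hX _ ((equivariantMaps κ ι).smul_mem hZ (-Complex.I))
    rw [fderiv_smul_line hZ.1, trace_smul] at h
    simpa using h
  -- If `Z` vanishes at `T`, then multiplying by an equivariant `Y` whose value there is the adjoint
  -- of the derivative of `Z` gives the squared norm of that derivative as a trace, so it is zero.
  have hwd : ∀ Z ∈ equivariantMaps κ ι, Z T = 0 → fderiv ℝ Z T X = 0 := fun Z hZ h0 => by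
    obtain ⟨Y, hY, hYT⟩ := exists_equivariantMaps_eq hirr (fderiv ℝ Z T X)ᴴ
    have h := htr _ (mul_mem hZ hY)
    rw [fderiv_mul_line hZ.1 hY.1, h0, zero_mul, add_zero, hYT,
      trace_mul_conjTranspose_self_eq_zero_iff] at h
    exact h
  choose z hz hzT using fun M => exists_equivariantMaps_eq (ι := ι) hirr M
  have hD : ∀ Z ∈ equivariantMaps κ ι, fderiv ℝ (z (Z T)) T X = fderiv ℝ Z T X := fun Z hZ => by
    have h := hwd (z (Z T) + (-1 : ℂ) • Z)
      (add_mem (hz _) ((equivariantMaps κ ι).smul_mem hZ _)) (by simp [hzT])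
    rw [fderiv_add_line (hz _).1 ((equivariantMaps κ ι).smul_mem hZ _).1, fderiv_smul_line hZ.1, neg_one_smul] at h
    exact add_neg_eq_zero.mp h
  have hDv : ∀ Z ∈ equivariantMaps κ ι, ∀ M, Z T = M → fderiv ℝ (z M) T X = fderiv ℝ Z T X :=
    fun Z hZ M h => h ▸ hD Z hZ
  -- The derivative along `X` now depends only on the value at `T`. As these values exhaust all
  -- matrices, it descends to a linear map, and the product rule makes it a derivation.
  let D : Matrix I I ℂ →ₗ[ℂ] Matrix I I ℂ :=
    { toFun := fun M => fderiv ℝ (z M) T X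
      map_add' := fun M N => by
        rw [hDv _ (add_mem (hz M) (hz N)) _ (by simp [hzT]), fderiv_add_line (hz M).1 (hz N).1]
      map_smul' := fun c M => by
        rw [hDv _ ((equivariantMaps κ ι).smul_mem (hz M) c) _ (by simp [hzT]),
          fderiv_smul_line (hz M).1, RingHom.id_apply] }
  obtain ⟨ξ, hξ⟩ := exists_commutator_of_derivation D fun M N => by
    change fderiv ℝ (z (M * N)) T X = fderiv ℝ (z M) T X * N + M * fderiv ℝ (z N) T X
    rw [hDv _ (mul_mem (hz M) (hz N)) _ (by simp [hzT]), fderiv_mul_line (hz M).1 (hz N).1, hzT,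
      hzT]
  have hstar : ∀ M, D Mᴴ = (D M)ᴴ := fun M => by
    change fderiv ℝ (z Mᴴ) T X = (fderiv ℝ (z M) T X)ᴴ
    rw [hDv _ (conjTranspose_mem_equivariantMaps (hz M)) _ (by simp [hzT]),
      fderiv_conjTranspose_line (hz M).1]
  have hT : D (ι T) = ι X := by
    change fderiv ℝ (z (ι T)) T X = ι X
    rw [hDv _ (inclusion_mem_equivariantMaps ι) _ rfl]
    exact congrFun (congrArg DFunLike.coe ι.fderiv) X
  -- Differentiation commutes with the adjoint, so `-ξᴴ` implements `D` on `ι T` as well as `ξ`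
  -- does; averaging the two gives a skew-Hermitian generator.
  have h2 : D (ι T) = -(ξᴴ * ι T - ι T * ξᴴ) := by
    have h := hstar (ι T)ᴴ
    rw [conjTranspose_conjTranspose, hξ (ι T)ᴴ] at h
    rw [h]
    simp only [conjTranspose_sub, conjTranspose_mul, conjTranspose_conjTranspose, neg_sub]
  -- The block projections are values of constant equivariant maps, so `D` kills them and `ξ`
  -- commutes with them.
  have hξm : ξ ∈ blockDiag κ := mem_blockDiag_of_commute fun v => by
    rw [← sub_eq_zero, ← hξ]
    change fderiv ℝ (z _) T X = 0
    rw [hDv _ (const_mem_equivariantMaps ι fun w => if w = v then 1 else 0) _ rfl,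
      fderiv_const_apply]
    rfl
  refine ⟨(2⁻¹ : ℝ) • (ξ - ξᴴ),
    ((Subalgebra.toSubmodule (blockDiag κ)).restrictScalars ℝ).smul_mem _
      (sub_mem hξm (conjTranspose_mem_blockDiag hξm)), half_skew ξ, ?_⟩
  have h3 : ι X = (2⁻¹ : ℝ) • (D (ι T) + D (ι T)) := by
    rw [hT, ← two_smul ℝ, smul_smul, inv_mul_cancel₀ two_ne_zero, one_smul]
  rw [h3, Matrix.smul_mul, Matrix.mul_smul, ← smul_sub]
  congr 1
  nth_rewrite 2 [h2]
  rw [hξ, sub_mul, mul_sub]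
  abel

end Equivariant

end BlockMatrix

/-! ### Local parameters near an irreducible balanced matrix -/

namespace BlockMatrix

open Matrix Module
open scoped ComplexOrder Topology Matrix.Norms.Frobenius

set_option linter.unusedSectionVars false

section Local

variable {I : Type*} [Fintype I] [DecidableEq I] {V : Type*} [DecidableEq V] {κ : I → V}
  {E : Type*} [NormedAddCommGroup E] [NormedSpace ℝ E] [FiniteDimensional ℝ E]

/-- Near an irreducible balanced matrix all balanced matrices are irreducible. -/
theorem eventually_isIrreducible [Nonempty I] {T : Matrix I I ℂ} (hT : IsBalanced κ T)
    (hirr : IsIrreducible κ T) : ∀ᶠ R in 𝓝 T, IsIrreducible κ R := by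
  -- Restricted to trace zero matrices, the commutator with `T` is injective, the scalars having
  -- been removed. Injectivity is an open condition and yields irreducibility of nearby `R`.
  let c : Matrix I I ℂ → (traceZero κ →L[ℂ] Matrix I I ℂ) := fun R =>
    ((ContinuousLinearMap.mul ℂ (Matrix I I ℂ)).flip R - ContinuousLinearMap.mul ℂ (Matrix I I ℂ) R)
      ∘L (traceZero κ).subtypeL
  have hc : ∀ R (g : traceZero κ), c R g = g.1 * R - R * g.1 := fun _ _ => rfl
  have hcard : (Fintype.card I : ℂ) ≠ 0 := Nat.cast_ne_zero.mpr Fintype.card_ne_zero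
  have hinj : Function.Injective (c T) := by
    rw [injective_iff_map_eq_zero]
    intro g hg
    rw [hc, sub_eq_zero] at hg
    have hg2 := mem_traceZero.mp g.2
    obtain ⟨z, hz⟩ := exists_smul_one_of_commute hT hirr hg2.1 hg
    have h1 := hg2.2
    rw [hz, trace_smul, trace_one, smul_eq_mul, mul_eq_zero, or_iff_left hcard] at h1
    exact Subtype.ext (by rw [hz, h1, zero_smul]; rfl)
  have hcont : Continuous c :=
    ((ContinuousLinearMap.mul ℂ (Matrix I I ℂ)).flip.continuous.sub
      (ContinuousLinearMap.mul ℂ (Matrix I I ℂ)).continuous).clm_comp continuous_const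
  have hopen : {R | Function.Injective (c R)} ∈ 𝓝 T :=
    (ContinuousLinearMap.isOpen_injective.preimage hcont).mem_nhds hinj
  filter_upwards [hopen] with R hR g hg hgR _
  refine ⟨trace g / Fintype.card I, ?_⟩
  set s : Matrix I I ℂ := (trace g / Fintype.card I) • (1 : Matrix I I ℂ) with hs
  have hmem : g - s ∈ traceZero κ := mem_traceZero.mpr
    ⟨sub_mem hg ((blockDiag κ).smul_mem (one_mem _) _), by
      rw [trace_sub, hs, trace_smul, trace_one, smul_eq_mul, div_mul_cancel₀ _ hcard, sub_self]⟩
  have h0 : c R ⟨g - s, hmem⟩ = 0 := by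
    rw [hc]
    simp [hs, sub_mul, mul_sub, hgR]
  have := hR (h0.trans (map_zero _).symm)
  exact sub_eq_zero.mp (congrArg Subtype.val this)

theorem realBlockScalar_conjTranspose {η : Matrix I I ℂ} (h : η ∈ realBlockScalar κ) :
    ηᴴ = η := by
  rw [← scalarPart_of_mem h, scalarPart_conjTranspose]

/-- Directions in the slice are separated by the differentials of the invariants. -/
theorem eq_zero_of_fderiv_trace_eq_zero {ι : E →L[ℝ] Matrix I I ℂ} (hι : Function.Injective ι)
    {T : E} (hirr : IsIrreducible κ (ι T)) {X : E}
    (hXs : momentLin κ (ι T) (ι X) ∈ realBlockScalar κ)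
    (hX : ∀ Z ∈ equivariantMaps κ ι, (trace (fderiv ℝ Z T X)).re = 0) :
    X = 0 := by
  obtain ⟨ξ, hξ, hs, hξX⟩ := exists_skew_of_fderiv_trace_eq_zero hirr hX
  have h1 := re_trace_skew_mul hs (realBlockScalar_conjTranspose hXs)
  rw [momentLin_apply, trace_mul_diagPart hξ] at h1
  have h2 : (ι X)ᴴ = ξ * (ι T)ᴴ - (ι T)ᴴ * ξ := by
    rw [hξX, conjTranspose_sub, conjTranspose_mul, conjTranspose_mul, hs]
    simp only [mul_neg, neg_mul]
    abel
  -- For the orbit direction `[ξ, T]` the squared norm equals the pairing of `ξ` with its linearized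
  -- moment, and this has real part zero because one is skew and the other Hermitian.
  have h3 : (trace (ι X * (ι X)ᴴ)).re = 0 := by
    have e1 : trace (ι X * (ξ * (ι T)ᴴ)) = trace (ξ * ((ι T)ᴴ * ι X)) := by
      rw [trace_mul_comm, mul_assoc]
    have e2 : trace (ι X * ((ι T)ᴴ * ξ)) = trace (ξ * (ι X * (ι T)ᴴ)) := by
      rw [← mul_assoc, trace_mul_comm]
    rw [mul_sub, trace_sub, Complex.sub_re] at h1
    rw [h2, mul_sub, trace_sub, e1, e2, Complex.sub_re]
    linarith
  exact hι ((eq_zero_of_re_trace h3).trans (map_zero ι).symm)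

/-- Finitely many invariants which are coordinates on the slice, normalized to `1` at `T`. -/
theorem exists_invariant_coordinates {ι : E →L[ℝ] Matrix I I ℂ} (hι : Function.Injective ι)
    {T : E} (hirr : IsIrreducible κ (ι T)) {m : ℕ}
    (hm : finrank ℝ ((realBlockScalar κ).comap
      ((momentLin κ (ι T)).restrictScalars ℝ ∘ₗ (ι : E →ₗ[ℝ] Matrix I I ℂ))) = m) :
    ∃ P : E → Fin m → ℝ, ContDiff ℝ ∞ P ∧ (∀ k, P T k = 1) ∧
      (∀ k ∈ unitaryBlocks κ, ∀ R R', ι R' = k * ι R * kᴴ → P R' = P R) ∧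
      ∀ X, momentLin κ (ι T) (ι X) ∈ realBlockScalar κ → fderiv ℝ P T X = 0 → X = 0 := by
  set L := (realBlockScalar κ).comap
    ((momentLin κ (ι T)).restrictScalars ℝ ∘ₗ (ι : E →ₗ[ℝ] Matrix I I ℂ))
  let τ : Matrix I I ℂ →L[ℝ] ℝ := LinearMap.toContinuousLinearMap
    (Complex.reLm ∘ₗ (traceLinearMap I ℂ ℂ).restrictScalars ℝ)
  have hτ : ∀ M, τ M = (trace M).re := fun _ => rfl
  -- An equivariant map is sent to the differential at `T` of the real part of its trace, restricted
  -- to the tangent space `L` of the slice.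
  let Φ : equivariantMaps κ ι →ₗ[ℝ] Dual ℝ L :=
    { toFun := fun Z => ((τ ∘L fderiv ℝ Z.1 T : E →L[ℝ] ℝ) : E →ₗ[ℝ] ℝ) ∘ₗ L.subtype
      map_add' := fun Y Z => by
        ext X
        change τ (fderiv ℝ (Y.1 + Z.1) T X) = τ (fderiv ℝ Y.1 T X) + τ (fderiv ℝ Z.1 T X)
        rw [fderiv_add_line Y.2.1 Z.2.1, map_add]
      map_smul' := fun r Z => by
        ext X
        change τ (fderiv ℝ ((r : ℂ) • Z.1) T X) = r * τ (fderiv ℝ Z.1 T X)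
        rw [fderiv_smul_line Z.2.1, hτ, hτ, trace_smul]
        simp }
  have hΦ : ∀ Z X, Φ Z X = (trace (fderiv ℝ Z.1 T X)).re := fun _ _ => rfl
  -- No nonzero vector of `L` is annihilated by the range, so in finite dimension every functional,
  -- in particular every coordinate, is the differential of an invariant.
  have htop : LinearMap.range Φ = ⊤ := by
    have h1 := Subspace.finrank_add_finrank_dualCoannihilator_eq (LinearMap.range Φ)
    have h2 : (LinearMap.range Φ).dualCoannihilator = ⊥ := by
      rw [eq_bot_iff]
      intro X hX
      rw [Submodule.mem_dualCoannihilator] at hX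
      rw [Submodule.mem_bot]
      exact Subtype.ext (eq_zero_of_fderiv_trace_eq_zero hι hirr X.2
        fun Z hZ => hX _ ⟨⟨Z, hZ⟩, rfl⟩)
    rw [h2, finrank_bot, add_zero] at h1
    exact Submodule.eq_top_of_finrank_eq (h1.trans Subspace.dual_finrank_eq.symm)
  let b := finBasisOfFinrankEq ℝ L hm
  have hZ : ∀ k, ∃ Z, Φ Z = b.coord k := fun k => by
    have : b.coord k ∈ LinearMap.range Φ := htop ▸ Submodule.mem_top
    exact this
  choose Z hZ using hZ
  -- The shift by constants normalizes every invariant to `1` at `T`, so that the parameters are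
  -- positive near `T`.
  have hPk : ∀ k, ContDiff ℝ ∞ fun R => τ ((Z k).1 R) - τ ((Z k).1 T) + 1 := fun k =>
    ((τ.contDiff.comp (Z k).2.1).sub contDiff_const).add contDiff_const
  have hPd : ∀ k, HasFDerivAt (fun R => τ ((Z k).1 R) - τ ((Z k).1 T) + 1)
      (τ ∘L fderiv ℝ (Z k).1 T) T := fun k =>
    ((τ.hasFDerivAt.comp T ((Z k).2.1.differentiable (by simp) T).hasFDerivAt).sub_const
      _).add_const _
  refine ⟨fun R k => τ ((Z k).1 R) - τ ((Z k).1 T) + 1, contDiff_pi.mpr hPk, fun k => by simp,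
    fun k hk R R' h => ?_, fun X hXL hX => ?_⟩
  · funext i
    simp only [hτ]
    rw [(Z i).2.2 k hk R R' h, trace_mul_comm, ← mul_assoc, conjTranspose_mul_self hk, one_mul]
  · have h0 : (⟨X, hXL⟩ : L) = 0 := by
      rw [← b.forall_coord_eq_zero_iff]
      intro k
      rw [← hZ k, hΦ]
      have h1 : fderiv ℝ (fun R k => τ ((Z k).1 R) - τ ((Z k).1 T) + 1) T =
          ContinuousLinearMap.pi fun k => τ ∘L fderiv ℝ (Z k).1 T :=
        (hasFDerivAt_pi.mpr hPd).fderiv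
      rw [h1] at hX
      exact congrFun hX k
    exact congrArg Subtype.val h0

/-- The irreducible balanced matrices supported on the arrows depend, up to conjugation by block
unitary matrices, locally on `|V| + 1` parameters. -/
theorem exists_local_parameters [Nonempty I] [Fintype V] {A : V → V → Prop}
    (hκ : Function.Surjective κ)
    (hdim : finrank ℂ (arrowMatrices κ A) = finrank ℂ (blockDiag κ))
    {ι : E →L[ℝ] Matrix I I ℂ} (hι : Function.Injective ι)
    (hr : LinearMap.range (ι : E →ₗ[ℝ] Matrix I I ℂ) = (arrowMatrices κ A).restrictScalars ℝ)
    {T : E} (hT : IsBalanced κ (ι T)) (hirr : IsIrreducible κ (ι T)) :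
    ∃ (O : Set E) (W : Set (Fin (Fintype.card V + 1) → ℝ))
      (P : E → Fin (Fintype.card V + 1) → ℝ) (F : (Fin (Fintype.card V + 1) → ℝ) → E),
      IsOpen O ∧ T ∈ O ∧ IsOpen W ∧ (∀ w ∈ W, ∀ k, 0 < w k) ∧
      ContDiff ℝ ∞ P ∧ ContDiffOn ℝ ∞ F W ∧
      (∀ R ∈ O, ∀ R', (∃ k ∈ unitaryBlocks κ, ι R' = k * ι R * kᴴ) → R' ∈ O ∧ P R' = P R) ∧
      (∀ w ∈ W, F w ∈ O ∧ IsBalanced κ (ι (F w)) ∧ IsIrreducible κ (ι (F w)) ∧ P (F w) = w) ∧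
      ∀ R ∈ O, IsBalanced κ (ι R) →
        P R ∈ W ∧ ∃ k ∈ unitaryBlocks κ, ι (F (P R)) = k * ι R * kᴴ := by
  have hmemA : ∀ R, ι R ∈ arrowMatrices κ A := fun R => by
    have : ι R ∈ LinearMap.range (ι : E →ₗ[ℝ] Matrix I I ℂ) := ⟨R, rfl⟩
    rw [hr] at this
    exact this
  have hL := finrank_comap_realBlockScalar hκ hdim (ι : E →ₗ[ℝ] Matrix I I ℂ) hι hr (hmemA T) hT
    hirr
  obtain ⟨P, hP, hPT, hPinv, hPinj⟩ := exists_invariant_coordinates hι hirr hL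
  let f : E → Matrix I I ℂ := fun R => sliceMap κ (ι T) (ι R)
  have hf : ContDiff ℝ ∞ f := (contDiff_sliceMap (ι T)).comp ι.contDiff
  have hfd : ∀ X, fderiv ℝ f T X = sliceDeriv κ (momentLin κ (ι T) (ι X)) := fun X => by
    have h1 : HasFDerivAt f (fderiv ℝ (sliceMap κ (ι T)) (ι T) ∘L ι) T :=
      ((contDiff_sliceMap (ι T)).differentiable (by simp) (ι T)).hasFDerivAt.comp T ι.hasFDerivAt
    rw [h1.fderiv, ← fderiv_sliceMap]
    rfl
  have hker : LinearMap.ker (fderiv ℝ f T : E →ₗ[ℝ] Matrix I I ℂ) = (realBlockScalar κ).comap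
      ((momentLin κ (ι T)).restrictScalars ℝ ∘ₗ (ι : E →ₗ[ℝ] Matrix I I ℂ)) := by
    ext X
    rw [LinearMap.mem_ker, ContinuousLinearMap.coe_coe, hfd, sliceDeriv_eq_zero]
    rfl
  have hN : {R | IsIrreducible κ (ι R) ∧ ∀ k, 0 < P R k} ∈ 𝓝 T := by
    refine Filter.inter_mem (ι.continuous.continuousAt.eventually
      (eventually_isIrreducible hT hirr)) (Filter.eventually_all.mpr fun k => ?_)
    have : ContinuousAt (fun R => P R k) T :=
      ((continuous_apply k).comp hP.continuous).continuousAt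
    exact this.eventually_const_lt (by simp [hPT])
  -- The chart lives on the zero set of `f`, within a neighbourhood where irreducibility and
  -- positivity persist.
  obtain ⟨S, W, F, hSo, hTS, hSN, hWo, hF, hFW, hSW⟩ := exists_chart_of_level_set hf hP
    (fun R => by
      obtain ⟨η, hη, h⟩ := exists_sliceDeriv_eq (κ := κ) (ι T) (ι R)
      obtain ⟨Y, hY, rfl⟩ := exists_momentLin_eq (hmemA T) hT hirr hη
      have : Y ∈ LinearMap.range (ι : E →ₗ[ℝ] Matrix I I ℂ) := hr ▸ hY
      obtain ⟨X, rfl⟩ := this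
      exact ⟨X, (hfd X).trans h⟩)
    (fun X h1 h2 => hPinj X (sliceDeriv_eq_zero.mp ((hfd X).symm.trans h1)) h2)
    (Eq.trans (congrArg (fun S : Submodule ℝ E => finrank ℝ S) hker) hL) hN
  obtain ⟨ε, hε, hεS⟩ : ∃ ε > 0, ∀ R, ‖ι R - ι T‖ < ε → R ∈ S := by
    have h1 := (LinearMap.isClosedEmbedding_of_injective
      (f := (ι : E →ₗ[ℝ] Matrix I I ℂ)) (LinearMap.ker_eq_bot.mpr hι)).isInducing.nhds_eq_comap T
    have h2 := hSo.mem_nhds hTS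
    rw [h1, Filter.mem_comap] at h2
    obtain ⟨t, ht, hts⟩ := h2
    obtain ⟨ε, hε, hb⟩ := Metric.mem_nhds_iff.mp ht
    exact ⟨ε, hε, fun R hR => hts (hb (by rw [Metric.mem_ball, dist_eq_norm]; exact hR))⟩
  have hFc : ContinuousOn (fun w => ‖ι (F w) - ι T‖) W :=
    ((ι.continuous.comp_continuousOn hF.continuousOn).sub continuousOn_const).norm
  -- The neighbourhood is the union of all orbits that come within `ε` of `T`, hence invariant. The
  -- parameters are restricted to normal forms that are themselves within `ε` of `T`.
  refine ⟨{R | ∃ k ∈ unitaryBlocks κ, ‖k * ι R * kᴴ - ι T‖ < ε},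
    W ∩ (fun w => ‖ι (F w) - ι T‖) ⁻¹' Set.Iio ε, P, F, ?_,
    ⟨1, one_mem_unitaryBlocks, by simpa using hε⟩, hFc.isOpen_inter_preimage hWo isOpen_Iio, ?_, hP,
    hF.mono Set.inter_subset_left, ?_, ?_, ?_⟩
  · have : {R | ∃ k ∈ unitaryBlocks κ, ‖k * ι R * kᴴ - ι T‖ < ε} =
        ⋃ k ∈ unitaryBlocks κ, {R | ‖k * ι R * kᴴ - ι T‖ < ε} := by
      ext R; simp
    rw [this]
    refine isOpen_biUnion fun k _ => isOpen_lt ?_ continuous_const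
    have := ι.continuous
    fun_prop
  · intro w hw
    obtain ⟨h1, -, h3⟩ := hFW w hw.1
    have := (hSN h1).2
    rwa [h3] at this
  · rintro R ⟨l, hl, hlR⟩ R' ⟨k, hk, h⟩
    refine ⟨⟨l * kᴴ, mul_mem_unitaryBlocks hl (conjTranspose_mem_unitaryBlocks hk), ?_⟩,
      hPinv k hk R R' h⟩
    have : l * kᴴ * ι R' * (l * kᴴ)ᴴ = l * ι R * lᴴ := by
      rw [h, conjTranspose_mul, conjTranspose_conjTranspose]
      have e : l * kᴴ * (k * ι R * kᴴ) * (k * lᴴ) = l * (kᴴ * k) * ι R * (kᴴ * k) * lᴴ := by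
        simp only [mul_assoc]
      rw [e, conjTranspose_mul_self hk, mul_one, mul_one]
    rw [this]
    exact hlR
  · intro w hw
    obtain ⟨h1, h2, h3⟩ := hFW w hw.1
    refine ⟨⟨1, one_mem_unitaryBlocks, ?_⟩, (sliceMap_eq_zero.mp h2).1, (hSN h1).1, h3⟩
    simpa using hw.2
  · rintro R ⟨l, hl, hlR⟩ hR
    -- The closest point of the orbit of `R` is balanced and satisfies the gauge condition. It is no
    -- farther from `T` than the point conjugated by `l`, so it lies in the domain of the chart.
    obtain ⟨k, hk, hmin, hherm⟩ := exists_closest (κ := κ) (ι T) (ι R)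
    have hmem : k * ι R * kᴴ ∈ LinearMap.range (ι : E →ₗ[ℝ] Matrix I I ℂ) := by
      rw [hr]
      exact mem_arrowMatrices_mul (conjTranspose_mem_unitaryBlocks hk).2
        (mul_mem_arrowMatrices hk.2 (hmemA R))
    obtain ⟨R₁, hR₁⟩ := hmem
    rw [ContinuousLinearMap.coe_coe] at hR₁
    have hlt : ‖ι R₁ - ι T‖ < ε := hR₁ ▸ (hmin l hl).trans_lt hlR
    have h0 : f R₁ = 0 := by
      refine sliceMap_eq_zero.mpr ⟨?_, ?_⟩
      · rw [hR₁]; exact hR.conj hk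
      · rw [hR₁]; exact hherm
    obtain ⟨h1, h2⟩ := hSW R₁ (hεS R₁ hlt) h0
    rw [hPinv k hk R R₁ hR₁] at h1 h2
    refine ⟨⟨h1, ?_⟩, k, hk, by rw [h2, hR₁]⟩
    rw [Set.mem_preimage, h2]
    exact hlt

end Local

end BlockMatrix

/-! ### Representations as block matrices; orthoscalar means balanced -/

namespace HilbertRep

open Matrix Module BlockMatrix
open scoped InnerProductSpace

set_option linter.unusedSectionVars false

section Translation

variable {V : Type u} [Quiver.{v} V] [Fintype V] [DecidableEq V] [∀ i j : V, Fintype (i ⟶ j)]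
  {δ : V → ℕ}

/-- The relation "there is an arrow". -/
def HasArrow (V : Type u) [Quiver.{v} V] (i j : V) : Prop := Nonempty (i ⟶ j)

/-- A representation as one matrix, with rows and columns indexed by the standard basis vectors of
all the spaces. -/
noncomputable def toMatrix : HilbertRep V δ →ₗ[ℝ]
    Matrix (Σ v : V, Fin (δ v)) (Σ v : V, Fin (δ v)) ℂ where
  toFun T := Matrix.of fun x y => ∑ a : (y.1 ⟶ x.1), T y.1 x.1 a (EuclideanSpace.single y.2 1) x.2
  map_add' S T := by ext x y; simp [Finset.sum_add_distrib]
  map_smul' r T := by ext x y; simp [Finset.mul_sum]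

theorem toMatrix_apply (T : HilbertRep V δ) (x y : Σ v : V, Fin (δ v)) :
    toMatrix T x y = ∑ a : (y.1 ⟶ x.1), T y.1 x.1 a (EuclideanSpace.single y.2 1) x.2 := rfl

theorem toMatrix_mem (T : HilbertRep V δ) :
    toMatrix T ∈ arrowMatrices Sigma.fst (HasArrow V) := fun x y h => by
  have : IsEmpty (y.1 ⟶ x.1) := not_nonempty_iff.mp h
  rw [toMatrix_apply, Finset.univ_eq_empty, Finset.sum_empty]

theorem toMatrix_arrow (hV : HasNoMultipleArrows V) (T : HilbertRep V δ) {i j : V} (a : i ⟶ j)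
    (s : Fin (δ j)) (t : Fin (δ i)) :
    toMatrix T ⟨j, s⟩ ⟨i, t⟩ = T i j a (EuclideanSpace.single t 1) s := by
  rw [toMatrix_apply]
  exact Fintype.sum_eq_single a fun b hb => absurd (hV _ _ b a) hb

theorem apply_eq_sum (hV : HasNoMultipleArrows V) (T : HilbertRep V δ) {i j : V} (a : i ⟶ j)
    (x : EuclideanSpace ℂ (Fin (δ i))) (s : Fin (δ j)) :
    T i j a x s = ∑ t, toMatrix T ⟨j, s⟩ ⟨i, t⟩ * x t := by
  have hx : x = ∑ t, x t • EuclideanSpace.single t (1 : ℂ) := by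
    ext t
    simp [Finset.sum_apply, Pi.single_apply]
  conv_lhs => rw [hx]
  simp [toMatrix_arrow hV T a, mul_comm]

theorem adjoint_apply_eq_sum (hV : HasNoMultipleArrows V) (T : HilbertRep V δ) {i j : V}
    (a : i ⟶ j) (x : EuclideanSpace ℂ (Fin (δ j))) (t : Fin (δ i)) :
    ContinuousLinearMap.adjoint (T i j a) x t =
      ∑ s, star (toMatrix T ⟨j, s⟩ ⟨i, t⟩) * x s := by
  have h : ContinuousLinearMap.adjoint (T i j a) x t =
      ⟪EuclideanSpace.single t (1 : ℂ), ContinuousLinearMap.adjoint (T i j a) x⟫_ℂ := by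
    simp [EuclideanSpace.inner_single_left]
  rw [h, ContinuousLinearMap.adjoint_inner_right, PiLp.inner_apply]
  refine Finset.sum_congr rfl fun s _ => ?_
  rw [toMatrix_arrow hV T a, RCLike.inner_apply, mul_comm]
  rfl

theorem toMatrix_injective (hV : HasNoMultipleArrows V) :
    Function.Injective (toMatrix : HilbertRep V δ →ₗ[ℝ] _) := fun S T h => by
  funext i j a
  ext x s
  rw [apply_eq_sum hV, apply_eq_sum hV, h]

theorem range_toMatrix (hV : HasNoMultipleArrows V) :
    LinearMap.range (toMatrix : HilbertRep V δ →ₗ[ℝ] _) =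
      (arrowMatrices Sigma.fst (HasArrow V)).restrictScalars ℝ := by
  apply le_antisymm
  · rintro _ ⟨T, rfl⟩
    exact toMatrix_mem T
  · intro M hM
    refine ⟨fun i j _ => LinearMap.toContinuousLinearMap
      (toEuclideanLin (Matrix.of fun (s : Fin (δ j)) (t : Fin (δ i)) => M ⟨j, s⟩ ⟨i, t⟩)), ?_⟩
    ext ⟨j, s⟩ ⟨i, t⟩
    by_cases h : HasArrow V i j
    · obtain ⟨a⟩ := h
      rw [toMatrix_arrow hV _ a]
      simp [toLpLin_apply]
    · rw [toMatrix_mem _ _ _ h, hM _ _ h]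

/-- The blocks of a product with a block diagonal matrix. -/
theorem blockDiag_mul_apply {g M : Matrix (Σ v : V, Fin (δ v)) (Σ v : V, Fin (δ v)) ℂ}
    (hg : g ∈ BlockMatrix.blockDiag Sigma.fst) (j : V) (s : Fin (δ j)) (y : Σ v : V, Fin (δ v)) :
    (g * M) ⟨j, s⟩ y = ∑ s', g ⟨j, s⟩ ⟨j, s'⟩ * M ⟨j, s'⟩ y := by
  rw [mul_apply, Fintype.sum_sigma]
  exact Fintype.sum_eq_single j fun w hw => Finset.sum_eq_zero fun t _ => by
    rw [hg ⟨j, s⟩ ⟨w, t⟩ hw.symm, zero_mul]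

theorem mul_blockDiag_apply {g M : Matrix (Σ v : V, Fin (δ v)) (Σ v : V, Fin (δ v)) ℂ}
    (hg : g ∈ BlockMatrix.blockDiag Sigma.fst) (x : Σ v : V, Fin (δ v)) (i : V) (t : Fin (δ i)) :
    (M * g) x ⟨i, t⟩ = ∑ t', M x ⟨i, t'⟩ * g ⟨i, t'⟩ ⟨i, t⟩ := by
  rw [mul_apply, Fintype.sum_sigma]
  exact Fintype.sum_eq_single i fun w hw => Finset.sum_eq_zero fun t' _ => by
    rw [hg ⟨w, t'⟩ ⟨i, t⟩ hw, mul_zero]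

theorem incoming_apply (hV : HasNoMultipleArrows V) (T : HilbertRep V δ) (i : V)
    (x : EuclideanSpace ℂ (Fin (δ i))) (s : Fin (δ i)) :
    (∑ j, ∑ a : (j ⟶ i), (T j i a) ∘L ContinuousLinearMap.adjoint (T j i a)) x s =
      ∑ s', (toMatrix T * (toMatrix T)ᴴ) ⟨i, s⟩ ⟨i, s'⟩ * x s' := by
  have h : ∀ j, ((∑ a : (j ⟶ i), (T j i a) ∘L ContinuousLinearMap.adjoint (T j i a)) x) s =
      ∑ s', (∑ t, toMatrix T ⟨i, s⟩ ⟨j, t⟩ * star (toMatrix T ⟨i, s'⟩ ⟨j, t⟩)) * x s' := fun j => by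
    by_cases hj : HasArrow V j i
    · obtain ⟨a⟩ := hj
      have h1 : ∑ b : (j ⟶ i), (T j i b) ∘L ContinuousLinearMap.adjoint (T j i b) =
          (T j i a) ∘L ContinuousLinearMap.adjoint (T j i a) :=
        Fintype.sum_eq_single a fun b hb => absurd (hV _ _ b a) hb
      rw [h1, ContinuousLinearMap.comp_apply, apply_eq_sum hV]
      simp only [adjoint_apply_eq_sum hV, Finset.mul_sum, Finset.sum_mul]
      rw [Finset.sum_comm]
      simp only [mul_assoc]
    · have h0 : ∀ s t, toMatrix T ⟨i, s⟩ ⟨j, t⟩ = 0 := fun s t => toMatrix_mem T _ _ hj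
      have : IsEmpty (j ⟶ i) := not_nonempty_iff.mp hj
      simp [h0]
  rw [_root_.sum_apply, WithLp.ofLp_sum, Finset.sum_apply]
  simp only [h, mul_apply, conjTranspose_apply, Fintype.sum_sigma, Finset.sum_mul]
  rw [Finset.sum_comm]

theorem outgoing_apply (hV : HasNoMultipleArrows V) (T : HilbertRep V δ) (j : V)
    (x : EuclideanSpace ℂ (Fin (δ j))) (s : Fin (δ j)) :
    (∑ i, ∑ a : (j ⟶ i), ContinuousLinearMap.adjoint (T j i a) ∘L (T j i a)) x s =
      ∑ s', ((toMatrix T)ᴴ * toMatrix T) ⟨j, s⟩ ⟨j, s'⟩ * x s' := by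
  have h : ∀ i, ((∑ a : (j ⟶ i), ContinuousLinearMap.adjoint (T j i a) ∘L (T j i a)) x) s =
      ∑ s', (∑ t, star (toMatrix T ⟨i, t⟩ ⟨j, s⟩) * toMatrix T ⟨i, t⟩ ⟨j, s'⟩) * x s' := fun i => by
    by_cases hi : HasArrow V j i
    · obtain ⟨a⟩ := hi
      have h1 : ∑ b : (j ⟶ i), ContinuousLinearMap.adjoint (T j i b) ∘L (T j i b) =
          ContinuousLinearMap.adjoint (T j i a) ∘L (T j i a) :=
        Fintype.sum_eq_single a fun b hb => absurd (hV _ _ b a) hb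
      rw [h1, ContinuousLinearMap.comp_apply, adjoint_apply_eq_sum hV]
      simp only [apply_eq_sum hV, Finset.mul_sum, Finset.sum_mul]
      rw [Finset.sum_comm]
      simp only [mul_assoc]
    · have h0 : ∀ s t, toMatrix T ⟨i, s⟩ ⟨j, t⟩ = 0 := fun s t => toMatrix_mem T _ _ hi
      have : IsEmpty (j ⟶ i) := not_nonempty_iff.mp hi
      simp [h0]
  rw [_root_.sum_apply, WithLp.ofLp_sum, Finset.sum_apply]
  simp only [h, mul_apply, conjTranspose_apply, Fintype.sum_sigma, Finset.sum_mul]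
  rw [Finset.sum_comm]

theorem eq_smul_id_iff {n : ℕ} {L : EuclideanSpace ℂ (Fin n) →L[ℂ] EuclideanSpace ℂ (Fin n)}
    {b : Fin n → Fin n → ℂ} (hb : ∀ x s, L x s = ∑ s', b s s' * x s') (z : ℂ) :
    L = z • ContinuousLinearMap.id ℂ (EuclideanSpace ℂ (Fin n)) ↔
      ∀ s s', b s s' = if s = s' then z else 0 := by
  constructor
  · intro h s s'
    have h1 := hb (EuclideanSpace.single s' 1) s
    rw [h] at h1
    simpa [Pi.single_apply, eq_comm] using h1.symm
  · intro h
    ext x s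
    rw [hb]
    simp [h]

theorem moment_odd {even : Set V} (hsep : IsSeparatedBy V even) (T : HilbertRep V δ) {i : V}
    (hi : i ∉ even) (s s' : Fin (δ i)) :
    ((toMatrix T)ᴴ * toMatrix T) ⟨i, s⟩ ⟨i, s'⟩ = 0 := by
  rw [mul_apply]
  refine Finset.sum_eq_zero fun x _ => ?_
  rw [toMatrix_mem T x ⟨i, s'⟩ fun ⟨a⟩ => hi (hsep _ _ a).1, mul_zero]

theorem moment_even {even : Set V} (hsep : IsSeparatedBy V even) (T : HilbertRep V δ) {i : V}
    (hi : i ∈ even) (s s' : Fin (δ i)) :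
    (toMatrix T * (toMatrix T)ᴴ) ⟨i, s⟩ ⟨i, s'⟩ = 0 := by
  rw [mul_apply]
  refine Finset.sum_eq_zero fun x _ => ?_
  rw [toMatrix_mem T ⟨i, s⟩ x fun ⟨a⟩ => (hsep _ _ a).2 hi, zero_mul]

/-- Odd vertices emit no arrows and even ones receive none, so a diagonal block of `M * Mᴴ - Mᴴ * M`
is either the incoming sum or minus the outgoing sum. -/
theorem isOrthoscalar_iff (hV : HasNoMultipleArrows V) {even : Set V}
    (hsep : IsSeparatedBy V even) (T : HilbertRep V δ) :
    T.IsOrthoscalar even ↔ IsBalanced Sigma.fst (toMatrix T) := by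
  classical
  have hin := fun i z => eq_smul_id_iff (incoming_apply hV T i) z
  have hout := fun i z => eq_smul_id_iff (outgoing_apply hV T i) z
  constructor
  · rintro ⟨χ, -, hodd, heven⟩
    refine ⟨fun v => if v ∈ even then -χ v else χ v, ?_⟩
    ext ⟨v, s⟩ ⟨w, t⟩
    rw [diagPart_apply]
    by_cases hvw : v = w
    · subst hvw
      rw [if_pos rfl, Matrix.sub_apply, diagonal_apply]
      simp only [Sigma.mk.injEq, heq_eq_eq, true_and]
      by_cases hv : v ∈ even
      · rw [moment_even hsep T hv, (hout v _).mp (heven v hv) s t, if_pos hv]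
        split_ifs <;> simp
      · rw [moment_odd hsep T hv, (hin v _).mp (hodd v hv) s t, if_neg hv]
        split_ifs <;> simp
    · rw [if_neg hvw, diagonal_apply_ne _ fun h => hvw (congrArg Sigma.fst h)]
  · rintro ⟨c, hc⟩
    have hent : ∀ v s t, (toMatrix T * (toMatrix T)ᴴ) ⟨v, s⟩ ⟨v, t⟩ -
        ((toMatrix T)ᴴ * toMatrix T) ⟨v, s⟩ ⟨v, t⟩ = if s = t then (c v : ℂ) else 0 := fun v s t => by
      have := congrFun (congrFun hc ⟨v, s⟩) ⟨v, t⟩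
      rw [diagPart_apply, if_pos rfl, Matrix.sub_apply, diagonal_apply] at this
      simpa only [Sigma.mk.injEq, heq_eq_eq, true_and] using this
    -- On a nonzero space the sign of `c v` is fixed by the parity of `v`. On a zero space `c v` is
    -- arbitrary, and the absolute value still gives an admissible number.
    refine ⟨fun v => |c v|, fun v => abs_nonneg _, fun v hv => (hin v _).mpr fun s t => ?_,
      fun v hv => (hout v _).mpr fun s t => ?_⟩
    · have h := fun t => hent v s t
      simp only [moment_odd hsep T hv, sub_zero] at h
      have h1 := h s
      rw [if_pos rfl, mul_apply] at h1
      have h2 : c v = ∑ x, ‖toMatrix T ⟨v, s⟩ x‖ ^ 2 := by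
        have := congrArg Complex.re h1.symm
        rw [Complex.ofReal_re, Complex.re_sum] at this
        rw [this]
        refine Finset.sum_congr rfl fun x _ => ?_
        rw [conjTranspose_apply, Complex.star_def, Complex.mul_conj, Complex.ofReal_re,
          Complex.normSq_eq_norm_sq]
      beta_reduce
      rw [h t, abs_of_nonneg (h2 ▸ Finset.sum_nonneg fun _ _ => sq_nonneg _)]
    · have h := fun t => hent v s t
      simp only [moment_even hsep T hv, zero_sub] at h
      have h1 := h s
      rw [if_pos rfl, mul_apply] at h1
      have h2 : -c v = ∑ x, ‖toMatrix T x ⟨v, s⟩‖ ^ 2 := by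
        have := congrArg Complex.re h1.symm
        rw [Complex.ofReal_re, Complex.neg_re, Complex.re_sum] at this
        rw [this, neg_neg]
        refine Finset.sum_congr rfl fun x _ => ?_
        rw [conjTranspose_apply, Complex.star_def, mul_comm, Complex.mul_conj, Complex.ofReal_re,
          Complex.normSq_eq_norm_sq]
      beta_reduce
      rw [abs_of_nonpos (neg_nonneg.mp (h2 ▸ Finset.sum_nonneg fun _ _ => sq_nonneg _)),
        neg_eq_iff_eq_neg.mp (h t)]
      split_ifs <;> simp

end Translation

end HilbertRep

/-! ### Unitary equivalence, indecomposability and the Tits form in matrix terms -/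

namespace HilbertRep

open Matrix Module BlockMatrix
open scoped InnerProductSpace

set_option linter.unusedSectionVars false

section Equivalence

variable {V : Type u} [Quiver.{v} V] [Fintype V] [DecidableEq V] [∀ i j : V, Fintype (i ⟶ j)]
  {δ : V → ℕ}

theorem single_eq_sum_apply {n m : ℕ} (L : EuclideanSpace ℂ (Fin n) →ₗ[ℂ] EuclideanSpace ℂ (Fin m))
    (x : EuclideanSpace ℂ (Fin n)) (s : Fin m) :
    L x s = ∑ t, L (EuclideanSpace.single t 1) s * x t := by
  have hx : x = ∑ t, x t • EuclideanSpace.single t (1 : ℂ) := by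
    ext t
    simp [Finset.sum_apply, Pi.single_apply]
  conv_lhs => rw [hx]
  simp [mul_comm]

/-- The block diagonal matrix of a family of linear operators. -/
noncomputable def blockMatrixOf
    (L : ∀ v : V, EuclideanSpace ℂ (Fin (δ v)) →ₗ[ℂ] EuclideanSpace ℂ (Fin (δ v))) :
    Matrix (Σ v : V, Fin (δ v)) (Σ v : V, Fin (δ v)) ℂ :=
  blockDiagonal' fun v => Matrix.of fun s t => L v (EuclideanSpace.single t 1) s

theorem blockMatrixOf_apply
    (L : ∀ v : V, EuclideanSpace ℂ (Fin (δ v)) →ₗ[ℂ] EuclideanSpace ℂ (Fin (δ v))) (v : V)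
    (s t : Fin (δ v)) :
    blockMatrixOf L ⟨v, s⟩ ⟨v, t⟩ = L v (EuclideanSpace.single t 1) s := by
  rw [blockMatrixOf, blockDiagonal'_apply_eq]; rfl

theorem blockMatrixOf_mem
    (L : ∀ v : V, EuclideanSpace ℂ (Fin (δ v)) →ₗ[ℂ] EuclideanSpace ℂ (Fin (δ v))) :
    blockMatrixOf L ∈ BlockMatrix.blockDiag Sigma.fst := fun _ _ h =>
  blockDiagonal'_apply_ne _ _ _ h

theorem blockMatrixOf_mul_toMatrix (hV : HasNoMultipleArrows V) {S T : HilbertRep V δ}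
    {L : ∀ v : V, EuclideanSpace ℂ (Fin (δ v)) →ₗ[ℂ] EuclideanSpace ℂ (Fin (δ v))}
    (h : ∀ (i j : V) (a : i ⟶ j) (x : EuclideanSpace ℂ (Fin (δ i))),
      L j (S i j a x) = T i j a (L i x)) :
    blockMatrixOf L * toMatrix S = toMatrix T * blockMatrixOf L := by
  ext ⟨j, s⟩ ⟨i, t⟩
  rw [blockDiag_mul_apply (blockMatrixOf_mem L), mul_blockDiag_apply (blockMatrixOf_mem L)]
  simp only [blockMatrixOf_apply]
  by_cases hij : HasArrow V i j
  · obtain ⟨a⟩ := hij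
    rw [← apply_eq_sum hV, ← h]
    simp only [toMatrix_arrow hV S a]
    rw [← single_eq_sum_apply]
  · rw [Finset.sum_eq_zero, Finset.sum_eq_zero]
    · intro t' _
      rw [toMatrix_mem T _ _ hij, zero_mul]
    · intro s' _
      rw [toMatrix_mem S _ _ hij, mul_zero]

theorem exists_unitaryBlocks_of_equivalent (hV : HasNoMultipleArrows V) {S T : HilbertRep V δ}
    (h : UnitarilyEquivalent S T) :
    ∃ k ∈ unitaryBlocks Sigma.fst, toMatrix T = k * toMatrix S * kᴴ := by
  obtain ⟨U, hU⟩ := h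
  let L : ∀ v : V, EuclideanSpace ℂ (Fin (δ v)) →ₗ[ℂ] EuclideanSpace ℂ (Fin (δ v)) :=
    fun v => (U v).toLinearEquiv.toLinearMap
  have hmem : blockMatrixOf L ∈ unitaryBlocks Sigma.fst := by
    refine ⟨mem_unitaryGroup_iff'.mpr ?_, blockMatrixOf_mem L⟩
    ext ⟨v, s⟩ ⟨w, t⟩
    rw [star_eq_conjTranspose, mul_blockDiag_apply (blockMatrixOf_mem L)]
    by_cases hvw : v = w
    · subst hvw
      have h1 : ∀ t', (blockMatrixOf L)ᴴ ⟨v, s⟩ ⟨v, t'⟩ * blockMatrixOf L ⟨v, t'⟩ ⟨v, t⟩ =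
          inner ℂ ((U v (EuclideanSpace.single s 1)) t') ((U v (EuclideanSpace.single t 1)) t') :=
        fun t' => by
          rw [conjTranspose_apply, blockMatrixOf_apply, blockMatrixOf_apply, RCLike.inner_apply,
            mul_comm]
          rfl
      simp only [h1]
      rw [← PiLp.inner_apply, LinearIsometryEquiv.inner_map_map, EuclideanSpace.inner_single_left]
      simp [one_apply]
    · rw [one_apply_ne fun h => hvw (congrArg Sigma.fst h)]
      refine Finset.sum_eq_zero fun t' _ => ?_
      rw [conjTranspose_apply, blockMatrixOf_mem L ⟨w, t'⟩ ⟨v, s⟩ (Ne.symm hvw), star_zero,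
        zero_mul]
  refine ⟨blockMatrixOf L, hmem, ?_⟩
  rw [blockMatrixOf_mul_toMatrix hV (L := L) hU, mul_assoc, mul_conjTranspose_self' hmem, mul_one]

theorem equivalent_of_unitaryBlocks (hV : HasNoMultipleArrows V) {S T : HilbertRep V δ}
    {k : Matrix (Σ v : V, Fin (δ v)) (Σ v : V, Fin (δ v)) ℂ} (hk : k ∈ unitaryBlocks Sigma.fst)
    (h : toMatrix T = k * toMatrix S * kᴴ) : UnitarilyEquivalent S T := by
  have hkS : k * toMatrix S = toMatrix T * k := by
    rw [h, mul_assoc _ kᴴ, conjTranspose_mul_self hk, mul_one]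
  let u : ∀ v : V, Matrix (Fin (δ v)) (Fin (δ v)) ℂ := fun v => Matrix.of fun s t => k ⟨v, s⟩ ⟨v, t⟩
  have hu : ∀ v, u v ∈ unitaryGroup (Fin (δ v)) ℂ := fun v => by
    refine mem_unitaryGroup_iff'.mpr ?_
    ext s t
    have h1 := congrFun (congrFun (conjTranspose_mul_self hk) ⟨v, s⟩) ⟨v, t⟩
    rw [mul_blockDiag_apply hk.2] at h1
    rw [mul_apply]
    simpa [u, star_apply, one_apply] using h1
  refine ⟨fun v => Unitary.linearIsometryEquiv ⟨toEuclideanCLM (n := Fin (δ v)) (𝕜 := ℂ) (u v),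
    Unitary.map_mem _ (hu v)⟩, fun i j a x => ?_⟩
  change toEuclideanCLM (n := Fin (δ j)) (𝕜 := ℂ) (u j) (S i j a x) =
    T i j a (toEuclideanCLM (n := Fin (δ i)) (𝕜 := ℂ) (u i) x)
  have hap : ∀ v (y : EuclideanSpace ℂ (Fin (δ v))) s,
      toEuclideanCLM (n := Fin (δ v)) (𝕜 := ℂ) (u v) y s = ∑ t, k ⟨v, s⟩ ⟨v, t⟩ * y t :=
    fun v y s => by
      rw [ofLp_toEuclideanCLM, mulVec, dotProduct]; rfl
  ext s
  rw [hap, apply_eq_sum hV]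
  simp only [hap, apply_eq_sum hV, Finset.mul_sum]
  have h2 : ∀ t, ∑ s', k ⟨j, s⟩ ⟨j, s'⟩ * toMatrix S ⟨j, s'⟩ ⟨i, t⟩ =
      ∑ t', toMatrix T ⟨j, s⟩ ⟨i, t'⟩ * k ⟨i, t'⟩ ⟨i, t⟩ := fun t => by
    rw [← blockDiag_mul_apply hk.2, ← mul_blockDiag_apply hk.2, hkS]
  rw [Finset.sum_comm]
  conv_rhs => rw [Finset.sum_comm]
  refine Finset.sum_congr rfl fun t _ => ?_
  simp only [← mul_assoc, ← Finset.sum_mul]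
  rw [h2]

theorem nonempty_sigma_iff : Nonempty (Σ v : V, Fin (δ v)) ↔ δ ≠ 0 := by
  constructor
  · rintro ⟨v, s⟩ h
    have := s.2
    simp [h] at this
  · intro h
    obtain ⟨v, hv⟩ := Function.ne_iff.mp h
    exact ⟨⟨v, ⟨0, Nat.pos_of_ne_zero hv⟩⟩⟩

/-- Orthogonal decompositions and the commutant of `M` and `Mᴴ` determine each other: an eigenspace
of a commuting matrix splits the representation, and the projections of a splitting commute. -/
theorem isIndecomposable_iff (hV : HasNoMultipleArrows V) (T : HilbertRep V δ) :
    T.IsIndecomposable ↔ δ ≠ 0 ∧ IsIrreducible Sigma.fst (toMatrix T) := by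
  refine and_congr_right fun hδ => ?_
  obtain ⟨o⟩ := nonempty_sigma_iff.mpr hδ
  constructor
  · intro hT g hg h1 h2
    have : Nontrivial ((Σ v : V, Fin (δ v)) → ℂ) := ⟨⟨0, 1, fun h => zero_ne_one (congrFun h o)⟩⟩
    -- The eigenspace of `g` for `z` is invariant under `M` and `Mᴴ`, so its blocks form a summand.
    -- It contains an eigenvector, hence is everything, and `g` is the scalar `z`.
    obtain ⟨z, hz⟩ := Module.End.exists_eigenvalue (toLin' g)
    obtain ⟨x, hx, hx0⟩ := hz.exists_hasEigenvector
    rw [Module.End.mem_eigenspace_iff, toLin'_apply] at hx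
    let M : ∀ v : V, Submodule ℂ (EuclideanSpace ℂ (Fin (δ v))) := fun v =>
      { carrier := {y | ∀ s, ∑ t, g ⟨v, s⟩ ⟨v, t⟩ * y t = z * y s}
        add_mem' := fun {a b} ha hb s => by
          simp only [PiLp.add_apply, mul_add, Finset.sum_add_distrib, ha s, hb s]
        zero_mem' := fun s => by simp
        smul_mem' := fun c a ha s => by
          have := congrArg (c * ·) (ha s)
          simp only [Finset.mul_sum] at this
          simp only [PiLp.smul_apply, smul_eq_mul, mul_left_comm _ c, this] }
    have hM : ∀ v y, y ∈ M v ↔ ∀ s, ∑ t, g ⟨v, s⟩ ⟨v, t⟩ * y t = z * y s := fun _ _ => Iff.rfl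
    have hmaps : ∀ (i j : V) (N : Matrix (Σ v : V, Fin (δ v)) (Σ v : V, Fin (δ v)) ℂ),
        g * N = N * g → ∀ y ∈ M i, ∀ y' : EuclideanSpace ℂ (Fin (δ j)),
        (∀ s, y' s = ∑ t, N ⟨j, s⟩ ⟨i, t⟩ * y t) → y' ∈ M j := by
      intro i j N hN y hy y' hy' s
      simp only [hy', Finset.mul_sum]
      rw [Finset.sum_comm]
      simp only [← mul_assoc, ← Finset.sum_mul]
      have h3 : ∀ t, ∑ s', g ⟨j, s⟩ ⟨j, s'⟩ * N ⟨j, s'⟩ ⟨i, t⟩ =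
          ∑ t', N ⟨j, s⟩ ⟨i, t'⟩ * g ⟨i, t'⟩ ⟨i, t⟩ := fun t => by
        rw [← blockDiag_mul_apply hg, ← mul_blockDiag_apply hg, hN]
      simp only [h3, Finset.sum_mul]
      rw [Finset.sum_comm]
      refine Finset.sum_congr rfl fun t _ => ?_
      simp only [mul_assoc, ← Finset.mul_sum]
      rw [hy t]
      ring
    rcases hT M (fun i j a y hy => hmaps i j _ h1 y hy _ fun s => apply_eq_sum hV T a y s)
      (fun i j a y hy => by
        rw [Submodule.mem_orthogonal] at hy ⊢
        intro w hw
        rw [← ContinuousLinearMap.adjoint_inner_left]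
        exact hy _ (hmaps j i _ h2 w hw _ fun s => adjoint_apply_eq_sum hV T a w s)) with h | h
    · exfalso
      apply hx0
      funext ⟨v, s⟩
      have hv : (WithLp.toLp 2 fun t => x ⟨v, t⟩ : EuclideanSpace ℂ (Fin (δ v))) ∈ M v := by
        intro s
        have h3 := congrFun hx ⟨v, s⟩
        rw [mulVec, dotProduct, Fintype.sum_sigma,
          Fintype.sum_eq_single v fun w hw => Finset.sum_eq_zero fun t _ => by
            rw [hg ⟨v, s⟩ ⟨w, t⟩ hw.symm, zero_mul]] at h3
        exact h3
      rw [h v, Submodule.mem_bot] at hv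
      exact congrArg (fun y : EuclideanSpace ℂ (Fin (δ v)) => y s) hv
    · refine ⟨z, ?_⟩
      ext ⟨v, s⟩ ⟨w, t⟩
      by_cases hvw : v = w
      · subst hvw
        have h3 : EuclideanSpace.single t (1 : ℂ) ∈ M v := h v ▸ Submodule.mem_top
        have h4 := h3 s
        simpa [Pi.single_apply, one_apply] using h4
      · rw [hg _ _ hvw, Matrix.smul_apply, one_apply_ne fun h => hvw (congrArg Sigma.fst h), smul_zero]
  · intro hirr M h1 h2
    let L : ∀ v : V, EuclideanSpace ℂ (Fin (δ v)) →ₗ[ℂ] EuclideanSpace ℂ (Fin (δ v)) :=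
      fun v => ((M v).starProjection : _ →ₗ[ℂ] _)
    have hL : ∀ v y, L v y = (M v).starProjection y := fun _ _ => rfl
    have hc1 : blockMatrixOf L * toMatrix T = toMatrix T * blockMatrixOf L := by
      refine blockMatrixOf_mul_toMatrix hV fun i j a x => ?_
      obtain ⟨y, hy, w, hw, rfl⟩ := (M i).exists_add_mem_mem_orthogonal x
      simp only [hL, map_add]
      rw [Submodule.starProjection_eq_self_iff.mpr (h1 i j a y hy),
        (Submodule.starProjection_apply_eq_zero_iff _).mpr (h2 i j a w hw),
        Submodule.starProjection_eq_self_iff.mpr hy,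
        (Submodule.starProjection_apply_eq_zero_iff _).mpr hw, map_zero]
    have hherm : (blockMatrixOf L)ᴴ = blockMatrixOf L := by
      ext ⟨v, s⟩ ⟨w, t⟩
      by_cases hvw : v = w
      · subst hvw
        rw [conjTranspose_apply, blockMatrixOf_apply, blockMatrixOf_apply, hL, hL]
        have h3 : ∀ a b : Fin (δ v), (M v).starProjection (EuclideanSpace.single b 1) a =
            ⟪EuclideanSpace.single a (1 : ℂ), (M v).starProjection (EuclideanSpace.single b 1)⟫_ℂ :=
          fun a b => by simp [EuclideanSpace.inner_single_left]
        rw [h3, h3, Complex.star_def, inner_conj_symm, Submodule.inner_starProjection_left_eq_right]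
      · rw [blockMatrixOf_mem L ⟨v, s⟩ ⟨w, t⟩ hvw, conjTranspose_apply,
          blockMatrixOf_mem L ⟨w, t⟩ ⟨v, s⟩ (Ne.symm hvw), star_zero]
    have hc2 : blockMatrixOf L * (toMatrix T)ᴴ = (toMatrix T)ᴴ * blockMatrixOf L := by
      have := congrArg conjTranspose hc1
      rw [conjTranspose_mul, conjTranspose_mul, hherm] at this
      exact this.symm
    obtain ⟨z, hz⟩ := hirr _ (blockMatrixOf_mem L) hc1 hc2
    have hp : ∀ v y, (M v).starProjection y = z • y := fun v y => by
      ext s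
      rw [← hL, single_eq_sum_apply]
      simp only [← blockMatrixOf_apply, hz]
      simp [one_apply]
    by_cases hz0 : z = 0
    · left
      intro v
      rw [eq_bot_iff]
      intro y hy
      have := hp v y
      rw [Submodule.starProjection_eq_self_iff.mpr hy, hz0, zero_smul] at this
      rw [this]
      exact Submodule.zero_mem _
    · right
      intro v
      rw [eq_top_iff]
      intro y _
      have h3 := Submodule.starProjection_apply_mem (M v) y
      rw [hp] at h3
      exact ((M v).smul_mem_iff hz0).mp h3

/-- The Tits form at `δ` is the dimension of the block diagonal matrices minus that of the space of
representations. -/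
theorem finrank_arrowMatrices_eq (hV : HasNoMultipleArrows V)
    (hδ : titsForm (fun i => (δ i : ℤ)) = 0) :
    finrank ℂ (arrowMatrices (Sigma.fst : (Σ v : V, Fin (δ v)) → V) (HasArrow V)) =
      finrank ℂ (BlockMatrix.blockDiag (Sigma.fst : (Σ v : V, Fin (δ v)) → V)) := by
  classical
  have hsup : Subalgebra.toSubmodule (BlockMatrix.blockDiag (Sigma.fst : (Σ v : V, Fin (δ v)) → V)) =
      supportedOn fun x y => x.1 = y.1 := rfl
  have hcount : ∀ (p : V → V → Prop) [DecidableRel p],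
      Nat.card {xy : (Σ v : V, Fin (δ v)) × (Σ v : V, Fin (δ v)) // p xy.1.1 xy.2.1} =
      ∑ i, ∑ j, if p i j then δ i * δ j else 0 := fun p _ => by
    rw [Nat.card_eq_fintype_card, Fintype.card_subtype, Finset.card_filter, Fintype.sum_prod_type,
      Fintype.sum_sigma]
    simp only [Fintype.sum_sigma]
    refine Finset.sum_congr rfl fun i _ => ?_
    rw [Finset.sum_comm]
    refine Finset.sum_congr rfl fun j _ => ?_
    split_ifs <;> simp
  have h1 : finrank ℂ (BlockMatrix.blockDiag (Sigma.fst : (Σ v : V, Fin (δ v)) → V)) =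
      ∑ i, ∑ j, if i = j then δ i * δ j else 0 :=
    (finrank_supportedOn _).trans (hcount fun i j => i = j)
  rw [h1, arrowMatrices, finrank_supportedOn, hcount fun i j => HasArrow V j i]
  rw [titsForm, sub_eq_zero] at hδ
  zify
  rw [Finset.sum_comm]
  convert hδ.symm using 4 with i _ j _
  · by_cases h : HasArrow V i j
    · obtain ⟨a⟩ := h
      rw [if_pos ⟨a⟩, Fintype.sum_eq_single a fun b hb => absurd (hV _ _ b a) hb, mul_comm]
    · have : IsEmpty (i ⟶ j) := not_nonempty_iff.mp h
      rw [if_neg h]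
      simp
  · simp [sq]

end Equivalence

/-! ### From block matrices back to representations -/

section Assembly

variable {V : Type u} [Quiver.{v} V] [Fintype V] [∀ i j : V, Fintype (i ⟶ j)] {δ : V → ℕ}

open scoped Matrix.Norms.Frobenius in
set_option synthInstance.maxHeartbeats 200000 in
set_option maxHeartbeats 1000000 in
theorem dependsOnPositiveParameters (hV : HasNoMultipleArrows V) {even : Set V}
    (hsep : IsSeparatedBy V even) (hδ : titsForm (fun i => (δ i : ℤ)) = 0) (hpos : ∀ v, 0 < δ v)
    (hex : ∃ T : HilbertRep V δ, T.IsOrthoscalar even ∧ T.IsIndecomposable) :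
    HilbertRep.DependsOnPositiveParameters
      {T : HilbertRep V δ | T.IsOrthoscalar even ∧ T.IsIndecomposable} (Fintype.card V + 1) := by
  classical
  refine ⟨hex, fun T hT => ?_⟩
  have hδ0 : δ ≠ 0 := hT.2.1
  have hne : Nonempty (Σ v : V, Fin (δ v)) := nonempty_sigma_iff.mpr hδ0
  have hfin : FiniteDimensional ℝ (HilbertRep V δ) :=
    FiniteDimensional.of_injective toMatrix (toMatrix_injective hV)
  let ι : HilbertRep V δ →L[ℝ] Matrix (Σ v : V, Fin (δ v)) (Σ v : V, Fin (δ v)) ℂ :=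
    LinearMap.toContinuousLinearMap toMatrix
  obtain ⟨O, W, P, F, hO, hTO, hW, hWpos, hP, hF, h1, h2, h3⟩ := exists_local_parameters (ι := ι)
    (A := HasArrow V) (fun v => ⟨⟨v, ⟨0, hpos v⟩⟩, rfl⟩) (finrank_arrowMatrices_eq hV hδ)
    (toMatrix_injective hV) (range_toMatrix hV)
    ((isOrthoscalar_iff hV hsep T).mp hT.1) ((isIndecomposable_iff hV T).mp hT.2).2
  refine ⟨O, W, P, F, hO, hTO, hW, hWpos, hP.contDiffOn, hF,
    fun R hR R' _ hRR' => h1 R hR.1 R' (exists_unitaryBlocks_of_equivalent hV hRR'), fun w hw => ?_,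
    fun R hR => ?_⟩
  · obtain ⟨ha, hb, hc, hd⟩ := h2 w hw
    exact ⟨⟨ha, (isOrthoscalar_iff hV hsep _).mpr hb, (isIndecomposable_iff hV _).mpr ⟨hδ0, hc⟩⟩, hd⟩
  · obtain ⟨ha, k, hk, hb⟩ := h3 R hR.1 ((isOrthoscalar_iff hV hsep _).mp hR.2.1)
    exact ⟨ha, equivalent_of_unitaryBlocks hV hk hb⟩

end Assembly

end HilbertRep

/-! ### Existence: minimal imaginary roots and explicit models on the graphs -/

section ExtendedDynkin

open Matrix Module BlockMatrix

set_option linter.unusedSectionVars false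
set_option linter.unusedSimpArgs false

section Model

/-- A family of real matrices on the edges of a graph, symmetric, "orthoscalar" at every vertex
and with trivial commutant. -/
def HasOrthoscalarModel {W : Type*} [Fintype W] (H : SimpleGraph W) (d : W → ℕ) : Prop :=
  ∃ N : ∀ v w : W, Matrix (Fin (d v)) (Fin (d w)) ℝ,
    (∀ v w, N w v = (N v w)ᵀ) ∧ (∀ v w, ¬ H.Adj v w → N v w = 0) ∧
    (∃ c : W → ℝ, ∀ v, ∑ w, N v w * N w v = c v • (1 : Matrix (Fin (d v)) (Fin (d v)) ℝ)) ∧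
    ∀ p : ∀ v, Matrix (Fin (d v)) (Fin (d v)) ℝ, (∀ v w, p v * N v w = N v w * p w) →
      ∃ z : ℝ, ∀ v, p v = z • (1 : Matrix (Fin (d v)) (Fin (d v)) ℝ)

theorem HasOrthoscalarModel.of_iso {V W : Type*} [Fintype V] [Fintype W] {G : SimpleGraph V}
    {H : SimpleGraph W} {d : W → ℕ} (h : HasOrthoscalarModel H d) (e : G ≃g H) :
    HasOrthoscalarModel G fun v => d (e v) := by
  obtain ⟨N, hsym, hN, ⟨c, hc⟩, hirr⟩ := h
  refine ⟨fun v w => N (e v) (e w), fun v w => hsym _ _,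
    fun v w hvw => hN _ _ fun h => hvw (e.map_adj_iff.mp h), ⟨fun v => c (e v), fun v => ?_⟩,
    fun p hp => ?_⟩
  · rw [← hc (e v)]
    exact e.toEquiv.sum_comp fun w => N (e v) w * N w (e v)
  · let p' := Equiv.piCongrLeft (fun w => Matrix (Fin (d w)) (Fin (d w)) ℝ) e.toEquiv p
    have hp' : ∀ v, p' (e v) = p v := fun v =>
      Equiv.piCongrLeft_apply_apply (fun w => Matrix (Fin (d w)) (Fin (d w)) ℝ) e.toEquiv p v
    obtain ⟨z, hz⟩ := hirr p' fun v w => by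
      obtain ⟨v, rfl⟩ := e.surjective v
      obtain ⟨w, rfl⟩ := e.surjective w
      rw [hp', hp', hp]
    exact ⟨z, fun v => (hp' v).symm.trans (hz (e v))⟩

/-- A labelling of a connected graph by positive integers, one of them `1`, such that twice each
label is the sum of the labels of the neighbours. -/
def IsNullRoot {W : Type*} [Fintype W] (H : SimpleGraph W) (d : W → ℕ) : Prop :=
  H.Preconnected ∧ (∀ v, 0 < d v) ∧ (∃ v, d v = 1) ∧
    ∀ v, ∀ _inst : DecidableRel H.Adj, ∑ w, (if H.Adj v w then d w else 0) = 2 * d v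

theorem IsNullRoot.of_iso {V W : Type*} [Fintype V] [Fintype W] {G : SimpleGraph V}
    {H : SimpleGraph W} {d : W → ℕ} (h : IsNullRoot H d) (e : G ≃g H) :
    IsNullRoot G fun v => d (e v) := by
  classical
  obtain ⟨h1, h2, ⟨w, hw⟩, h4⟩ := h
  refine ⟨e.preconnected_iff.mpr h1, fun v => h2 _, ⟨e.symm w, by simpa using hw⟩, fun v _ => ?_⟩
  rw [← h4 (e v) (Classical.decRel _), ← e.toEquiv.sum_comp]
  refine Finset.sum_congr rfl fun w _ => ?_
  have : H.Adj (e v) (e.toEquiv w) ↔ G.Adj v w := e.map_adj_iff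
  simp only [this]
  rfl

variable {V : Type u} [Quiver.{v} V] [Fintype V] [∀ i j : V, Fintype (i ⟶ j)]

/-- Separatedness excludes opposite arrows, so each edge carries one arrow and is counted once in
each direction on the right; hence the factor 2. -/
theorem two_mul_titsForm {even : Set V} (hsep : IsSeparatedBy V even) (hV : HasNoMultipleArrows V)
    [DecidableRel (quiverGraph V).Adj] (x : V → ℤ) :
    2 * titsForm x = 2 * ∑ i, x i ^ 2 -
      ∑ i, ∑ j, if (quiverGraph V).Adj i j then x i * x j else 0 := by
  classical
  have hadj : ∀ i j, (if (quiverGraph V).Adj i j then x i * x j else 0) =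
      (∑ _a : (i ⟶ j), x i * x j) + ∑ _a : (j ⟶ i), x j * x i := fun i j => by
    have hcard : ∀ i j : V, (∑ _a : (i ⟶ j), x i * x j) =
        if Nonempty (i ⟶ j) then x i * x j else 0 := fun i j => by
      split_ifs with h
      · obtain ⟨a⟩ := h
        exact Fintype.sum_eq_single a fun b hb => absurd (hV _ _ b a) hb
      · have := not_nonempty_iff.mp h
        simp
    rw [hcard, hcard]
    by_cases h1 : Nonempty (i ⟶ j)
    · obtain ⟨a⟩ := h1
      have h2 : ¬ Nonempty (j ⟶ i) := fun ⟨b⟩ => (hsep _ _ a).2 (hsep _ _ b).1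
      have h3 : (quiverGraph V).Adj i j :=
        ⟨fun h => (hsep _ _ a).2 (h ▸ (hsep _ _ a).1), Or.inl ⟨a⟩⟩
      rw [if_pos h3, if_pos ⟨a⟩, if_neg h2, add_zero]
    · by_cases h2 : Nonempty (j ⟶ i)
      · obtain ⟨a⟩ := h2
        have h3 : (quiverGraph V).Adj i j :=
          ⟨fun h => (hsep _ _ a).2 (h ▸ (hsep _ _ a).1), Or.inr ⟨a⟩⟩
        rw [if_pos h3, if_neg h1, if_pos ⟨a⟩, zero_add, mul_comm]
      · have h3 : ¬ (quiverGraph V).Adj i j := fun h => h.2.elim h1 h2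
        rw [if_neg h3, if_neg h1, if_neg h2, add_zero]
  simp only [hadj, Finset.sum_add_distrib]
  rw [titsForm, Finset.sum_comm (f := fun i j => ∑ _a : (j ⟶ i), x j * x i)]
  ring

/-- On vectors, the Tits form is a sum of squares over the edges that vanishes only on multiples of
`d`. As `d` takes the value 1, every integral zero is an integral multiple of `d`, and minimality
leaves `d` itself. -/
theorem eq_of_isMinimalImaginaryRoot {even : Set V} (hsep : IsSeparatedBy V even)
    (hV : HasNoMultipleArrows V) {d δ : V → ℕ} (hd : IsNullRoot (quiverGraph V) d)
    (hδ : IsMinimalImaginaryRoot δ) : δ = d := by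
  classical
  obtain ⟨hconn, hpos, ⟨o, ho⟩, hsum⟩ := hd
  have hsum' : ∀ v, ∑ w, (if (quiverGraph V).Adj v w then (d w : ℝ) else 0) = 2 * d v := fun v => by
    exact_mod_cast hsum v (Classical.decRel _)
  have htits := fun x : V → ℕ => two_mul_titsForm hsep hV fun i => (x i : ℤ)
  have htits' : ∀ x : V → ℕ, titsForm (fun i => (x i : ℤ)) = 0 ↔
      ∑ i, ∑ j, (if (quiverGraph V).Adj i j then (x i : ℝ) * x j else 0) =
        2 * ∑ i, (x i : ℝ) ^ 2 := fun x => by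
    have h1 : titsForm (fun i => (x i : ℤ)) = 0 ↔ 2 * titsForm (fun i => (x i : ℤ)) = 0 := by
      simp
    rw [h1, htits x, sub_eq_zero, eq_comm]
    constructor
    · intro h; exact_mod_cast h
    · intro h; exact_mod_cast h
  apply le_antisymm
  · refine hδ.2 ⟨fun h => (hpos o).ne' (congrFun h o), ?_⟩
    rw [htits', Finset.mul_sum]
    refine Finset.sum_congr rfl fun i _ => ?_
    have h1 : ∀ j, (if (quiverGraph V).Adj i j then (d i : ℝ) * d j else 0) =
        d i * if (quiverGraph V).Adj i j then (d j : ℝ) else 0 := fun j => by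
      split_ifs <;> simp
    simp only [h1]
    rw [← Finset.mul_sum, hsum' i]
    ring
  · obtain ⟨hne, h0⟩ := hδ.1
    rw [htits'] at h0
    have hposR : ∀ v, (0 : ℝ) < d v := fun v => Nat.cast_pos.mpr (hpos v)
    -- Expanding the squares, the null root equation for `d` turns the pure terms into `4 * ∑ (δ
    -- i)²`, which the mixed terms cancel since the Tits form vanishes at `δ`.
    have hsq : ∑ i, ∑ j, (if (quiverGraph V).Adj i j then
        ((d i : ℝ) * δ j - d j * δ i) ^ 2 / (d i * d j) else 0) = 0 := by
      have h1 : ∀ i j, (if (quiverGraph V).Adj i j then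
          ((d i : ℝ) * δ j - d j * δ i) ^ 2 / (d i * d j) else 0) =
          (δ j : ℝ) ^ 2 / d j * (if (quiverGraph V).Adj j i then (d i : ℝ) else 0) +
          (δ i : ℝ) ^ 2 / d i * (if (quiverGraph V).Adj i j then (d j : ℝ) else 0) -
          2 * (if (quiverGraph V).Adj i j then (δ i : ℝ) * δ j else 0) := fun i j => by
        rw [(quiverGraph V).adj_comm j i]
        have hi := (hposR i).ne'
        have hj := (hposR j).ne'
        split_ifs
        · field_simp
          ring
        · simp
      simp only [h1, Finset.sum_sub_distrib, Finset.sum_add_distrib, ← Finset.mul_sum]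
      rw [Finset.sum_comm, h0]
      simp only [← Finset.mul_sum, hsum']
      have h2 : ∀ i, (δ i : ℝ) ^ 2 / d i * (2 * d i) = 2 * (δ i : ℝ) ^ 2 := fun i => by
        have hi := (hposR i).ne'
        field_simp
      simp only [h2, ← Finset.mul_sum]
      ring
    have hnn : ∀ i j, 0 ≤ (if (quiverGraph V).Adj i j then
        ((d i : ℝ) * δ j - d j * δ i) ^ 2 / (d i * d j) else 0) := fun i j => by
      have hi := hposR i
      have hj := hposR j
      split_ifs
      · positivity
      · exact le_rfl
    have hadj : ∀ i j, (quiverGraph V).Adj i j → d i * δ j = d j * δ i := fun i j hij => by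
      have h1 := (Finset.sum_eq_zero_iff_of_nonneg fun i _ =>
        Finset.sum_nonneg fun j _ => hnn i j).mp hsq i (Finset.mem_univ i)
      have h2 := (Finset.sum_eq_zero_iff_of_nonneg fun j _ => hnn i j).mp h1 j (Finset.mem_univ j)
      rw [if_pos hij, div_eq_zero_iff, or_iff_left (mul_pos (hposR i) (hposR j)).ne',
        sq_eq_zero_iff, sub_eq_zero] at h2
      exact_mod_cast h2
    have hall : ∀ i, δ i = d i * δ o := fun i => by
      obtain ⟨w⟩ := hconn o i
      have : ∀ {a b : V} (w : (quiverGraph V).Walk a b), d a * δ b = d b * δ a := by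
        intro a b w
        induction w with
        | nil => rfl
        | @cons a b c hab _ ih =>
          have h1 := hadj a b hab
          have hb := hpos b
          apply Nat.eq_of_mul_eq_mul_left hb
          calc d b * (d a * δ c) = d a * (d b * δ c) := by ring
            _ = d c * (d a * δ b) := by rw [ih]; ring
            _ = d b * (d c * δ a) := by rw [h1]; ring
      have h1 := this w
      rwa [ho, one_mul] at h1
    have hδo : 0 < δ o := by
      rw [Nat.pos_iff_ne_zero]
      intro h
      apply hne
      funext i
      rw [hall i, h, mul_zero]
      rfl
    intro i
    rw [hall i]
    exact Nat.le_mul_of_pos_right _ hδo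

/-- A model on the graph gives an indecomposable orthoscalar representation of the quiver. -/
theorem exists_rep_of_model {even : Set V} (hsep : IsSeparatedBy V even)
    (hV : HasNoMultipleArrows V) {δ : V → ℕ} (hδ : δ ≠ 0)
    (h : HasOrthoscalarModel (quiverGraph V) δ) :
    ∃ T : HilbertRep V δ, T.IsOrthoscalar even ∧ T.IsIndecomposable := by
  classical
  obtain ⟨N, hsym, hN, ⟨c, hc⟩, hirr⟩ := h
  -- Of the two mutually transposed blocks on an edge, only the one in the direction of the arrow is
  -- kept; the other reappears in `Mᴴ`.
  let M : Matrix (Σ v : V, Fin (δ v)) (Σ v : V, Fin (δ v)) ℂ := Matrix.of fun x y =>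
    if HilbertRep.HasArrow V y.1 x.1 then (N x.1 y.1 x.2 y.2 : ℂ) else 0
  have hMap : ∀ v s w t, M ⟨v, s⟩ ⟨w, t⟩ =
      if HilbertRep.HasArrow V w v then (N v w s t : ℂ) else 0 := fun _ _ _ _ => rfl
  have hM : M ∈ (arrowMatrices Sigma.fst (HilbertRep.HasArrow V)).restrictScalars ℝ :=
    fun x y h => if_neg h
  rw [← HilbertRep.range_toMatrix hV] at hM
  obtain ⟨T, hT⟩ := hM
  have hsymE : ∀ v w s t, N v w s t = N w v t s := fun v w s t => by rw [hsym v w]; rfl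
  have hcE : ∀ v s s', ∑ w, ∑ t, (N v w s t : ℂ) * N v w s' t =
      if s = s' then (c v : ℂ) else 0 := fun v s s' => by
    have h1 := congrFun (congrFun (hc v) s) s'
    rw [Matrix.sum_apply] at h1
    simp only [mul_apply, Matrix.smul_apply, one_apply, hsymE _ v] at h1
    have h2 := congrArg (fun r : ℝ => (r : ℂ)) h1
    simp only [Complex.ofReal_sum, Complex.ofReal_mul] at h2
    rw [h2]
    split_ifs <;> simp
  have hnoarrow : ∀ v w, ¬ HilbertRep.HasArrow V v w → ¬ HilbertRep.HasArrow V w v →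
      N v w = 0 := fun v w h1 h2 => hN v w fun h => h.2.elim h1 h2
  refine ⟨T, (HilbertRep.isOrthoscalar_iff hV hsep T).mpr ?_,
    (HilbertRep.isIndecomposable_iff hV T).mpr ⟨hδ, ?_⟩⟩
  · refine ⟨fun v => if v ∈ even then -c v else c v, ?_⟩
    ext ⟨v, s⟩ ⟨w, t⟩
    rw [diagPart_apply]
    by_cases hvw : v = w
    · subst hvw
      rw [if_pos rfl, Matrix.sub_apply, diagonal_apply]
      simp only [Sigma.mk.injEq, heq_eq_eq, true_and]
      by_cases hv : v ∈ even
      · rw [HilbertRep.moment_even hsep T hv, hT, if_pos hv, zero_sub, mul_apply,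
          Fintype.sum_sigma]
        have h1 : ∀ w t', Mᴴ ⟨v, s⟩ ⟨w, t'⟩ * M ⟨w, t'⟩ ⟨v, t⟩ =
            (N v w s t' : ℂ) * N v w t t' := fun w t' => by
          have h2 : ¬ HilbertRep.HasArrow V w v := fun ⟨a⟩ => (hsep _ _ a).2 hv
          rw [conjTranspose_apply, hMap, hMap]
          by_cases h3 : HilbertRep.HasArrow V v w
          · rw [if_pos h3, if_pos h3, hsymE w v, hsymE w v]; simp
          · rw [hnoarrow v w h3 h2, if_neg h3]; simp
        simp only [h1, hcE]
        split_ifs <;> simp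
      · rw [HilbertRep.moment_odd hsep T hv, hT, if_neg hv, sub_zero, mul_apply,
          Fintype.sum_sigma]
        have h1 : ∀ w t', M ⟨v, s⟩ ⟨w, t'⟩ * Mᴴ ⟨w, t'⟩ ⟨v, t⟩ =
            (N v w s t' : ℂ) * N v w t t' := fun w t' => by
          have h2 : ¬ HilbertRep.HasArrow V v w := fun ⟨a⟩ => hv (hsep _ _ a).1
          rw [conjTranspose_apply, hMap, hMap]
          by_cases h3 : HilbertRep.HasArrow V w v
          · rw [if_pos h3, if_pos h3]; simp
          · rw [hnoarrow v w h2 h3, if_neg h3]; simp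
        simp only [h1, hcE]
    · rw [if_neg hvw, diagonal_apply_ne _ fun h => hvw (congrArg Sigma.fst h)]
  · rw [hT]
    intro g hg h1 h2
    have hcomm : ∀ v w s t, ∑ s', g ⟨v, s⟩ ⟨v, s'⟩ * (N v w s' t : ℂ) =
        ∑ t', (N v w s t' : ℂ) * g ⟨w, t'⟩ ⟨w, t⟩ := fun v w s t => by
      by_cases h3 : HilbertRep.HasArrow V w v
      · have h4 := congrFun (congrFun h1 ⟨v, s⟩) ⟨w, t⟩
        rw [HilbertRep.blockDiag_mul_apply hg, HilbertRep.mul_blockDiag_apply hg] at h4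
        simpa only [hMap, if_pos h3] using h4
      · by_cases h5 : HilbertRep.HasArrow V v w
        · have h4 := congrFun (congrFun h2 ⟨v, s⟩) ⟨w, t⟩
          rw [HilbertRep.blockDiag_mul_apply hg, HilbertRep.mul_blockDiag_apply hg] at h4
          simp only [conjTranspose_apply, hMap, if_pos h5] at h4
          simpa [hsymE w v] using h4
        · simp [hnoarrow v w h5 h3]
    -- The model is real, so real and imaginary parts of a commuting complex matrix commute with it
    -- separately.
    obtain ⟨a, ha⟩ := hirr (fun v => Matrix.of fun s t => (g ⟨v, s⟩ ⟨v, t⟩).re) fun v w => by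
      ext s t
      have := congrArg Complex.re (hcomm v w s t)
      simpa [mul_apply, Complex.re_sum] using this
    obtain ⟨b, hb⟩ := hirr (fun v => Matrix.of fun s t => (g ⟨v, s⟩ ⟨v, t⟩).im) fun v w => by
      ext s t
      have := congrArg Complex.im (hcomm v w s t)
      simpa [mul_apply, Complex.im_sum] using this
    refine ⟨⟨a, b⟩, ?_⟩
    ext ⟨v, s⟩ ⟨w, t⟩
    by_cases hvw : v = w
    · subst hvw
      have ha' := congrFun (congrFun (ha v) s) t
      have hb' := congrFun (congrFun (hb v) s) t
      rw [of_apply, Matrix.smul_apply, one_apply] at ha' hb'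
      rw [Matrix.smul_apply, one_apply]
      apply Complex.ext
      · rw [ha']; simp only [Sigma.mk.injEq, heq_eq_eq, true_and]; split_ifs <;> simp
      · rw [hb']; simp only [Sigma.mk.injEq, heq_eq_eq, true_and]; split_ifs <;> simp
    · rw [hg _ _ hvw, Matrix.smul_apply, one_apply_ne fun h => hvw (congrArg Sigma.fst h),
        smul_zero]

theorem dependsOnPositiveParameters_of_iso {W : Type*} [Fintype W] {H : SimpleGraph W} {d : W → ℕ}
    (hd : IsNullRoot H d) (hmodel : HasOrthoscalarModel H d) (e : quiverGraph V ≃g H)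
    {even : Set V} (hsep : IsSeparatedBy V even) (hV : HasNoMultipleArrows V) {δ : V → ℕ}
    (hδ : IsMinimalImaginaryRoot δ) :
    HilbertRep.DependsOnPositiveParameters
      {T : HilbertRep V δ | T.IsOrthoscalar even ∧ T.IsIndecomposable} (Fintype.card V + 1) := by
  have hd' := hd.of_iso e
  obtain rfl := eq_of_isMinimalImaginaryRoot hsep hV hd' hδ
  exact HilbertRep.dependsOnPositiveParameters hV hsep hδ.1.2 hd'.2.1
    (exists_rep_of_model hsep hV hδ.1.1 (hmodel.of_iso e))

/-- A graph is connected if every vertex but one has a neighbour of smaller height. -/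
theorem preconnected_of_height {W : Type*} {H : SimpleGraph W} (f : W → ℕ) (o : W)
    (h : ∀ v, v ≠ o → ∃ w, f w < f v ∧ H.Adj v w) : H.Preconnected := by
  have key : ∀ n v, f v = n → H.Reachable v o := by
    intro n
    induction n using Nat.strong_induction_on with
    | _ n ih =>
      intro v hv
      by_cases hvo : v = o
      · rw [hvo]
      · obtain ⟨w, hw, hadj⟩ := h v hvo
        exact hadj.reachable.trans (ih (f w) (hv ▸ hw) w rfl)
  exact fun v w => (key _ v rfl).trans (key _ w rfl).symm

end Model

/-! ### Cycles -/

section CycleGraph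

theorem isNullRoot_cycleGraph {n : ℕ} (hn : 3 ≤ n) :
    IsNullRoot (SimpleGraph.cycleGraph n) fun _ => 1 := by
  obtain ⟨k, rfl⟩ : ∃ k, n = k + 3 := ⟨n - 3, by omega⟩
  refine ⟨SimpleGraph.cycleGraph_preconnected, fun _ => Nat.one_pos, ⟨0, rfl⟩, fun v inst => ?_⟩
  have h := SimpleGraph.cycleGraph_degree_three_le (n := k) (v := v)
  rw [← SimpleGraph.card_neighborFinset_eq_degree] at h
  simp only [Finset.sum_boole, Nat.cast_id, mul_one]
  rw [← h]
  congr 1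
  ext w
  simp

/-- All edge maps are the identity of a line. Each vertex has two neighbours, whence the scalar 2,
and a commuting family is constant along edges, hence constant by connectedness. -/
theorem hasOrthoscalarModel_cycleGraph {n : ℕ} (hn : 3 ≤ n) :
    HasOrthoscalarModel (SimpleGraph.cycleGraph n) fun _ => 1 := by
  classical
  have hroot := isNullRoot_cycleGraph hn
  set H := SimpleGraph.cycleGraph n
  refine ⟨fun v w => if H.Adj v w then 1 else 0, fun v w => ?_, fun v w h => if_neg h,
    ⟨fun _ => 2, fun v => ?_⟩, fun p hp => ?_⟩
  · simp only [H.adj_comm v w]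
    split_ifs <;> simp
  · have h := hroot.2.2.2 v (Classical.decRel _)
    have h' : ∀ w, (if H.Adj v w then (1 : Matrix (Fin 1) (Fin 1) ℝ) else 0) *
        (if H.Adj w v then 1 else 0) = (((if H.Adj v w then 1 else 0 : ℕ) : ℝ)) • 1 := by
      intro w
      simp only [H.adj_comm w v]
      split_ifs <;> simp
    simp only [h']
    rw [← Finset.sum_smul, ← Nat.cast_sum]
    congr 1
    have h2 : (2 : ℝ) = ((2 * 1 : ℕ) : ℝ) := by norm_num
    rw [h2]
    exact congrArg Nat.cast (by convert h)
  · have hedge : ∀ v w, H.Adj v w → p v = p w := fun v w h => by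
      have := hp v w
      simpa [if_pos h] using this
    have hall : ∀ v w, p v = p w := fun v w => by
      obtain ⟨q⟩ := hroot.1 v w
      induction q with
      | nil => rfl
      | cons h _ ih => exact (hedge _ _ h).trans ih
    refine ⟨p ⟨0, by omega⟩ 0 0, fun v => ?_⟩
    rw [hall v ⟨0, by omega⟩]
    ext i j
    rw [Subsingleton.elim i 0, Subsingleton.elim j 0]
    simp

end CycleGraph

/-! ### The graphs `D̃ₙ` -/

section DTilde

/-- The isometric embedding of `ℝ^k` in `ℝ²` (`k = 1, 2`) which is the identity for `k = 2` and
is given by the vector `u` for `k = 1`. -/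
def planeFrame (k : ℕ) (u : Fin 2 → ℝ) : Matrix (Fin 2) (Fin k) ℝ :=
  Matrix.of fun i s => if k = 2 then (if i.val = s.val then 1 else 0) else u i

theorem planeFrame_two (u : Fin 2 → ℝ) : planeFrame 2 u = 1 := by
  ext i j
  simp [planeFrame, Matrix.one_apply, Fin.ext_iff]

theorem planeFrame_transpose_mul {k : ℕ} {u : Fin 2 → ℝ} (hk : k = 1 ∨ k = 2)
    (hu : u 0 * u 0 + u 1 * u 1 = 1) : (planeFrame k u)ᵀ * planeFrame k u = 1 := by
  rcases hk with rfl | rfl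
  · ext i j
    rw [Subsingleton.elim i 0, Subsingleton.elim j 0]
    simp [planeFrame, Matrix.mul_apply, hu]
  · simp [planeFrame_two]

theorem planeFrame_one_mul_transpose (u : Fin 2 → ℝ) :
    planeFrame 1 u * (planeFrame 1 u)ᵀ = vecMulVec u u := by
  ext i j
  simp [planeFrame, Matrix.mul_apply, vecMulVec_apply]

variable {m : ℕ}

/-- The minimal imaginary root of `D̃ₙ`. -/
def rootDTilde (m : ℕ) (v : Fin (m + 5)) : ℕ := if v.val ≤ 1 ∨ m + 3 ≤ v.val then 1 else 2

theorem graphDTilde_adj {v w : Fin (m + 5)} : (graphDTilde m).Adj v w ↔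
    ((v.val = 0 ∧ w.val = 2) ∨ (1 ≤ v.val ∧ w.val = v.val + 1 ∧ w.val ≤ m + 3) ∨
      (v.val = m + 2 ∧ w.val = m + 4)) ∨
    ((w.val = 0 ∧ v.val = 2) ∨ (1 ≤ w.val ∧ v.val = w.val + 1 ∧ v.val ≤ m + 3) ∨
      (w.val = m + 2 ∧ v.val = m + 4)) := by
  simp only [graphDTilde, SimpleGraph.fromRel_adj, ne_eq, Fin.ext_iff]
  omega

theorem sum_ite_adj {W M : Type*} [Fintype W] [DecidableEq W] [AddCommMonoid M]
    {H : SimpleGraph W} [DecidableRel H.Adj] {v : W} (S : Finset W) (h : ∀ w, H.Adj v w ↔ w ∈ S)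
    (f : W → M) : ∑ w, (if H.Adj v w then f w else 0) = ∑ w ∈ S, f w := by
  simp only [h]
  rw [← Finset.sum_filter]
  congr 1
  ext w
  simp

/-- Stated for an arbitrary additive monoid so that one case analysis yields both the null root
equation (with `g = 2`) and the sum of the projections at each vertex (with `g = 1`). -/
theorem sum_adj_graphDTilde {M : Type*} [AddCommMonoid M] [DecidableRel (graphDTilde m).Adj]
    (f : Fin (m + 5) → M) (g : M) (h0 : f ⟨0, by omega⟩ + f ⟨1, by omega⟩ = g)
    (h1 : f ⟨m + 3, by omega⟩ + f ⟨m + 4, by omega⟩ = g)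
    (h2 : ∀ v : Fin (m + 5), 2 ≤ v.val → v.val ≤ m + 2 → f v = g) (v : Fin (m + 5)) :
    ∑ w, (if (graphDTilde m).Adj v w then f w else 0) = rootDTilde m v • g := by
  classical
  obtain ⟨k, hk⟩ := v
  have key : ∀ S : Finset (Fin (m + 5)), (∀ w, (graphDTilde m).Adj ⟨k, hk⟩ w ↔ w ∈ S) →
      ∑ w, (if (graphDTilde m).Adj ⟨k, hk⟩ w then f w else 0) = ∑ w ∈ S, f w :=
    fun S hS => sum_ite_adj S hS f
  simp only [rootDTilde]
  split_ifs with hv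
  · rw [one_smul]
    rcases Nat.lt_or_ge k 2 with h | h
    · rw [key ({⟨2, by omega⟩} : Finset _) (by simp only [graphDTilde_adj, Finset.mem_insert, Finset.mem_singleton,
            Fin.ext_iff, and_true, true_and, or_true]; omega),
        Finset.sum_singleton]
      exact h2 _ le_rfl (by simp)
    · rw [key ({⟨m + 2, by omega⟩} : Finset _) (by simp only [graphDTilde_adj, Finset.mem_insert, Finset.mem_singleton,
            Fin.ext_iff, and_true, true_and, or_true]; omega),
        Finset.sum_singleton]
      exact h2 _ (by simp) le_rfl
  · rw [two_smul]
    rcases Nat.eq_or_lt_of_le (show 2 ≤ k by omega) with h | h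
    · subst h
      rcases Nat.eq_zero_or_pos m with rfl | hm
      · rw [key ({⟨0, by omega⟩, ⟨1, by omega⟩, ⟨3, by omega⟩, ⟨4, by omega⟩} : Finset _) (by
          simp only [graphDTilde_adj, Finset.mem_insert, Finset.mem_singleton,
            Fin.ext_iff, and_true, true_and, or_true]; omega),
          Finset.sum_insert (by simp), Finset.sum_insert (by simp), Finset.sum_insert (by simp),
          Finset.sum_singleton, ← add_assoc, h0]
        exact congrArg (g + ·) h1
      · rw [key ({⟨0, by omega⟩, ⟨1, by omega⟩, ⟨3, by omega⟩} : Finset _) (by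
          simp only [graphDTilde_adj, Finset.mem_insert, Finset.mem_singleton,
            Fin.ext_iff, and_true, true_and, or_true]; omega),
          Finset.sum_insert (by simp), Finset.sum_insert (by simp),
          Finset.sum_singleton, ← add_assoc, h0, h2 _ (by simp) (by simp; omega)]
    · rcases Nat.eq_or_lt_of_le (show k ≤ m + 2 by omega) with h' | h'
      · subst h'
        rw [key ({⟨m + 1, by omega⟩, ⟨m + 3, by omega⟩, ⟨m + 4, by omega⟩} : Finset _) (by
          simp only [graphDTilde_adj, Finset.mem_insert, Finset.mem_singleton,
            Fin.ext_iff, and_true, true_and, or_true]; omega),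
          Finset.sum_insert (by simp), Finset.sum_insert (by simp),
          Finset.sum_singleton, h1, h2 _ (by simp; omega) (by simp)]
      · rw [key ({⟨k - 1, by omega⟩, ⟨k + 1, by omega⟩} : Finset _) (by
          simp only [graphDTilde_adj, Finset.mem_insert, Finset.mem_singleton,
            Fin.ext_iff, and_true, true_and, or_true]; omega),
          Finset.sum_insert (by simp), Finset.sum_singleton,
          h2 _ (by simp; omega) (by simp; omega), h2 _ (by simp; omega) (by simp; omega)]

theorem isNullRoot_graphDTilde (m : ℕ) : IsNullRoot (graphDTilde m) (rootDTilde m) := by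
  refine ⟨preconnected_of_height (fun v => if v.val = 2 then 0 else v.val + 1) ⟨2, by omega⟩
    fun v hv => ?_, fun v => ?_, ⟨⟨0, by omega⟩, by simp [rootDTilde]⟩, fun v _ => ?_⟩
  · have hv' : v.val ≠ 2 := fun h => hv (Fin.ext h)
    have hlt := v.isLt
    by_cases h1 : v.val ≤ 1
    · refine ⟨⟨2, by omega⟩, by simp [hv'], ?_⟩
      rw [graphDTilde_adj]
      simp only [and_true, true_and]
      omega
    · by_cases h2 : v.val = m + 4
      · refine ⟨⟨m + 2, by omega⟩, ?_, ?_⟩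
        · simp only [hv', if_false]
          split_ifs <;> omega
        · rw [graphDTilde_adj]
          simp only [and_true, true_and]
          omega
      · refine ⟨⟨v.val - 1, by omega⟩, ?_, ?_⟩
        · simp only [hv', if_false]
          split_ifs <;> omega
        · rw [graphDTilde_adj]
          simp only [and_true, true_and]
          omega
  · simp only [rootDTilde]
    split_ifs <;> omega
  · rw [sum_adj_graphDTilde _ 2, smul_eq_mul, mul_comm]
    · simp [rootDTilde]
    · simp [rootDTilde]
    · intro v h h'
      simp only [rootDTilde]
      split_ifs <;> omega

/-- The unit vectors at the end vertices of `D̃ₙ`. -/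
noncomputable def endVectorDTilde (m : ℕ) (v : Fin (m + 5)) : Fin 2 → ℝ :=
  if v.val = 0 then ![1, 0] else if v.val = 1 then ![0, 1] else
    if v.val = m + 3 then ![3 / 5, 4 / 5] else ![4 / 5, -3 / 5]

/-- Middle vertices carry the plane with identity maps between them. The two lines at each end are
spanned by an orthonormal basis, so their projections add up to 1. The two bases, one standard and
one from the triple 3, 4, 5, share no line, which leaves only scalars in the commutant. -/
theorem hasOrthoscalarModel_graphDTilde (m : ℕ) :
    HasOrthoscalarModel (graphDTilde m) (rootDTilde m) := by
  classical
  set d := rootDTilde m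
  have hd1 : ∀ v, (v.val ≤ 1 ∨ m + 3 ≤ v.val) → d v = 1 := fun v h => if_pos h
  have hd2 : ∀ v, 2 ≤ v.val → v.val ≤ m + 2 → d v = 2 := fun v h h' => if_neg (by omega)
  let E : ∀ v, Matrix (Fin 2) (Fin (d v)) ℝ := fun v => planeFrame (d v) (endVectorDTilde m v)
  have hE : ∀ v, (E v)ᵀ * E v = 1 := fun v => by
    refine planeFrame_transpose_mul ?_ ?_
    · by_cases h : v.val ≤ 1 ∨ m + 3 ≤ v.val
      · exact Or.inl (hd1 v h)
      · exact Or.inr (hd2 v (by omega) (by omega))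
    · unfold endVectorDTilde
      split_ifs <;> norm_num [Matrix.cons_val_zero, Matrix.cons_val_one]
  let X : Fin (m + 5) → Matrix (Fin 2) (Fin 2) ℝ := fun v => E v * (E v)ᵀ
  have hXmid : ∀ v : Fin (m + 5), 2 ≤ v.val → v.val ≤ m + 2 → X v = 1 := fun v h h' => by
    have hgen : ∀ k (u : Fin 2 → ℝ), k = 2 → planeFrame k u * (planeFrame k u)ᵀ = 1 := by
      rintro _ u rfl
      simp [planeFrame_two]
    exact hgen _ _ (hd2 v h h')
  have hXend : ∀ v : Fin (m + 5), (v.val ≤ 1 ∨ m + 3 ≤ v.val) →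
      X v = vecMulVec (endVectorDTilde m v) (endVectorDTilde m v) := fun v h => by
    have hgen : ∀ k (u : Fin 2 → ℝ), k = 1 → planeFrame k u * (planeFrame k u)ᵀ =
        vecMulVec u u := by
      rintro _ u rfl
      exact planeFrame_one_mul_transpose u
    exact hgen _ _ (hd1 v h)
  have hX0 : X ⟨0, by omega⟩ = !![1, 0; 0, 0] := by
    rw [hXend _ (by simp)]
    ext i j
    fin_cases i <;> fin_cases j <;> norm_num [endVectorDTilde, vecMulVec_apply]
  have hX1 : X ⟨1, by omega⟩ = !![0, 0; 0, 1] := by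
    rw [hXend _ (by simp)]
    ext i j
    fin_cases i <;> fin_cases j <;> norm_num [endVectorDTilde, vecMulVec_apply]
  have h31 : m + 3 ≠ 1 := by omega
  have h41 : m + 4 ≠ 1 := by omega
  have hX3 : X ⟨m + 3, by omega⟩ = !![9 / 25, 12 / 25; 12 / 25, 16 / 25] := by
    rw [hXend _ (by simp)]
    ext i j
    fin_cases i <;> fin_cases j <;> simp [endVectorDTilde, vecMulVec_apply, h31] <;> norm_num
  have hX4 : X ⟨m + 4, by omega⟩ = !![16 / 25, -12 / 25; -12 / 25, 9 / 25] := by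
    rw [hXend _ (by simp)]
    ext i j
    fin_cases i <;> fin_cases j <;> simp [endVectorDTilde, vecMulVec_apply, h41] <;> norm_num
  have hsum : ∀ v, ∑ w, (if (graphDTilde m).Adj v w then X w else 0) = d v • 1 := by
    refine sum_adj_graphDTilde X 1 ?_ ?_ hXmid
    · rw [hX0, hX1]
      ext i j
      fin_cases i <;> fin_cases j <;> norm_num
    · rw [hX3, hX4]
      ext i j
      fin_cases i <;> fin_cases j <;> norm_num
  refine ⟨fun v w => if (graphDTilde m).Adj v w then (E v)ᵀ * E w else 0, fun v w => ?_,
    fun v w h => if_neg h, ⟨fun v => d v, fun v => ?_⟩, fun p hp => ?_⟩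
  · simp only [(graphDTilde m).adj_comm v w]
    split_ifs <;> simp
  · have : ∀ w, (if (graphDTilde m).Adj v w then (E v)ᵀ * E w else 0) *
        (if (graphDTilde m).Adj w v then (E w)ᵀ * E v else 0) =
        (E v)ᵀ * (if (graphDTilde m).Adj v w then X w else 0) * E v := by
      intro w
      simp only [(graphDTilde m).adj_comm w v]
      split_ifs
      · simp only [X, Matrix.mul_assoc]
      · simp
    simp only [this]
    rw [← Matrix.sum_mul, ← Matrix.mul_sum, hsum]
    rw [Matrix.mul_smul, Matrix.smul_mul, Matrix.mul_one, hE, Nat.cast_smul_eq_nsmul]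
  · let Q : Fin (m + 5) → Matrix (Fin 2) (Fin 2) ℝ := fun v => E v * p v * (E v)ᵀ
    have hQX : ∀ v w, (graphDTilde m).Adj v w → Q v * X w = X v * Q w := fun v w h => by
      have h1 := hp v w
      simp only [if_pos h] at h1
      calc Q v * X w = E v * (p v * ((E v)ᵀ * E w)) * (E w)ᵀ := by
            simp only [Q, X, Matrix.mul_assoc]
        _ = X v * Q w := by rw [h1]; simp only [Q, X, Matrix.mul_assoc]
    have hQX' : ∀ v, Q v * X v = Q v := fun v => by
      calc Q v * X v = E v * p v * ((E v)ᵀ * E v) * (E v)ᵀ := by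
            simp only [Q, X, Matrix.mul_assoc]
        _ = Q v := by rw [hE, Matrix.mul_one]
    have hmid : ∀ k, ∀ h : k + 2 ≤ m + 2, Q ⟨k + 2, by omega⟩ = Q ⟨2, by omega⟩ := by
      intro k
      induction k with
      | zero => exact fun _ => rfl
      | succ k ih =>
        intro h
        rw [← ih (by omega)]
        have := hQX ⟨k + 2, by omega⟩ ⟨k + 1 + 2, by omega⟩
          (by rw [graphDTilde_adj]; simp only [and_true, true_and]; omega)
        rw [hXmid _ (by simp) (by simpa using h), hXmid _ (by simp) (by simp; omega),
          Matrix.mul_one, Matrix.one_mul] at this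
        exact this.symm
    have hend : ∀ v w, (graphDTilde m).Adj v w → 2 ≤ w.val → w.val ≤ m + 2 →
        Q v = X v * Q w ∧ Q w * X v = Q v := fun v w h h1 h2 => by
      have e1 := hQX v w h
      have e2 := hQX w v h.symm
      rw [hXmid w h1 h2] at e1 e2
      rw [Matrix.mul_one] at e1
      rw [Matrix.one_mul] at e2
      exact ⟨e1, e2⟩
    have hnbr : ∀ v : Fin (m + 5), ∃ w, (graphDTilde m).Adj v w ∧ 2 ≤ w.val ∧ w.val ≤ m + 2 ∨
        (2 ≤ v.val ∧ v.val ≤ m + 2) := fun v => by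
      have hlt := v.isLt
      rcases Nat.lt_or_ge v.val 2 with h | h
      · exact ⟨⟨2, by omega⟩, Or.inl ⟨by rw [graphDTilde_adj]; simp only [and_true, true_and]; omega, le_rfl, by simp⟩⟩
      · rcases Nat.lt_or_ge v.val (m + 3) with h' | h'
        · exact ⟨v, Or.inr ⟨h, by omega⟩⟩
        · exact ⟨⟨m + 2, by omega⟩,
            Or.inl ⟨by rw [graphDTilde_adj]; simp only [and_true, true_and]; omega, by simp, le_rfl⟩⟩
    set q := Q ⟨2, by omega⟩ with hq
    have hQmid : ∀ w : Fin (m + 5), 2 ≤ w.val → w.val ≤ m + 2 → Q w = q := by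
      rintro ⟨k, hk⟩ h1 h2
      obtain ⟨j, rfl⟩ : ∃ j, k = j + 2 := ⟨k - 2, by simp only at h1; omega⟩
      exact hmid j h2
    have hQ : ∀ v, Q v = X v * q ∧ q * X v = Q v := fun v => by
      obtain ⟨w, ⟨h, h1, h2⟩ | ⟨h1, h2⟩⟩ := hnbr v
      · rw [← hQmid w h1 h2]
        exact hend v w h h1 h2
      · rw [hXmid v h1 h2, hQmid v h1 h2, Matrix.one_mul, Matrix.mul_one]
        exact ⟨rfl, rfl⟩
    -- Commuting with the first coordinate projection makes `q` diagonal; commuting with the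
    -- projection onto `(3, 4)` then equates its diagonal entries.
    have c0 := (hQ ⟨0, by omega⟩).2.trans (hQ ⟨0, by omega⟩).1
    have c3 := (hQ ⟨m + 3, by omega⟩).2.trans (hQ ⟨m + 3, by omega⟩).1
    rw [hX0] at c0
    rw [hX3] at c3
    have a1 := congrFun (congrFun c0 0) 1
    have a2 := congrFun (congrFun c0 1) 0
    have a3 := congrFun (congrFun c3 0) 1
    simp [Matrix.mul_apply, Fin.sum_univ_two] at a1 a2 a3
    have hscalar : q = q 0 0 • (1 : Matrix (Fin 2) (Fin 2) ℝ) := by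
      ext i j
      fin_cases i <;> fin_cases j <;> simp
      · exact a1.symm
      · exact a2
      · linarith
    refine ⟨q 0 0, fun v => ?_⟩
    calc p v = ((E v)ᵀ * E v) * p v * ((E v)ᵀ * E v) := by
          rw [hE, Matrix.one_mul, Matrix.mul_one]
      _ = (E v)ᵀ * Q v * E v := by simp only [Q, Matrix.mul_assoc]
      _ = (E v)ᵀ * (q 0 0 • X v) * E v := by
          rw [(hQ v).1]
          nth_rewrite 1 [hscalar]
          rw [Matrix.mul_smul, Matrix.mul_one]
      _ = q 0 0 • (((E v)ᵀ * E v) * ((E v)ᵀ * E v)) := by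
          simp only [X, Matrix.mul_smul, Matrix.smul_mul, Matrix.mul_assoc]
      _ = q 0 0 • 1 := by rw [hE, Matrix.one_mul]

end DTilde

/-! ### Jacobi matrices and complements to scalar matrices -/

section Jacobi

/-- Row `i` determines `x` at `i + 1` from the earlier entries. The equation is demanded only where
`x i` vanishes, which covers eigenvectors for any eigenvalue; values in a module allow whole matrix
columns as entries. -/
theorem eq_zero_of_hessenberg {M : Type*} [AddCommGroup M] [Module ℝ M] {n : ℕ}
    {J : Matrix (Fin (n + 1)) (Fin (n + 1)) ℝ} (h1 : ∀ i : Fin n, J i.castSucc i.succ ≠ 0)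
    (h2 : ∀ i k : Fin (n + 1), i.val + 1 < k.val → J i k = 0) (x : Fin (n + 1) → M)
    (hx : ∀ i, x i = 0 → ∑ k, J i k • x k = 0) (h0 : x 0 = 0) : x = 0 := by
  have key : ∀ m : ℕ, ∀ k : Fin (n + 1), k.val ≤ m → x k = 0 := by
    intro m
    induction m with
    | zero =>
      intro k hk
      rw [show k = 0 from Fin.ext (by simpa using hk), h0]
    | succ m ih =>
      intro k hk
      rcases Nat.lt_or_ge m k.val with h | h
      · obtain ⟨i, rfl⟩ : ∃ i : Fin n, k = i.succ := Fin.exists_succ_eq.mpr (by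
          rintro rfl
          simp at h) |>.imp fun _ h => h.symm
        have hi : i.val = m := by simp at hk h; omega
        have := hx i.castSucc (ih _ (by simp [hi]))
        rw [Finset.sum_eq_single i.succ] at this
        · exact (smul_eq_zero.mp this).resolve_left (h1 i)
        · intro b _ hb
          rcases Nat.lt_or_ge i.val b.val with hlt | hle
          · rw [h2 _ _ (by
              have : b.val ≠ i.val + 1 := fun h => hb (Fin.ext (by simpa using h))
              simp
              omega), zero_smul]
          · rw [ih b (by omega), smul_zero]
        · simp
      · exact ih k h
  funext k
  exact key k.val k le_rfl

/-- The first basis vector is cyclic for a Jacobi matrix. A commuting `p` having it as an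
eigenvector is therefore scalar: the columns of `p - p 0 0 • 1` satisfy the recursion with vanishing
start. -/
theorem eq_smul_one_of_commute_hessenberg {n : ℕ} {J p : Matrix (Fin (n + 1)) (Fin (n + 1)) ℝ}
    (hJ : Jᵀ = J) (h1 : ∀ i : Fin n, J i.castSucc i.succ ≠ 0)
    (h2 : ∀ i k : Fin (n + 1), i.val + 1 < k.val → J i k = 0) (hp : p * J = J * p)
    (h0 : ∀ a, a ≠ 0 → p a 0 = 0) : p = p 0 0 • 1 := by
  have hq : (p - p 0 0 • 1) * J = J * (p - p 0 0 • 1) := by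
    simp [Matrix.sub_mul, Matrix.mul_sub, hp]
  set q := p - p 0 0 • (1 : Matrix (Fin (n + 1)) (Fin (n + 1)) ℝ) with hqdef
  have hzero : (fun k a => q a k) = (0 : Fin (n + 1) → Fin (n + 1) → ℝ) := by
    refine eq_zero_of_hessenberg h1 h2 _ (fun i hi => ?_) ?_
    · funext a
      have := congrFun (congrFun hq a) i
      rw [Matrix.mul_apply, Matrix.mul_apply] at this
      have hz : ∑ k, J a k * q k i = 0 :=
        Finset.sum_eq_zero fun k _ => by rw [show q k i = 0 from congrFun hi k, mul_zero]
      rw [hz] at this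
      simp only [Finset.sum_apply, Pi.smul_apply, smul_eq_mul, Pi.zero_apply]
      rw [← this]
      refine Finset.sum_congr rfl fun k _ => ?_
      rw [mul_comm, show J i k = J k i from congrFun (congrFun hJ k) i]
    · funext a
      by_cases ha : a = 0
      · subst ha
        simp [hqdef]
      · simp [hqdef, h0 a ha, Matrix.one_apply_ne ha]
  have : q = 0 := by
    ext a k
    exact congrFun (congrFun hzero k) a
  exact sub_eq_zero.mp this

/-- An eigenvector is determined by its first coordinate, so eigenspaces are lines. -/
theorem eigenvalues_injective_of_hessenberg {n : ℕ} {J : Matrix (Fin (n + 1)) (Fin (n + 1)) ℝ}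
    (hJ : J.IsHermitian) (h1 : ∀ i : Fin n, J i.castSucc i.succ ≠ 0)
    (h2 : ∀ i k : Fin (n + 1), i.val + 1 < k.val → J i k = 0) :
    Function.Injective hJ.eigenvalues := by
  intro i j hij
  by_contra hne
  let U : Fin (n + 1) → Fin (n + 1) → ℝ := fun i => (hJ.eigenvectorBasis i).ofLp
  have hU : ∀ i j, U i ⬝ᵥ U j = if i = j then 1 else 0 := fun i j => by
    have := orthonormal_iff_ite.mp hJ.eigenvectorBasis.orthonormal j i
    simp only [eq_comm (a := j)] at this
    rw [← this, EuclideanSpace.inner_eq_star_dotProduct]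
    simp [U]
  have hker : ∀ x : Fin (n + 1) → ℝ, J *ᵥ x = hJ.eigenvalues i • x → x 0 = 0 → x = 0 := by
    intro x hx
    refine eq_zero_of_hessenberg h1 h2 x fun k hk => ?_
    have := congrFun hx k
    simpa [hk, Matrix.mulVec, dotProduct] using this
  have hi : J *ᵥ U i = hJ.eigenvalues i • U i := hJ.mulVec_eigenvectorBasis i
  have hj : J *ᵥ U j = hJ.eigenvalues i • U j := by
    rw [hij]
    exact hJ.mulVec_eigenvectorBasis j
  -- The combination of the two eigenvectors that kills the first coordinate.
  have hy := hker (U j 0 • U i - U i 0 • U j)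
    (by rw [Matrix.mulVec_sub, Matrix.mulVec_smul, Matrix.mulVec_smul, hi, hj, smul_sub,
      smul_comm, smul_comm (U i 0)]) (by simp [mul_comm])
  have hz := congrArg (fun y => y ⬝ᵥ U i) hy
  simp only [sub_dotProduct, smul_dotProduct, hU, if_pos, if_neg (Ne.symm hne), zero_dotProduct]
    at hz
  have hv := hker (U j) hj (by simpa using hz)
  have := hU j j
  simp [hv] at this

/-- A Jacobi matrix has simple spectrum, hence is completed to a scalar matrix by a positive
semidefinite matrix of corank one with simple nonzero spectrum. -/
theorem exists_jacobi_complement {n : ℕ} {J : Matrix (Fin (n + 1)) (Fin (n + 1)) ℝ}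
    (hJ : Jᵀ = J) (h1 : ∀ i : Fin n, J i.castSucc i.succ ≠ 0)
    (h2 : ∀ i k : Fin (n + 1), i.val + 1 < k.val → J i k = 0) :
    ∃ (c : ℝ) (S : Matrix (Fin (n + 1)) (Fin n) ℝ) (α : Fin n → ℝ),
      S * Sᵀ + J = c • 1 ∧ Sᵀ * S = diagonal α ∧ StrictAnti α ∧ ∀ s, 0 < α s := by
  have hH : J.IsHermitian := by
    rw [Matrix.IsHermitian, Matrix.conjTranspose_eq_transpose_of_trivial, hJ]
  let σ := Tuple.sort hH.eigenvalues
  let μ : Fin (n + 1) → ℝ := hH.eigenvalues ∘ σ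
  have hμ : StrictMono μ := (Tuple.monotone_sort hH.eigenvalues).strictMono_of_injective
    ((eigenvalues_injective_of_hessenberg hH h1 h2).comp σ.injective)
  let U : Matrix (Fin (n + 1)) (Fin (n + 1)) ℝ :=
    Matrix.of fun i s => (hH.eigenvectorBasis (σ s)).ofLp i
  have hU1 : Uᵀ * U = 1 := by
    ext s t
    have := orthonormal_iff_ite.mp hH.eigenvectorBasis.orthonormal (σ t) (σ s)
    rw [EuclideanSpace.inner_eq_star_dotProduct] at this
    rw [Matrix.mul_apply, Matrix.one_apply]
    simp only [σ.injective.eq_iff, eq_comm (a := t)] at this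
    rw [← this]
    simp [U, dotProduct]
  have hU2 : U * Uᵀ = 1 := mul_eq_one_comm.mp hU1
  have hJU : J * U = U * diagonal μ := by
    ext i s
    have := congrFun (hH.mulVec_eigenvectorBasis (σ s)) i
    rw [Matrix.mul_diagonal, mul_comm]
    exact this
  let c := μ (Fin.last n)
  have hpos : ∀ s : Fin n, 0 < c - μ s.castSucc := fun s =>
    sub_pos.mpr (hμ (Fin.castSucc_lt_last s))
  let r : Fin n → ℝ := fun s => Real.sqrt (c - μ s.castSucc)
  have hr : ∀ s, r s * r s = c - μ s.castSucc := fun s => Real.mul_self_sqrt (hpos s).le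
  refine ⟨c, Matrix.of fun i s => r s * U i s.castSucc, fun s => c - μ s.castSucc, ?_, ?_,
    fun s t hst => sub_lt_sub_left (hμ (Fin.castSucc_lt_castSucc_iff.mpr hst)) c, hpos⟩
  · have hJ' : J = U * diagonal μ * Uᵀ := by rw [← hJU, Matrix.mul_assoc, hU2, Matrix.mul_one]
    have hcJ : c • (1 : Matrix (Fin (n + 1)) (Fin (n + 1)) ℝ) - J =
        U * diagonal (fun s => c - μ s) * Uᵀ := by
      have : diagonal (fun s => c - μ s) = c • (1 : Matrix (Fin (n + 1)) (Fin (n + 1)) ℝ) -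
          diagonal μ := by
        ext i j
        by_cases h : i = j
        · subst h; simp
        · simp [h]
      rw [this, Matrix.mul_sub, Matrix.sub_mul, ← hJ', Matrix.mul_smul, Matrix.smul_mul,
        Matrix.mul_one, hU2]
    rw [← eq_sub_iff_add_eq, hcJ]
    ext i j
    rw [Matrix.mul_apply, Matrix.mul_apply, Fin.sum_univ_castSucc]
    simp only [Matrix.mul_diagonal, Matrix.transpose_apply, Matrix.of_apply]
    rw [show c - μ (Fin.last n) = 0 from sub_self _, mul_zero, zero_mul, add_zero]
    refine Finset.sum_congr rfl fun s _ => ?_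
    rw [← hr]
    ring
  · ext s t
    have := congrFun (congrFun hU1 s.castSucc) t.castSucc
    rw [Matrix.mul_apply, Matrix.one_apply] at this
    rw [Matrix.mul_apply, Matrix.diagonal_apply]
    simp only [Matrix.transpose_apply, Matrix.of_apply, Fin.castSucc_inj] at this ⊢
    have h3 : ∑ x, r s * U x s.castSucc * (r t * U x t.castSucc) =
        r s * r t * ∑ x, U x s.castSucc * U x t.castSucc := by
      rw [Finset.mul_sum]
      exact Finset.sum_congr rfl fun _ _ => by ring
    rw [h3, this]
    split_ifs with h
    · subst h
      rw [mul_one, hr]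
    · rw [mul_zero]

/-- One step down an arm whose dimensions fall by one: the differences to the largest entry are
nonzero except the first. Listing them in reverse order restores strict decrease, so the step can be
iterated. -/
theorem exists_diagonal_complement {k : ℕ} {α : Fin (k + 1) → ℝ} (hα : StrictAnti α) :
    ∃ (S : Matrix (Fin (k + 1)) (Fin k) ℝ) (β : Fin k → ℝ),
      diagonal α + S * Sᵀ = α 0 • 1 ∧ Sᵀ * S = diagonal β ∧ StrictAnti β ∧ ∀ s, 0 < β s := by
  have hpos : ∀ t : Fin k, 0 < α 0 - α t.succ := fun t => sub_pos.mpr (hα (Fin.succ_pos t))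
  refine ⟨Matrix.of fun i s => if i = s.rev.succ then Real.sqrt (α 0 - α i) else 0,
    fun s => α 0 - α s.rev.succ, ?_, ?_, fun s t hst =>
      sub_lt_sub_left (hα (Fin.succ_lt_succ_iff.mpr (Fin.rev_lt_rev.mpr hst))) _,
    fun s => hpos _⟩
  · ext i j
    rw [Matrix.add_apply, Matrix.mul_apply]
    simp only [Matrix.transpose_apply, Matrix.of_apply, Matrix.diagonal_apply, Matrix.smul_apply,
      Matrix.one_apply, smul_eq_mul]
    refine Fin.cases ?_ (fun t => ?_) i
    · simp [(Fin.succ_ne_zero _).symm]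
    · rw [Finset.sum_eq_single t.rev]
      · rw [Fin.rev_rev, if_pos rfl]
        by_cases h : t.succ = j
        · subst h
          simp [Real.mul_self_sqrt (hpos t).le]
        · simp [h, Ne.symm h]
      · intro b _ hb
        rw [if_neg, zero_mul]
        intro h
        exact hb (by rw [Fin.succ_injective _ h, Fin.rev_rev])
      · simp
  · ext s t
    rw [Matrix.mul_apply, Matrix.diagonal_apply]
    simp only [Matrix.transpose_apply, Matrix.of_apply]
    rw [Finset.sum_eq_single s.rev.succ]
    · by_cases h : s = t
      · subst h
        simp [Real.mul_self_sqrt (hpos _).le]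
      · simp [h]
    · intro b _ hb
      rw [if_neg hb, zero_mul]
    · simp

/-- A scalar endomorphism propagates outwards along an arm, with the same scalar, because `Sᵀ * S`
is invertible. -/
theorem eq_smul_one_of_mul_eq {a b : ℕ} {S : Matrix (Fin a) (Fin b) ℝ} {α : Fin b → ℝ}
    (hS : Sᵀ * S = diagonal α) (hα : ∀ s, 0 < α s) {p : Matrix (Fin a) (Fin a) ℝ}
    {q : Matrix (Fin b) (Fin b) ℝ} (h : p * S = S * q) {z : ℝ} (hp : p = z • 1) : q = z • 1 := by
  have h1 : diagonal α * q = z • diagonal α := by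
    rw [← hS, Matrix.mul_assoc, ← h, hp, Matrix.smul_mul, Matrix.one_mul, Matrix.mul_smul]
  ext i j
  have := congrFun (congrFun h1 i) j
  rw [Matrix.diagonal_mul] at this
  refine mul_left_cancel₀ (hα i).ne' (this.trans ?_)
  by_cases hij : i = j
  · subst hij; simp [mul_comm]
  · simp [hij]

theorem commute_mul_transpose {a b : ℕ} {S : Matrix (Fin a) (Fin b) ℝ}
    {p : Matrix (Fin a) (Fin a) ℝ} {q : Matrix (Fin b) (Fin b) ℝ} (h : p * S = S * q)
    (h' : q * Sᵀ = Sᵀ * p) : p * (S * Sᵀ) = S * Sᵀ * p := by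
  rw [← Matrix.mul_assoc, h, Matrix.mul_assoc, h', Matrix.mul_assoc]

end Jacobi

theorem Fintype.sum_eq_add_add {W M : Type*} [Fintype W] [DecidableEq W] [AddCommMonoid M]
    {f : W → M} (a b c : W) (hab : a ≠ b) (hac : a ≠ c) (hbc : b ≠ c)
    (h : ∀ w, w ≠ a → w ≠ b → w ≠ c → f w = 0) : ∑ w, f w = f a + (f b + f c) := by
  rw [← Finset.sum_subset (Finset.subset_univ {a, b, c}), Finset.sum_insert (by simp [hab, hac]),
    Finset.sum_pair hbc]
  intro w _ hw
  simp only [Finset.mem_insert, Finset.mem_singleton, not_or] at hw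
  exact h w hw.1 hw.2.1 hw.2.2

/-! ### The graph `Ẽ₆` -/

section E6

/-- The minimal imaginary root of `Ẽ₆`. -/
def rootE6Tilde : Fin 7 → ℕ := ![1, 2, 3, 2, 1, 2, 1]

theorem isNullRoot_graphE6Tilde : IsNullRoot graphE6Tilde rootE6Tilde := by
  have hadj : ∀ v w, graphE6Tilde.Adj v w ↔ v ≠ w ∧
      (((w.val = v.val + 1 ∧ w.val ≤ 4) ∨ (v.val = 2 ∧ w.val = 5) ∨ (v.val = 5 ∧ w.val = 6)) ∨
        ((v.val = w.val + 1 ∧ v.val ≤ 4) ∨ (w.val = 2 ∧ v.val = 5) ∨ (w.val = 5 ∧ v.val = 6))) :=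
    fun v w => SimpleGraph.fromRel_adj _ v w
  refine ⟨preconnected_of_height Fin.val 0 fun v hv => ?_, by decide, ⟨0, rfl⟩, fun v _ => ?_⟩
  · simp only [hadj]
    revert v
    decide
  · simp only [hadj]
    revert v
    decide

/-- A family of matrices on the edges of `Ẽ₆`. -/
def edgeMatrixE6Tilde (S₁₀ S₃₄ S₅₆ : Matrix (Fin 2) (Fin 1) ℝ)
    (S₂₁ S₂₃ S₂₅ : Matrix (Fin 3) (Fin 2) ℝ) :
    ∀ v w : Fin 7, Matrix (Fin (rootE6Tilde v)) (Fin (rootE6Tilde w)) ℝ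
  | 1, 0 => S₁₀
  | 0, 1 => S₁₀ᵀ
  | 2, 1 => S₂₁
  | 1, 2 => S₂₁ᵀ
  | 2, 3 => S₂₃
  | 3, 2 => S₂₃ᵀ
  | 3, 4 => S₃₄
  | 4, 3 => S₃₄ᵀ
  | 2, 5 => S₂₅
  | 5, 2 => S₂₅ᵀ
  | 5, 6 => S₅₆
  | 6, 5 => S₅₆ᵀ
  | _, _ => 0

theorem diagonal_eq_smul_one {α : Fin 1 → ℝ} : diagonal α = α 0 • (1 : Matrix (Fin 1) (Fin 1) ℝ) := by
  ext i j
  rw [Subsingleton.elim i 0, Subsingleton.elim j 0]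
  simp

-- The columns `(3, 4)` and `(12/5, -9/5)` are orthogonal with squared lengths 25 and 9. Placed in
-- rows 1, 2 for one arm and rows 0, 1 for another, they add up to a Jacobi matrix at the centre.
-- The unequal lengths leave 25 - 9 = 16 for the outermost edge; the third arm comes from the Jacobi
-- complement.
set_option maxHeartbeats 1000000 in
theorem hasOrthoscalarModel_graphE6Tilde : HasOrthoscalarModel graphE6Tilde rootE6Tilde := by
  let S₂₃ : Matrix (Fin 3) (Fin 2) ℝ := !![0, 0; 3, 12 / 5; 4, -9 / 5]
  let S₂₅ : Matrix (Fin 3) (Fin 2) ℝ := !![3, 12 / 5; 4, -9 / 5; 0, 0]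
  have hB : S₂₃ * S₂₃ᵀ = !![0, 0, 0; 0, 369 / 25, 192 / 25; 0, 192 / 25, 481 / 25] := by
    ext i j
    fin_cases i <;> fin_cases j <;> norm_num [S₂₃, Matrix.mul_apply, Fin.sum_univ_succ]
  have hC : S₂₅ * S₂₅ᵀ = !![369 / 25, 192 / 25, 0; 192 / 25, 481 / 25, 0; 0, 0, 0] := by
    ext i j
    fin_cases i <;> fin_cases j <;> norm_num [S₂₅, Matrix.mul_apply, Fin.sum_univ_succ]
  have hB' : S₂₃ᵀ * S₂₃ = diagonal ![25, 9] := by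
    ext i j
    fin_cases i <;> fin_cases j <;> norm_num [S₂₃, Matrix.mul_apply, Fin.sum_univ_succ]
  have hC' : S₂₅ᵀ * S₂₅ = diagonal ![25, 9] := by
    ext i j
    fin_cases i <;> fin_cases j <;> norm_num [S₂₅, Matrix.mul_apply, Fin.sum_univ_succ]
  set J := S₂₃ * S₂₃ᵀ + S₂₅ * S₂₅ᵀ with hJdef
  have hJsym : Jᵀ = J := by simp [J]
  have hJ1 : ∀ i k : Fin 3, k.val = i.val + 1 → J i k ≠ 0 := by
    intro i k
    rw [hJdef, hB, hC]
    fin_cases i <;> fin_cases k <;> norm_num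
  have hJ2 : ∀ i k : Fin 3, i.val + 1 < k.val → J i k = 0 := by
    intro i k
    rw [hJdef, hB, hC]
    fin_cases i <;> fin_cases k <;> norm_num
  obtain ⟨c, S₂₁, α, hS21, hS21', hα, hα0⟩ := exists_jacobi_complement hJsym
    (fun i => hJ1 _ _ rfl) hJ2
  obtain ⟨S₁₀, β, hS10, hS10', -, hβ0⟩ := exists_diagonal_complement hα
  have hanti : StrictAnti (![25, 9] : Fin 2 → ℝ) := by
    rw [Fin.strictAnti_iff_succ_lt]
    intro i
    fin_cases i
    norm_num
  obtain ⟨S₃₄, γ, hS34, hS34', -, hγ0⟩ := exists_diagonal_complement hanti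
  rw [← hS21'] at hS10
  refine ⟨edgeMatrixE6Tilde S₁₀ S₃₄ S₃₄ S₂₁ S₂₃ S₂₅, ?_, ?_, ?_, ?_⟩
  · intro v w
    fin_cases v <;> fin_cases w <;> rfl
  · intro v w
    fin_cases v <;> fin_cases w <;> first
      | exact fun _ => rfl
      | exact fun h => absurd ((SimpleGraph.fromRel_adj _ _ _).mpr (by decide)) h
  · have h25 : (![25, 9] : Fin 2 → ℝ) 0 = 25 := rfl
    rw [h25] at hS34
    have hS56 := hS34
    rw [← hB'] at hS34
    rw [← hC'] at hS56
    rw [diagonal_eq_smul_one] at hS10' hS34'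
    refine ⟨![β 0, α 0, c, 25, γ 0, 25, γ 0], fun v => ?_⟩
    fin_cases v
    · refine (Fintype.sum_eq_single 1 fun w hw => ?_).trans hS10'
      fin_cases w <;> first | exact absurd rfl hw | exact Matrix.zero_mul _
    · refine (Fintype.sum_eq_add 2 0 (by decide) fun w hw => ?_).trans hS10
      fin_cases w <;> first | exact absurd rfl hw.1 | exact absurd rfl hw.2 |
        exact Matrix.zero_mul _
    · refine (Fintype.sum_eq_add_add 1 3 5 (by decide) (by decide) (by decide)
        fun w h1 h3 h5 => ?_).trans hS21
      fin_cases w <;> first | exact absurd rfl h1 | exact absurd rfl h3 | exact absurd rfl h5 |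
        exact Matrix.zero_mul _
    · refine (Fintype.sum_eq_add 2 4 (by decide) fun w hw => ?_).trans hS34
      fin_cases w <;> first | exact absurd rfl hw.1 | exact absurd rfl hw.2 |
        exact Matrix.zero_mul _
    · refine (Fintype.sum_eq_single 3 fun w hw => ?_).trans hS34'
      fin_cases w <;> first | exact absurd rfl hw | exact Matrix.zero_mul _
    · refine (Fintype.sum_eq_add 2 6 (by decide) fun w hw => ?_).trans hS56
      fin_cases w <;> first | exact absurd rfl hw.1 | exact absurd rfl hw.2 |
        exact Matrix.zero_mul _
    · refine (Fintype.sum_eq_single 5 fun w hw => ?_).trans hS34'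
      fin_cases w <;> first | exact absurd rfl hw | exact Matrix.zero_mul _
  · intro p hp
    let q : Matrix (Fin 3) (Fin 3) ℝ := p 2
    have hpB : q * (S₂₃ * S₂₃ᵀ) = S₂₃ * S₂₃ᵀ * q := commute_mul_transpose (hp 2 3) (hp 3 2)
    have hpC : q * (S₂₅ * S₂₅ᵀ) = S₂₅ * S₂₅ᵀ * q := commute_mul_transpose (hp 2 5) (hp 5 2)
    have hq : q = q 0 0 • 1 := by
      -- The kernel of `S₂₃ * S₂₃ᵀ` is spanned by the first basis vector, which is therefore an
      -- eigenvector of `q`.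
      refine eq_smul_one_of_commute_hessenberg hJsym (fun i => hJ1 _ _ rfl) hJ2
        (by rw [Matrix.mul_add, Matrix.add_mul, hpB, hpC]) ?_
      rw [hB] at hpB
      have e1 := congrFun (congrFun hpB 1) 0
      have e2 := congrFun (congrFun hpB 2) 0
      simp [Matrix.mul_apply, Fin.sum_univ_succ] at e1 e2
      intro a ha
      fin_cases a
      · exact absurd rfl ha
      · change q 1 0 = 0
        linarith
      · change q 2 0 = 0
        linarith
    have pos : ∀ s, 0 < (![25, 9] : Fin 2 → ℝ) s := by
      intro s
      fin_cases s <;> norm_num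
    have h1 := eq_smul_one_of_mul_eq hS21' hα0 (hp 2 1) hq
    have h0 := eq_smul_one_of_mul_eq hS10' hβ0 (hp 1 0) h1
    have h3 := eq_smul_one_of_mul_eq hB' pos (hp 2 3) hq
    have h4 := eq_smul_one_of_mul_eq hS34' hγ0 (hp 3 4) h3
    have h5 := eq_smul_one_of_mul_eq hC' pos (hp 2 5) hq
    have h6 := eq_smul_one_of_mul_eq hS34' hγ0 (hp 5 6) h5
    refine ⟨q 0 0, fun v => ?_⟩
    fin_cases v
    exacts [h0, h1, hq, h3, h4, h5, h6]

end E6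

/-! ### The graph `Ẽ₇` -/

section E7

/-- The minimal imaginary root of `Ẽ₇`. -/
def rootE7Tilde : Fin 8 → ℕ := ![1, 2, 3, 4, 3, 2, 1, 2]

theorem isNullRoot_graphE7Tilde : IsNullRoot graphE7Tilde rootE7Tilde := by
  have hadj : ∀ v w, graphE7Tilde.Adj v w ↔ v ≠ w ∧
      (((w.val = v.val + 1 ∧ w.val ≤ 6) ∨ (v.val = 3 ∧ w.val = 7)) ∨
        ((v.val = w.val + 1 ∧ v.val ≤ 6) ∨ (w.val = 3 ∧ v.val = 7))) :=
    fun v w => SimpleGraph.fromRel_adj _ v w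
  refine ⟨preconnected_of_height Fin.val 0 fun v hv => ?_, by decide, ⟨0, rfl⟩, fun v _ => ?_⟩
  · simp only [hadj]
    revert v
    decide
  · simp only [hadj]
    revert v
    decide

/-- A family of matrices on the edges of `Ẽ₇`. -/
def edgeMatrixE7Tilde (S₁₀ S₅₆ : Matrix (Fin 2) (Fin 1) ℝ)
    (S₂₁ S₄₅ : Matrix (Fin 3) (Fin 2) ℝ) (S₃₂ S₃₄ : Matrix (Fin 4) (Fin 3) ℝ)
    (S₃₇ : Matrix (Fin 4) (Fin 2) ℝ) :
    ∀ v w : Fin 8, Matrix (Fin (rootE7Tilde v)) (Fin (rootE7Tilde w)) ℝ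
  | 1, 0 => S₁₀
  | 0, 1 => S₁₀ᵀ
  | 2, 1 => S₂₁
  | 1, 2 => S₂₁ᵀ
  | 3, 2 => S₃₂
  | 2, 3 => S₃₂ᵀ
  | 3, 4 => S₃₄
  | 4, 3 => S₃₄ᵀ
  | 4, 5 => S₄₅
  | 5, 4 => S₄₅ᵀ
  | 5, 6 => S₅₆
  | 6, 5 => S₅₆ᵀ
  | 3, 7 => S₃₇
  | 7, 3 => S₃₇ᵀ
  | _, _ => 0

-- The short arm takes two shifted copies of `(3, 4)`, scalar at vertex 7. One long arm takes the
-- orthogonal pair in rows 1, 2 and a unit vector in row 3, with distinct squared lengths 25, 9, 1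
-- as its continuation requires. The last arm completes their Jacobi sum.
set_option maxHeartbeats 1000000 in
theorem hasOrthoscalarModel_graphE7Tilde : HasOrthoscalarModel graphE7Tilde rootE7Tilde := by
  let S₃₄ : Matrix (Fin 4) (Fin 3) ℝ := !![0, 0, 0; 3, 12 / 5, 0; 4, -9 / 5, 0; 0, 0, 1]
  let S₃₇ : Matrix (Fin 4) (Fin 2) ℝ := !![3, 0; 4, 0; 0, 3; 0, 4]
  have hB : S₃₄ * S₃₄ᵀ = !![0, 0, 0, 0; 0, 369 / 25, 192 / 25, 0; 0, 192 / 25, 481 / 25, 0;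
      0, 0, 0, 1] := by
    ext i j
    fin_cases i <;> fin_cases j <;> norm_num [S₃₄, Matrix.mul_apply, Fin.sum_univ_succ]
  have hC : S₃₇ * S₃₇ᵀ = !![9, 12, 0, 0; 12, 16, 0, 0; 0, 0, 9, 12; 0, 0, 12, 16] := by
    ext i j
    fin_cases i <;> fin_cases j <;> norm_num [S₃₇, Matrix.mul_apply, Fin.sum_univ_succ]
  have hB' : S₃₄ᵀ * S₃₄ = diagonal ![25, 9, 1] := by
    ext i j
    fin_cases i <;> fin_cases j <;> norm_num [S₃₄, Matrix.mul_apply, Fin.sum_univ_succ]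
  have hC' : S₃₇ᵀ * S₃₇ = diagonal ![25, 25] := by
    ext i j
    fin_cases i <;> fin_cases j <;> norm_num [S₃₇, Matrix.mul_apply, Fin.sum_univ_succ]
  set J := S₃₄ * S₃₄ᵀ + S₃₇ * S₃₇ᵀ with hJdef
  have hJsym : Jᵀ = J := by simp [J]
  have hJ1 : ∀ i k : Fin 4, k.val = i.val + 1 → J i k ≠ 0 := by
    intro i k
    rw [hJdef, hB, hC]
    fin_cases i <;> fin_cases k <;> norm_num
  have hJ2 : ∀ i k : Fin 4, i.val + 1 < k.val → J i k = 0 := by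
    intro i k
    rw [hJdef, hB, hC]
    fin_cases i <;> fin_cases k <;> norm_num
  have hanti : StrictAnti (![25, 9, 1] : Fin 3 → ℝ) := by
    rw [Fin.strictAnti_iff_succ_lt]
    intro i
    fin_cases i
    · change (9 : ℝ) < 25
      norm_num
    · change (1 : ℝ) < 9
      norm_num
  obtain ⟨c, S₃₂, α, hS32, hS32', hα, hα0⟩ := exists_jacobi_complement hJsym
    (fun i => hJ1 _ _ rfl) hJ2
  obtain ⟨S₂₁, β, hS21, hS21', hβ, hβ0⟩ := exists_diagonal_complement hα
  obtain ⟨S₁₀, γ, hS10, hS10', -, hγ0⟩ := exists_diagonal_complement hβ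
  obtain ⟨S₄₅, ε, hS45, hS45', hε, hε0⟩ := exists_diagonal_complement hanti
  obtain ⟨S₅₆, ζ, hS56, hS56', -, hζ0⟩ := exists_diagonal_complement hε
  rw [← hS32'] at hS21
  rw [← hS21'] at hS10
  rw [← hS45'] at hS56
  refine ⟨edgeMatrixE7Tilde S₁₀ S₅₆ S₂₁ S₄₅ S₃₂ S₃₄ S₃₇, ?_, ?_, ?_, ?_⟩
  · intro v w
    fin_cases v <;> fin_cases w <;> rfl
  · intro v w
    fin_cases v <;> fin_cases w <;> first
      | exact fun _ => rfl
      | exact fun h => absurd ((SimpleGraph.fromRel_adj _ _ _).mpr (by decide)) h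
  · have h25 : (![25, 9, 1] : Fin 3 → ℝ) 0 = 25 := rfl
    have hS37 : S₃₇ᵀ * S₃₇ = (25 : ℝ) • 1 := by
      rw [hC', Matrix.smul_one_eq_diagonal]
      congr 1
      ext i
      fin_cases i <;> rfl
    rw [h25, ← hB'] at hS45
    rw [diagonal_eq_smul_one] at hS10' hS56'
    refine ⟨![γ 0, β 0, α 0, c, 25, ε 0, ζ 0, 25], fun v => ?_⟩
    fin_cases v
    · refine (Fintype.sum_eq_single 1 fun w hw => ?_).trans hS10'
      fin_cases w <;> first | exact absurd rfl hw | exact Matrix.zero_mul _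
    · refine (Fintype.sum_eq_add 2 0 (by decide) fun w hw => ?_).trans hS10
      fin_cases w <;> first | exact absurd rfl hw.1 | exact absurd rfl hw.2 |
        exact Matrix.zero_mul _
    · refine (Fintype.sum_eq_add 3 1 (by decide) fun w hw => ?_).trans hS21
      fin_cases w <;> first | exact absurd rfl hw.1 | exact absurd rfl hw.2 |
        exact Matrix.zero_mul _
    · refine (Fintype.sum_eq_add_add 2 4 7 (by decide) (by decide) (by decide)
        fun w h1 h2 h3 => ?_).trans hS32
      fin_cases w <;> first | exact absurd rfl h1 | exact absurd rfl h2 | exact absurd rfl h3 |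
        exact Matrix.zero_mul _
    · refine (Fintype.sum_eq_add 3 5 (by decide) fun w hw => ?_).trans hS45
      fin_cases w <;> first | exact absurd rfl hw.1 | exact absurd rfl hw.2 |
        exact Matrix.zero_mul _
    · refine (Fintype.sum_eq_add 4 6 (by decide) fun w hw => ?_).trans hS56
      fin_cases w <;> first | exact absurd rfl hw.1 | exact absurd rfl hw.2 |
        exact Matrix.zero_mul _
    · refine (Fintype.sum_eq_single 5 fun w hw => ?_).trans hS56'
      fin_cases w <;> first | exact absurd rfl hw | exact Matrix.zero_mul _
    · refine (Fintype.sum_eq_single 3 fun w hw => ?_).trans hS37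
      fin_cases w <;> first | exact absurd rfl hw | exact Matrix.zero_mul _
  · intro p hp
    let q : Matrix (Fin 4) (Fin 4) ℝ := p 3
    have hpB : q * (S₃₄ * S₃₄ᵀ) = S₃₄ * S₃₄ᵀ * q := commute_mul_transpose (hp 3 4) (hp 4 3)
    have hpC : q * (S₃₇ * S₃₇ᵀ) = S₃₇ * S₃₇ᵀ * q := commute_mul_transpose (hp 3 7) (hp 7 3)
    have hq : q = q 0 0 • 1 := by
      refine eq_smul_one_of_commute_hessenberg hJsym (fun i => hJ1 _ _ rfl) hJ2
        (by rw [Matrix.mul_add, Matrix.add_mul, hpB, hpC]) ?_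
      rw [hB] at hpB
      have e1 := congrFun (congrFun hpB 1) 0
      have e2 := congrFun (congrFun hpB 2) 0
      have e3 := congrFun (congrFun hpB 3) 0
      simp [Matrix.mul_apply, Fin.sum_univ_succ] at e1 e2 e3
      intro a ha
      fin_cases a
      · exact absurd rfl ha
      · change q 1 0 = 0
        linarith
      · change q 2 0 = 0
        linarith
      · exact e3.symm
    have pos : ∀ s, 0 < (![25, 9, 1] : Fin 3 → ℝ) s := by
      intro s
      fin_cases s <;> norm_num
    have pos' : ∀ s, 0 < (![25, 25] : Fin 2 → ℝ) s := by
      intro s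
      fin_cases s <;> norm_num
    have h2 := eq_smul_one_of_mul_eq hS32' hα0 (hp 3 2) hq
    have h1 := eq_smul_one_of_mul_eq hS21' hβ0 (hp 2 1) h2
    have h0 := eq_smul_one_of_mul_eq hS10' hγ0 (hp 1 0) h1
    have h4 := eq_smul_one_of_mul_eq hB' pos (hp 3 4) hq
    have h5 := eq_smul_one_of_mul_eq hS45' hε0 (hp 4 5) h4
    have h6 := eq_smul_one_of_mul_eq hS56' hζ0 (hp 5 6) h5
    have h7 := eq_smul_one_of_mul_eq hC' pos' (hp 3 7) hq
    refine ⟨q 0 0, fun v => ?_⟩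
    fin_cases v
    exacts [h0, h1, h2, hq, h4, h5, h6, h7]

end E7

/-! ### The graph `Ẽ₈` -/

section E8

/-- The minimal imaginary root of `Ẽ₈`. -/
def rootE8Tilde : Fin 9 → ℕ := ![1, 2, 3, 4, 5, 6, 4, 2, 3]

theorem isNullRoot_graphE8Tilde : IsNullRoot graphE8Tilde rootE8Tilde := by
  have hadj : ∀ v w, graphE8Tilde.Adj v w ↔ v ≠ w ∧
      (((w.val = v.val + 1 ∧ w.val ≤ 7) ∨ (v.val = 5 ∧ w.val = 8)) ∨
        ((v.val = w.val + 1 ∧ v.val ≤ 7) ∨ (w.val = 5 ∧ v.val = 8))) :=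
    fun v w => SimpleGraph.fromRel_adj _ v w
  refine ⟨preconnected_of_height Fin.val 0 fun v hv => ?_, by decide, ⟨0, rfl⟩, fun v _ => ?_⟩
  · simp only [hadj]
    revert v
    decide
  · simp only [hadj]
    revert v
    decide

/-- A family of matrices on the edges of `Ẽ₈`. -/
def edgeMatrixE8Tilde (S₁₀ : Matrix (Fin 2) (Fin 1) ℝ)
    (S₂₁ : Matrix (Fin 3) (Fin 2) ℝ) (S₃₂ : Matrix (Fin 4) (Fin 3) ℝ)
    (S₄₃ : Matrix (Fin 5) (Fin 4) ℝ) (S₅₄ : Matrix (Fin 6) (Fin 5) ℝ)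
    (S₅₆ : Matrix (Fin 6) (Fin 4) ℝ) (S₆₇ : Matrix (Fin 4) (Fin 2) ℝ)
    (S₅₈ : Matrix (Fin 6) (Fin 3) ℝ) :
    ∀ v w : Fin 9, Matrix (Fin (rootE8Tilde v)) (Fin (rootE8Tilde w)) ℝ
  | 1, 0 => S₁₀
  | 0, 1 => S₁₀ᵀ
  | 2, 1 => S₂₁
  | 1, 2 => S₂₁ᵀ
  | 3, 2 => S₃₂
  | 2, 3 => S₃₂ᵀ
  | 4, 3 => S₄₃
  | 3, 4 => S₄₃ᵀ
  | 5, 4 => S₅₄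
  | 4, 5 => S₅₄ᵀ
  | 5, 6 => S₅₆
  | 6, 5 => S₅₆ᵀ
  | 6, 7 => S₆₇
  | 7, 6 => S₆₇ᵀ
  | 5, 8 => S₅₈
  | 8, 5 => S₅₈ᵀ
  | _, _ => 0

-- Three copies of `(3, 4)` in rows 01, 23, 45 and two copies of the orthogonal pair in rows 12, 34
-- overlap to a Jacobi matrix of size 6. At vertex 6 the values 25, 25, 9, 9 drop by two dimensions
-- in one step, which `S₆₇` completes explicitly by 16 twice. The longest arm comes from the Jacobi
-- complement.
set_option maxHeartbeats 2000000 in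
theorem hasOrthoscalarModel_graphE8Tilde : HasOrthoscalarModel graphE8Tilde rootE8Tilde := by
  let S₅₆ : Matrix (Fin 6) (Fin 4) ℝ := !![0, 0, 0, 0; 3, 0, 12 / 5, 0; 4, 0, -9 / 5, 0;
    0, 3, 0, 12 / 5; 0, 4, 0, -9 / 5; 0, 0, 0, 0]
  let S₅₈ : Matrix (Fin 6) (Fin 3) ℝ := !![3, 0, 0; 4, 0, 0; 0, 3, 0; 0, 4, 0; 0, 0, 3; 0, 0, 4]
  let S₆₇ : Matrix (Fin 4) (Fin 2) ℝ := !![0, 0; 0, 0; 4, 0; 0, 4]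
  have hB : S₅₆ * S₅₆ᵀ = !![0, 0, 0, 0, 0, 0; 0, 369 / 25, 192 / 25, 0, 0, 0;
      0, 192 / 25, 481 / 25, 0, 0, 0; 0, 0, 0, 369 / 25, 192 / 25, 0;
      0, 0, 0, 192 / 25, 481 / 25, 0; 0, 0, 0, 0, 0, 0] := by
    ext i j
    fin_cases i <;> fin_cases j <;> norm_num [S₅₆, Matrix.mul_apply, Fin.sum_univ_succ]
  have hC : S₅₈ * S₅₈ᵀ = !![9, 12, 0, 0, 0, 0; 12, 16, 0, 0, 0, 0; 0, 0, 9, 12, 0, 0;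
      0, 0, 12, 16, 0, 0; 0, 0, 0, 0, 9, 12; 0, 0, 0, 0, 12, 16] := by
    ext i j
    fin_cases i <;> fin_cases j <;> norm_num [S₅₈, Matrix.mul_apply, Fin.sum_univ_succ]
  have hB' : S₅₆ᵀ * S₅₆ = diagonal ![25, 25, 9, 9] := by
    ext i j
    fin_cases i <;> fin_cases j <;> norm_num [S₅₆, Matrix.mul_apply, Fin.sum_univ_succ]
  have hC' : S₅₈ᵀ * S₅₈ = diagonal ![25, 25, 25] := by
    ext i j
    fin_cases i <;> fin_cases j <;> norm_num [S₅₈, Matrix.mul_apply, Fin.sum_univ_succ]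
  have hD' : S₆₇ᵀ * S₆₇ = diagonal ![16, 16] := by
    ext i j
    fin_cases i <;> fin_cases j <;> norm_num [S₆₇, Matrix.mul_apply, Fin.sum_univ_succ]
  have hE : S₆₇ * S₆₇ᵀ = diagonal ![0, 0, 16, 16] := by
    ext i j
    fin_cases i <;> fin_cases j <;> norm_num [S₆₇, Matrix.mul_apply, Fin.sum_univ_succ]
  have hD : S₅₆ᵀ * S₅₆ + S₆₇ * S₆₇ᵀ = (25 : ℝ) • 1 := by
    rw [hB', hE, Matrix.diagonal_add, Matrix.smul_one_eq_diagonal]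
    congr 1
    ext i
    fin_cases i <;> norm_num
  set J := S₅₆ * S₅₆ᵀ + S₅₈ * S₅₈ᵀ with hJdef
  have hJsym : Jᵀ = J := by simp [J]
  have hJ1 : ∀ i k : Fin 6, k.val = i.val + 1 → J i k ≠ 0 := by
    intro i k
    rw [hJdef, hB, hC]
    fin_cases i <;> fin_cases k <;> norm_num
  have hJ2 : ∀ i k : Fin 6, i.val + 1 < k.val → J i k = 0 := by
    intro i k
    rw [hJdef, hB, hC]
    fin_cases i <;> fin_cases k <;> norm_num
  obtain ⟨c, S₅₄, α, hS54, hS54', hα, hα0⟩ := exists_jacobi_complement hJsym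
    (fun i => hJ1 _ _ rfl) hJ2
  obtain ⟨S₄₃, β, hS43, hS43', hβ, hβ0⟩ := exists_diagonal_complement hα
  obtain ⟨S₃₂, γ, hS32, hS32', hγ, hγ0⟩ := exists_diagonal_complement hβ
  obtain ⟨S₂₁, ε, hS21, hS21', hε, hε0⟩ := exists_diagonal_complement hγ
  obtain ⟨S₁₀, ζ, hS10, hS10', -, hζ0⟩ := exists_diagonal_complement hε
  rw [← hS54'] at hS43
  rw [← hS43'] at hS32
  rw [← hS32'] at hS21
  rw [← hS21'] at hS10
  refine ⟨edgeMatrixE8Tilde S₁₀ S₂₁ S₃₂ S₄₃ S₅₄ S₅₆ S₆₇ S₅₈, ?_, ?_, ?_, ?_⟩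
  · intro v w
    fin_cases v <;> fin_cases w <;> rfl
  · intro v w
    fin_cases v <;> fin_cases w <;> first
      | exact fun _ => rfl
      | exact fun h => absurd ((SimpleGraph.fromRel_adj _ _ _).mpr (by decide)) h
  · have hS58 : S₅₈ᵀ * S₅₈ = (25 : ℝ) • 1 := by
      rw [hC', Matrix.smul_one_eq_diagonal]
      congr 1
      ext i
      fin_cases i <;> rfl
    have hS67 : S₆₇ᵀ * S₆₇ = (16 : ℝ) • 1 := by
      rw [hD', Matrix.smul_one_eq_diagonal]
      congr 1
      ext i
      fin_cases i <;> rfl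
    rw [diagonal_eq_smul_one] at hS10'
    refine ⟨![ζ 0, ε 0, γ 0, β 0, α 0, c, 25, 16, 25], fun v => ?_⟩
    fin_cases v
    · refine (Fintype.sum_eq_single 1 fun w hw => ?_).trans hS10'
      fin_cases w <;> first | exact absurd rfl hw | exact Matrix.zero_mul _
    · refine (Fintype.sum_eq_add 2 0 (by decide) fun w hw => ?_).trans hS10
      fin_cases w <;> first | exact absurd rfl hw.1 | exact absurd rfl hw.2 |
        exact Matrix.zero_mul _
    · refine (Fintype.sum_eq_add 3 1 (by decide) fun w hw => ?_).trans hS21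
      fin_cases w <;> first | exact absurd rfl hw.1 | exact absurd rfl hw.2 |
        exact Matrix.zero_mul _
    · refine (Fintype.sum_eq_add 4 2 (by decide) fun w hw => ?_).trans hS32
      fin_cases w <;> first | exact absurd rfl hw.1 | exact absurd rfl hw.2 |
        exact Matrix.zero_mul _
    · refine (Fintype.sum_eq_add 5 3 (by decide) fun w hw => ?_).trans hS43
      fin_cases w <;> first | exact absurd rfl hw.1 | exact absurd rfl hw.2 |
        exact Matrix.zero_mul _
    · refine (Fintype.sum_eq_add_add 4 6 8 (by decide) (by decide) (by decide)
        fun w h1 h2 h3 => ?_).trans hS54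
      fin_cases w <;> first | exact absurd rfl h1 | exact absurd rfl h2 | exact absurd rfl h3 |
        exact Matrix.zero_mul _
    · refine (Fintype.sum_eq_add 5 7 (by decide) fun w hw => ?_).trans hD
      fin_cases w <;> first | exact absurd rfl hw.1 | exact absurd rfl hw.2 |
        exact Matrix.zero_mul _
    · refine (Fintype.sum_eq_single 6 fun w hw => ?_).trans hS67
      fin_cases w <;> first | exact absurd rfl hw | exact Matrix.zero_mul _
    · refine (Fintype.sum_eq_single 5 fun w hw => ?_).trans hS58
      fin_cases w <;> first | exact absurd rfl hw | exact Matrix.zero_mul _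
  · intro p hp
    let q : Matrix (Fin 6) (Fin 6) ℝ := p 5
    have hpB : q * (S₅₆ * S₅₆ᵀ) = S₅₆ * S₅₆ᵀ * q := commute_mul_transpose (hp 5 6) (hp 6 5)
    have hpC : q * (S₅₈ * S₅₈ᵀ) = S₅₈ * S₅₈ᵀ * q := commute_mul_transpose (hp 5 8) (hp 8 5)
    have hq : q = q 0 0 • 1 := by
      refine eq_smul_one_of_commute_hessenberg hJsym (fun i => hJ1 _ _ rfl) hJ2
        (by rw [Matrix.mul_add, Matrix.add_mul, hpB, hpC]) ?_
      rw [hB] at hpB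
      rw [hC] at hpC
      -- Here the kernel of `S₅₆ * S₅₆ᵀ` is spanned by the first and the last basis vector, so `S₅₈
      -- * S₅₈ᵀ` is also needed: its unequal corner entries 9 and 16 force `q 5 0 = 0`.
      have e1 := congrFun (congrFun hpB 1) 0
      have e2 := congrFun (congrFun hpB 2) 0
      have e3 := congrFun (congrFun hpB 3) 0
      have e4 := congrFun (congrFun hpB 4) 0
      have e5 := congrFun (congrFun hpB 5) 1
      have e6 := congrFun (congrFun hpB 5) 2
      have e7 := congrFun (congrFun hpC 5) 0
      simp [Matrix.mul_apply, Fin.sum_univ_six] at e1 e2 e3 e4 e5 e6 e7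
      have z4 : q 4 0 = 0 := by linarith
      have z51 : q 5 1 = 0 := by linarith
      intro a ha
      fin_cases a
      · exact absurd rfl ha
      · change q 1 0 = 0
        linarith
      · change q 2 0 = 0
        linarith
      · change q 3 0 = 0
        linarith
      · exact z4
      · change q 5 0 = 0
        linarith
    have pos : ∀ s, 0 < (![25, 25, 9, 9] : Fin 4 → ℝ) s := by
      intro s
      fin_cases s <;> norm_num
    have pos' : ∀ s, 0 < (![25, 25, 25] : Fin 3 → ℝ) s := by
      intro s
      fin_cases s <;> norm_num
    have pos'' : ∀ s, 0 < (![16, 16] : Fin 2 → ℝ) s := by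
      intro s
      fin_cases s <;> norm_num
    have h4 := eq_smul_one_of_mul_eq hS54' hα0 (hp 5 4) hq
    have h3 := eq_smul_one_of_mul_eq hS43' hβ0 (hp 4 3) h4
    have h2 := eq_smul_one_of_mul_eq hS32' hγ0 (hp 3 2) h3
    have h1 := eq_smul_one_of_mul_eq hS21' hε0 (hp 2 1) h2
    have h0 := eq_smul_one_of_mul_eq hS10' hζ0 (hp 1 0) h1
    have h6 := eq_smul_one_of_mul_eq hB' pos (hp 5 6) hq
    have h7 := eq_smul_one_of_mul_eq hD' pos'' (hp 6 7) h6
    have h8 := eq_smul_one_of_mul_eq hC' pos' (hp 5 8) hq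
    refine ⟨q 0 0, fun v => ?_⟩
    fin_cases v
    exacts [h0, h1, h2, h3, h4, hq, h6, h7, h8]

end E8

end ExtendedDynkin

theorem theorem3 {V : Type u} [Fintype V] [Quiver.{v} V] [∀ i j : V, Fintype (i ⟶ j)]
    (even : Set V) (hsep : IsSeparatedBy V even) (hsingle : HasNoMultipleArrows V)
    (hG : IsExtendedDynkin (quiverGraph V))
    (δ : V → ℕ) (hδ : IsMinimalImaginaryRoot δ) :
    HilbertRep.DependsOnPositiveParameters
      {T : HilbertRep V δ | T.IsOrthoscalar even ∧ T.IsIndecomposable}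
      (Fintype.card V + 1) := by
  rcases hG with ⟨n, hn, ⟨e⟩⟩ | ⟨m, ⟨e⟩⟩ | ⟨⟨e⟩⟩ | ⟨⟨e⟩⟩ | ⟨⟨e⟩⟩
  · exact dependsOnPositiveParameters_of_iso (isNullRoot_cycleGraph hn)
      (hasOrthoscalarModel_cycleGraph hn) e hsep hsingle hδ
  · exact dependsOnPositiveParameters_of_iso (isNullRoot_graphDTilde m)
      (hasOrthoscalarModel_graphDTilde m) e hsep hsingle hδ
  · exact dependsOnPositiveParameters_of_iso isNullRoot_graphE6Tilde
      hasOrthoscalarModel_graphE6Tilde e hsep hsingle hδ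
  · exact dependsOnPositiveParameters_of_iso isNullRoot_graphE7Tilde
      hasOrthoscalarModel_graphE7Tilde e hsep hsingle hδ
  · exact dependsOnPositiveParameters_of_iso isNullRoot_graphE8Tilde
      hasOrthoscalarModel_graphE8Tilde e hsep hsingle hδ
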